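/- \textbf{Setting.} A \emph{weight sequence} is a sequence $M=(M_p)_{p\in\mathbb N}$ of positive numbers with $M_0=M_1=1$, $M_p^{1/p}\to\infty$ and $M_p^2\le M_{p-1}M_{p+1}$ for $p\ge1$. Put $m_p=M_p/M_{p-1}$ for $p\ge 1$, and $M_\alpha=M_{|\alpha|}$ for $\alpha\in\mathbb N^d$. Assume that $M$ is a weight sequence satisfying $(M.2)$: there are $C_0,H\ge1$ with $M_{p+q}\le C_0H^{p+q}M_pM_q$ for all $p,q\in\mathbb N$; $(M.2)^*$: there are integers $p_0,N\ge1$ with $2m_p\le m_{Np}$ for all $p\ge p_0$. For $h>0$ and a positive continuous function $w$ on $\mathbb R^d$ let $\mathcal B^{M,h}_w$ be the Banach space of all $\varphi\in C^\infty(\mathbb R^d)$ (complex-valued) with $$\sup_{\alpha\in\mathbb N^d}\sup_{x\in\mathbb R^d}\frac{h^{|\alpha|}|\partial^\alpha\varphi(x)|\,w(x)}{M_\alpha}<\infty .$$ Let $\mathcal K^{M,h}=\bigcap_{n\in\mathbb N}\mathcal B^{M,h}_{e^{n|\cdot|}}$, $\mathcal K^{(M)}=\bigcap_{h>0}\mathcal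 K^{M,h}$ and $\mathcal K^{\{M\}}=\bigcup_{h>0}\mathcal K^{M,h}$. An \emph{increasing weight system} is a pointwise increasing sequence $\mathcal W=(w_n)_{n\in\mathbb N}$ of positive continuous functions on $\mathbb R^d$ such that for every $n$ there is $m\ge n$ with $\lim_{|x|\to\infty}w_n(x)/w_m(x)=0$, and for every $n$ there are $m\ge n$ and $\kappa,C>0$ with $w_n(x+y)\le Cw_m(x)e^{\kappa|y|}$ for all $x,y\in\mathbb R^d$. Put $$\mathcal B^{(M)}_{\mathcal W}=\varprojlim_{n\ge1}\mathcal B^{M,n}_{w_n},\qquad \mathcal B^{M,h}_{\mathcal W}=\varprojlim_{n}\mathcal B^{M,h}_{w_n},\qquad \mathcal B^{\{M\}}_{\mathcal W}=\bigcup_{h>0}\mathcal B^{M,h}_{\mathcal W}.$$ A \emph{decreasing weight system} is a pointwise decreasing sequence $\mathcal V=(v_n)_{n\in\mathbb N}$ of positive continuous functions on $\mathbb R^d$ such that for every $n$ there is $m\ge n$ with $\lim_{|x|\to\infty}v_m(x)/v_n(x)=0$, and for every $n$ there are $m\ge n$ and $\kappa,C>0$ with $v_m(x+y)\le Cv_n(x)e^{\kappa|y|}$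 for all $x,y\in\mathbb R^d$. Put $$\mathcal B^{(M)}_{v_n}=\varprojlim_{h\to\infty}\mathcal B^{M,h}_{v_n},\qquad \mathcal B^{(M)}_{\mathcal V}=\bigcup_{n}\mathcal B^{(M)}_{v_n},\qquad \mathcal B^{\{M\}}_{\mathcal V}=\varinjlim_{n\ge1}\mathcal B^{M,1/n}_{v_n},$$ where the last space, as a set the union of its steps, carries the locally convex inductive limit topology and projective limits carry the projective limit topology. Write $\psi*\varphi(x)=\int_{\mathbb R^d}\psi(y)\varphi(x-y)\,dy$, $\psi*A=\{\psi*\varphi:\varphi\in A\}$ and $K*X=\{\psi*\varphi:\psi\in K,\ \varphi\in X\}$. The notation $[M]$ stands for either $(M)$ (Beurling case) or $\{M\}$ (Roumieu case), the same choice throughout a formula. \textbf{Theorem.} All convolution integrals occurring below converge absolutely at every point. (i) Let $\mathcal W=(w_n)$ be an increasing weight system. Then $\mathcal K^{[M]}*\mathcal B^{[M]}_{\mathcal W}=\mathcal B^{[M]}_{\mathcal W}$. Moreover, in the Beurling case, for every bounded set $B\subset\mathcal B^{(M)}_{\mathcal W}$ there are $\psi\in\mathcal K^{(M)}$ and a bounded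 set $A\subset\mathcal B^{(M)}_{\mathcal W}$ with $\psi*A=B$. In the Roumieu case, for every $h>0$ and every bounded set $B\subset\mathcal B^{M,h}_{\mathcal W}$ there are $\psi\in\mathcal K^{\{M\}}$, $k>0$ and a bounded set $A\subset\mathcal B^{M,k}_{\mathcal W}$ with $\psi*A=B$. (ii) Let $\mathcal V=(v_n)$ be a decreasing weight system. Then $\mathcal K^{[M]}*\mathcal B^{[M]}_{\mathcal V}=\mathcal B^{[M]}_{\mathcal V}$. Moreover, in the Beurling case, for every $n\in\mathbb N$ and every bounded set $B\subset\mathcal B^{(M)}_{v_n}$ there are $\psi\in\mathcal K^{(M)}$, $m\in\mathbb N$ and a bounded set $A\subset\mathcal B^{(M)}_{v_m}$ with $\psi*A=B$. In the Roumieu case, for every bounded set $B\subset\mathcal B^{\{M\}}_{\mathcal V}$ there are $\psi\in\mathcal K^{\{M\}}$ and a bounded set $A\subset\mathcal B^{\{M\}}_{\mathcal V}$ with $\psi*A=B$. -/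

import Mathlib

open MeasureTheory Filter Topology
open scoped ContDiff Convolution

noncomputable section

namespace Ultra

/-! ### Weight sequences -/

/-- A weight sequence: a log-convex sequence of positive numbers with `M 0 = M 1 = 1` and
`(M p)^(1/p) → ∞`. -/
structure WeightSequence where
  /-- the terms of the sequence -/
  M : ℕ → ℝ
  pos : ∀ p, 0 < M p
  zero : M 0 = 1
  one : M 1 = 1
  tendsto_root : Tendsto (fun p : ℕ => M p ^ (1 / (p : ℝ))) atTop atTop
  log_convex : ∀ p, 1 ≤ p → M p ^ 2 ≤ M (p - 1) * M (p + 1)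

/-- The quotients `m p = M p / M (p - 1)`, used for `p ≥ 1` only. -/
def WeightSequence.quot (M : WeightSequence) (p : ℕ) : ℝ := M.M p / M.M (p - 1)

/-- Condition `(M.2)` (stability under ultradifferential operators). -/
def WeightSequence.M2 (M : WeightSequence) : Prop :=
  ∃ C₀ H : ℝ, 1 ≤ C₀ ∧ 1 ≤ H ∧ ∀ p q : ℕ, M.M (p + q) ≤ C₀ * H ^ (p + q) * M.M p * M.M q

/-- Condition `(M.2)^*`. -/
def WeightSequence.M2star (M : WeightSequence) : Prop :=
  ∃ p₀ N : ℕ, 1 ≤ p₀ ∧ 1 ≤ N ∧ ∀ p, p₀ ≤ p → 2 * M.quot p ≤ M.quot (N * p)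

/-! ### Weight systems -/

/-- `ℝ^d` with the Euclidean norm. -/
abbrev Rd (d : ℕ) : Type := EuclideanSpace ℝ (Fin d)

/-- A positive continuous function on `ℝ^d`. -/
structure Weight (d : ℕ) where
  /-- the underlying function -/
  toFun : Rd d → ℝ
  continuous : Continuous toFun
  pos : ∀ x, 0 < toFun x

instance (d : ℕ) : CoeFun (Weight d) (fun _ => Rd d → ℝ) := ⟨Weight.toFun⟩

/-- The weight `x ↦ exp (n |x|)`. -/
def expWeight (d n : ℕ) : Weight d where
  toFun x := Real.exp (n * ‖x‖)
  continuous := by fun_prop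
  pos _ := Real.exp_pos _

/-- An increasing weight system `(w n)`. -/
structure IncreasingWeightSystem (d : ℕ) where
  /-- the weights -/
  w : ℕ → Weight d
  mono : ∀ n m, n ≤ m → ∀ x, w n x ≤ w m x
  proper : ∀ n, ∃ m, n ≤ m ∧ Tendsto (fun x => w n x / w m x) (cocompact (Rd d)) (𝓝 0)
  exp_bdd : ∀ n, ∃ m, n ≤ m ∧ ∃ κ C : ℝ, 0 < κ ∧ 0 < C ∧
    ∀ x y, w n (x + y) ≤ C * w m x * Real.exp (κ * ‖y‖)

/-- A decreasing weight system `(v n)`. -/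
structure DecreasingWeightSystem (d : ℕ) where
  /-- the weights -/
  v : ℕ → Weight d
  anti : ∀ n m, n ≤ m → ∀ x, v m x ≤ v n x
  proper : ∀ n, ∃ m, n ≤ m ∧ Tendsto (fun x => v m x / v n x) (cocompact (Rd d)) (𝓝 0)
  exp_bdd : ∀ n, ∃ m, n ≤ m ∧ ∃ κ C : ℝ, 0 < κ ∧ 0 < C ∧
    ∀ x y, v m (x + y) ≤ C * v n x * Real.exp (κ * ‖y‖)

/-! ### Smooth functions and partial derivatives -/

/-- The space `C^∞(ℝ^d)` of complex-valued smooth functions. -/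
def Smooth (d : ℕ) : Submodule ℂ (Rd d → ℂ) where
  carrier := {f | ContDiff ℝ ∞ f}
  add_mem' {f g} hf hg := by
    have hf' : ContDiff ℝ ∞ f := hf
    have hg' : ContDiff ℝ ∞ g := hg
    exact hf'.add hg'
  zero_mem' := by
    have h : ContDiff ℝ ∞ (fun _ : Rd d => (0 : ℂ)) := contDiff_const
    exact h
  smul_mem' c f hf := by
    have hf' : ContDiff ℝ ∞ f := hf
    exact hf'.const_smul c

theorem contDiff_coe {d : ℕ} (f : Smooth d) : ContDiff ℝ ∞ (f : Rd d → ℂ) := f.2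

theorem differentiableAt_coe {d : ℕ} (f : Smooth d) (x : Rd d) :
    DifferentiableAt ℝ (f : Rd d → ℂ) x :=
  ((contDiff_coe f).differentiable (by simp)).differentiableAt

/-- The partial derivative `∂_i`, as a linear operator on `C^∞(ℝ^d)`. -/
def pderiv {d : ℕ} (i : Fin d) : Module.End ℂ (Smooth d) where
  toFun f := ⟨fun x => fderiv ℝ (f : Rd d → ℂ) x (EuclideanSpace.single i 1), by
    have h : ContDiff ℝ ∞ (fun x => fderiv ℝ (f : Rd d → ℂ) x (EuclideanSpace.single i 1)) :=
      ((contDiff_coe f).fderiv_right (m := ∞) (by simp)).clm_apply contDiff_const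
    exact h⟩
  map_add' f g := by
    ext x
    change fderiv ℝ ((f : Rd d → ℂ) + (g : Rd d → ℂ)) x _ = fderiv ℝ _ x _ + fderiv ℝ _ x _
    rw [fderiv_add (differentiableAt_coe f x) (differentiableAt_coe g x)]
    rfl
  map_smul' c f := by
    ext x
    change fderiv ℝ (c • (f : Rd d → ℂ)) x _ = c • fderiv ℝ _ x _
    rw [fderiv_const_smul (differentiableAt_coe f x) c]
    rfl

/-- The derivative `∂^α` for a multi-index `α`, as a linear operator on `C^∞(ℝ^d)`. -/
def mderiv {d : ℕ} (α : Fin d → ℕ) : Module.End ℂ (Smooth d) :=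
  ((List.finRange d).map fun i => pderiv i ^ α i).prod

/-- The length `|α|` of a multi-index. -/
def len {d : ℕ} (α : Fin d → ℕ) : ℕ := ∑ i, α i

/-! ### The Banach spaces `B^{M,h}_w` -/

/-- Positive real numbers. -/
abbrev PosReal : Type := {h : ℝ // 0 < h}

/-- The quantity `h^{|α|} |∂^α φ(x)| w(x) / M_α` for `a = (α, x)`. -/
def term {d : ℕ} (M : WeightSequence) (h : PosReal) (w : Weight d) (φ : Smooth d)
    (a : (Fin d → ℕ) × Rd d) : ℝ :=
  (h : ℝ) ^ len a.1 * ‖(mderiv a.1 φ : Rd d → ℂ) a.2‖ * w a.2 / M.M (len a.1)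

theorem term_nonneg {d : ℕ} (M : WeightSequence) (h : PosReal) (w : Weight d) (φ : Smooth d)
    (a : (Fin d → ℕ) × Rd d) : 0 ≤ term M h w φ a :=
  div_nonneg (mul_nonneg (mul_nonneg (pow_nonneg h.2.le _) (norm_nonneg _)) (w.pos _).le)
    (M.pos _).le

theorem term_add_le {d : ℕ} (M : WeightSequence) (h : PosReal) (w : Weight d) (φ χ : Smooth d)
    (a : (Fin d → ℕ) × Rd d) : term M h w (φ + χ) a ≤ term M h w φ a + term M h w χ a := by
  have h1 : ‖(mderiv a.1 (φ + χ) : Rd d → ℂ) a.2‖ ≤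
      ‖(mderiv a.1 φ : Rd d → ℂ) a.2‖ + ‖(mderiv a.1 χ : Rd d → ℂ) a.2‖ := by
    rw [map_add]; exact norm_add_le _ _
  unfold term
  rw [← add_div, ← add_mul, ← mul_add]
  exact div_le_div_of_nonneg_right (mul_le_mul_of_nonneg_right
    (mul_le_mul_of_nonneg_left h1 (pow_nonneg h.2.le _)) (w.pos _).le) (M.pos _).le

theorem term_smul {d : ℕ} (M : WeightSequence) (h : PosReal) (w : Weight d) (c : ℂ)
    (φ : Smooth d) (a : (Fin d → ℕ) × Rd d) : term M h w (c • φ) a = ‖c‖ * term M h w φ a := by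
  have h1 : ‖(mderiv a.1 (c • φ) : Rd d → ℂ) a.2‖ = ‖c‖ * ‖(mderiv a.1 φ : Rd d → ℂ) a.2‖ := by
    rw [map_smul]; exact norm_smul c ((mderiv a.1 φ : Rd d → ℂ) a.2)
  unfold term
  rw [h1]; ring

theorem term_mono {d : ℕ} (M : WeightSequence) {h k : PosReal} {w u : Weight d}
    (hk : (h : ℝ) ≤ k) (hw : ∀ x, w x ≤ u x) (φ : Smooth d) (a : (Fin d → ℕ) × Rd d) :
    term M h w φ a ≤ term M k u φ a :=
  div_le_div_of_nonneg_right (mul_le_mul (mul_le_mul_of_nonneg_right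
    (pow_le_pow_left₀ h.2.le hk _) (norm_nonneg _)) (hw _) (w.pos _).le
    (mul_nonneg (pow_nonneg k.2.le _) (norm_nonneg _))) (M.pos _).le

/-- The space `B^{M,h}_w` of all smooth `φ` with
`sup_{α, x} h^{|α|} |∂^α φ(x)| w(x) / M_α < ∞`. -/
def BSpace {d : ℕ} (M : WeightSequence) (h : PosReal) (w : Weight d) :
    Submodule ℂ (Smooth d) where
  carrier := {φ | BddAbove (Set.range (term M h w φ))}
  add_mem' := by
    rintro φ χ ⟨C, hC⟩ ⟨D, hD⟩
    refine ⟨C + D, ?_⟩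
    rintro _ ⟨a, rfl⟩
    exact (term_add_le M h w φ χ a).trans (add_le_add (hC ⟨a, rfl⟩) (hD ⟨a, rfl⟩))
  zero_mem' := by
    refine ⟨0, ?_⟩
    rintro _ ⟨a, rfl⟩
    have := term_smul M h w 0 0 a
    simp only [zero_smul, norm_zero, zero_mul] at this
    exact this.le
  smul_mem' := by
    rintro c φ ⟨C, hC⟩
    refine ⟨‖c‖ * C, ?_⟩
    rintro _ ⟨a, rfl⟩
    rw [term_smul]
    exact mul_le_mul_of_nonneg_left (hC ⟨a, rfl⟩) (norm_nonneg c)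

theorem BSpace_anti {d : ℕ} (M : WeightSequence) {h k : PosReal} {w u : Weight d}
    (hk : (h : ℝ) ≤ k) (hw : ∀ x, w x ≤ u x) : BSpace M k u ≤ BSpace M h w := by
  rintro φ ⟨C, hC⟩
  refine ⟨C, ?_⟩
  rintro _ ⟨a, rfl⟩
  exact (term_mono M hk hw φ a).trans (hC ⟨a, rfl⟩)

/-- The norm `sup_{α, x} h^{|α|} |∂^α φ(x)| w(x) / M_α` of `B^{M,h}_w`. -/
def BNorm {d : ℕ} (M : WeightSequence) (h : PosReal) (w : Weight d) :
    Seminorm ℂ (BSpace M h w) :=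
  Seminorm.of (fun φ => ⨆ a, term M h w φ a)
    (fun φ χ => ciSup_le fun a => (term_add_le M h w φ χ a).trans
      (add_le_add (le_ciSup φ.2 a) (le_ciSup χ.2 a)))
    (fun c φ => by
      rw [Real.mul_iSup_of_nonneg (norm_nonneg c)]
      exact iSup_congr fun a => term_smul M h w c φ a)

/-! ### Projective limits -/

/-- The projective limit (intersection) of the spaces `B^{M, h i}_{w i}`. -/
def projSpace {d : ℕ} {ι : Type} (M : WeightSequence) (h : ι → PosReal) (w : ι → Weight d) :
    Submodule ℂ (Smooth d) :=
  ⨅ i, BSpace M (h i) (w i)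

/-- The locally convex projective limit topology on the intersection of the spaces
`B^{M, h i}_{w i}`: it is generated by the restrictions of all their norms. -/
abbrev projTopology {d : ℕ} {ι : Type} [Nonempty ι] (M : WeightSequence) (h : ι → PosReal)
    (w : ι → Weight d) : TopologicalSpace (projSpace M h w) :=
  SeminormFamily.moduleFilterBasis (𝕜 := ℂ) (ι := ι) (fun i =>
    (BNorm M (h i) (w i)).comp (Submodule.inclusion (iInf_le _ i))) |>.topology

/-- `A` is contained in the space `X` and bounded for the vector topology `t` of `X`. -/
def BoundedIn {d : ℕ} (X : Submodule ℂ (Smooth d)) (t : TopologicalSpace X)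
    (A : Set (Smooth d)) : Prop :=
  A ⊆ X ∧ @Bornology.IsVonNBounded ℂ X _ _ _ t (Subtype.val ⁻¹' A)

/-! ### The convolution algebras `K^{(M)}` and `K^{\{M\}}` -/

/-- The space `K^{M,h}` of smooth functions with
`sup_{α, x} h^{|α|} |∂^α φ(x)| exp (n |x|) / M_α < ∞` for all `n`. -/
def KSpace (d : ℕ) (M : WeightSequence) (h : PosReal) : Submodule ℂ (Smooth d) :=
  projSpace M (fun _ : ℕ => h) (fun n => expWeight d n)

/-- `K^{(M)}`, the intersection of all `K^{M,h}`, `h > 0`. -/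
def KBeurling (d : ℕ) (M : WeightSequence) : Set (Smooth d) := {ψ | ∀ h, ψ ∈ KSpace d M h}

/-- `K^{\{M\}}`, the union of all `K^{M,h}`, `h > 0`. -/
def KRoumieu (d : ℕ) (M : WeightSequence) : Set (Smooth d) := {ψ | ∃ h, ψ ∈ KSpace d M h}

/-! ### Spaces defined by an increasing weight system -/

/-- A positive integer as a positive real number. -/
def posNat (n : ℕ+) : PosReal := ⟨(n : ℝ), by exact_mod_cast n.pos⟩

/-- The reciprocal `1 / n` of a positive integer as a positive real number. -/
def posInv (n : ℕ+) : PosReal := ⟨1 / (n : ℝ), one_div_pos.mpr (posNat n).2⟩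

section Increasing

variable {d : ℕ} (M : WeightSequence) (W : IncreasingWeightSystem d)

/-- `B^{(M)}_W`, the projective limit of `B^{M,n}_{w_n}` over the positive integers `n`. -/
def BWBeurling : Submodule ℂ (Smooth d) := projSpace M posNat (fun n : ℕ+ => W.w n)

/-- The topology of `B^{(M)}_W`. -/
abbrev BWBeurlingTop : TopologicalSpace (BWBeurling M W) :=
  projTopology M posNat (fun n : ℕ+ => W.w n)

/-- `B^{M,h}_W`, the projective limit of `B^{M,h}_{w_n}` over all `n`. -/
def BWStep (h : PosReal) : Submodule ℂ (Smooth d) := projSpace M (fun _ : ℕ => h) W.w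

/-- The topology of `B^{M,h}_W`. -/
abbrev BWStepTop (h : PosReal) : TopologicalSpace (BWStep M W h) :=
  projTopology M (fun _ : ℕ => h) W.w

/-- `B^{\{M\}}_W`, the union of all `B^{M,h}_W`, `h > 0`. -/
def BWRoumieu : Set (Smooth d) := {φ | ∃ h, φ ∈ BWStep M W h}

end Increasing

/-! ### Spaces defined by a decreasing weight system -/

/-- `B^{(M)}_v`, the projective limit of `B^{M,h}_v` over all `h > 0`. -/
def BVStep {d : ℕ} (M : WeightSequence) (v : Weight d) : Submodule ℂ (Smooth d) :=
  projSpace M (fun h : PosReal => h) (fun _ => v)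

/-- The topology of `B^{(M)}_v`. -/
abbrev BVStepTop {d : ℕ} (M : WeightSequence) (v : Weight d) : TopologicalSpace (BVStep M v) :=
  haveI : Nonempty PosReal := ⟨⟨1, one_pos⟩⟩
  projTopology M (fun h : PosReal => h) (fun _ => v)

section Decreasing

variable {d : ℕ} (M : WeightSequence) (V : DecreasingWeightSystem d)

/-- `B^{(M)}_V`, the union of all `B^{(M)}_{v_n}`. -/
def BVBeurling : Set (Smooth d) := {φ | ∃ n, φ ∈ BVStep M (V.v n)}

theorem BV_mono {n m : ℕ+} (h : n ≤ m) :
    BSpace M (posInv n) (V.v n) ≤ BSpace M (posInv m) (V.v m) :=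
  BSpace_anti M (one_div_le_one_div_of_le (posNat n).2 (by exact_mod_cast h))
    (V.anti n m (by exact_mod_cast h))

/-- `B^{\{M\}}_V`, the union of the spaces `B^{M,1/n}_{v_n}` over the positive integers `n`. -/
def BVRoumieu : Submodule ℂ (Smooth d) where
  carrier := {φ | ∃ n : ℕ+, φ ∈ BSpace M (posInv n) (V.v n)}
  add_mem' := by
    rintro φ χ ⟨n, hn⟩ ⟨m, hm⟩
    exact ⟨max n m, Submodule.add_mem _ (BV_mono M V (le_max_left n m) hn)
      (BV_mono M V (le_max_right n m) hm)⟩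
  zero_mem' := ⟨1, Submodule.zero_mem _⟩
  smul_mem' := by
    rintro c φ ⟨n, hn⟩
    exact ⟨n, Submodule.smul_mem _ c hn⟩

theorem BSpace_le_BVRoumieu (n : ℕ+) : BSpace M (posInv n) (V.v n) ≤ BVRoumieu M V :=
  fun _ hφ => ⟨n, hφ⟩

/-- The seminorms on `B^{\{M\}}_V` whose restriction to each Banach space `B^{M,1/n}_{v_n}` is
continuous, that is, dominated by a multiple of the norm. -/
def BVRoumieuSeminorm : Type :=
  {p : Seminorm ℂ (BVRoumieu M V) // ∀ n : ℕ+, ∃ C : ℝ, ∀ φ : BSpace M (posInv n) (V.v n),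
    p (Submodule.inclusion (BSpace_le_BVRoumieu M V n) φ) ≤ C * BNorm M (posInv n) (V.v n) φ}

instance : Nonempty (BVRoumieuSeminorm M V) :=
  ⟨⟨0, fun _ => ⟨0, fun _ => by simp⟩⟩⟩

/-- The locally convex inductive limit topology on `B^{\{M\}}_V`, the finest locally convex
topology for which all the inclusions `B^{M,1/n}_{v_n} → B^{\{M\}}_V` are continuous: it is
generated by all seminorms whose restriction to each step is continuous. -/
abbrev BVRoumieuTop : TopologicalSpace (BVRoumieu M V) :=
  SeminormFamily.moduleFilterBasis (𝕜 := ℂ) (ι := BVRoumieuSeminorm M V)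
    (fun p => p.1) |>.topology

end Decreasing

/-! ### Convolution -/

/-- The convolution `(ψ ∗ φ)(x) = ∫ ψ(y) φ(x - y) dy`. -/
def conv {d : ℕ} (ψ φ : Smooth d) : Rd d → ℂ :=
  MeasureTheory.convolution (ψ : Rd d → ℂ) (φ : Rd d → ℂ) (ContinuousLinearMap.mul ℂ ℂ) volume

/-- The integral defining `(ψ ∗ φ)(x)` converges absolutely for every `x`. -/
def ConvExists {d : ℕ} (ψ φ : Smooth d) : Prop :=
  MeasureTheory.ConvolutionExists (ψ : Rd d → ℂ) (φ : Rd d → ℂ)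
    (ContinuousLinearMap.mul ℂ ℂ) volume

/-- A set of smooth functions, regarded as a set of functions. -/
def asFunctions {d : ℕ} (A : Set (Smooth d)) : Set (Rd d → ℂ) :=
  (fun φ : Smooth d => (φ : Rd d → ℂ)) '' A

/-- All the convolutions `ψ ∗ φ` with `ψ ∈ K`, `φ ∈ X` exist, and `K ∗ X = X`, where
`K ∗ X = {ψ ∗ φ | ψ ∈ K, φ ∈ X}`. -/
def FactorsThrough {d : ℕ} (K X : Set (Smooth d)) : Prop :=
  (∀ ψ ∈ K, ∀ φ ∈ X, ConvExists ψ φ) ∧ Set.image2 conv K X = asFunctions X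

/-- `ψ ∗ A = B`, where `ψ ∗ A = {ψ ∗ φ | φ ∈ A}`. -/
def ConvSetEq {d : ℕ} (ψ : Smooth d) (A B : Set (Smooth d)) : Prop :=
  conv ψ '' A = asFunctions B

end Ultra

end

noncomputable section

namespace Ultra

/-! ### The associated function of a weight sequence -/

namespace WeightSequence

variable (M : WeightSequence)

/-! Convolution by one ψ has to be inverted on a whole bounded set B. The Fourier transform of ψ is
taken to be exp(-q), a zero-free entire function whose size is controlled by powers of exp
ω_M(θ|ξ|), where ω_M = log `assoc`. The growth function θ must be large enough for ψ to belong to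
the algebra, and small enough for the regularity of B to absorb exp(q).

The exponent q is the Gaussian regularization of ω_M ∘ θ. By (M.2)^*, ω_M(2t) is at most a multiple
of 1 + ω_M(t); since ω_M is convex in log t, the variation of ω_M ∘ θ is then linear in the dilation
(`M2star.slowlyVarying`). Therefore Re q is comparable with ω_M ∘ θ on each horizontal strip
(`re_gaussReg_bounds`), and contour shifts give decay of the inverse transforms faster than every
exponential (`norm_invF_le`).

Elements of B may grow exponentially, so division takes place after a short-time Fourier transform.
Let g be a window with transform exp(-q₀), q₀ growing faster than all admissible q, and let κ_τ have
the transform exp(q) exp(-q₀(· - τ)). Then ψ * κ_τ = exp(2πiτ·) g, and the size of κ_τ is polynomial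
in exp ω_M(θ|τ|) (`exists_kernels`). In dimension d tensor products are used, and Tφ(x) = c ∬ κ_t(y)
V_gφ(t, x - y) dy dt. Convolution with ψ replaces κ_t by the modulated window, and Fourier inversion
of V_gφ in t returns a constant multiple of φ (`Tame.integral_conv_deconv`). The constant (∫ g(y)
g(-y) dy)^d is nonzero because g(-y) is the conjugate of g(y). Integration by parts and (M.2) make
V_gφ decay like 1/exp ω_M(h|t|/H) (`stft_mul_assoc_le`). The integral converges, with the right
bounds, when this decay beats the growth of κ_t; `Tame` records that requirement.

In the Roumieu case θ(t) = st with s small (`exists_deconv_roumieu`). In the Beurling case θ(t) = t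
f(t), where f tends to infinity so slowly, depending on the norms of B at all scales, that the scale
h can be adapted to the frequency (`exists_slowFactor`, `exists_deconv_beurling`). The inclusion K *
X ⊆ X is a direct estimate, its converse is the result for singletons, and bounded sets of the
Roumieu inductive limit lie in a step (`BoundedIn.exists_bnd`). -/

theorem eventually_pow_le (r : ℝ) : ∀ᶠ p : ℕ in atTop, |r| ^ p ≤ M.M p := by
  filter_upwards [M.tendsto_root.eventually_ge_atTop |r|, eventually_gt_atTop 0] with p hp h0
  calc |r| ^ p ≤ (M.M p ^ (1 / (p : ℝ))) ^ p := pow_le_pow_left₀ (abs_nonneg r) hp p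
    _ = M.M p := by
      rw [one_div, Real.rpow_inv_natCast_pow (M.pos p).le h0.ne']

/-- The function `exp ∘ ω_M`, where `ω_M` is the associated function of `M`. -/
def assoc (t : ℝ) : ℝ := ⨆ p : ℕ, t ^ p / M.M p

theorem bddAbove_assoc (t : ℝ) : BddAbove (Set.range fun p : ℕ => t ^ p / M.M p) := by
  refine Filter.IsBoundedUnder.bddAbove_range ⟨1, ?_⟩
  simp only [eventually_map]
  filter_upwards [M.eventually_pow_le t] with p hp
  rw [div_le_one (M.pos p)]
  exact (le_abs_self _).trans ((abs_pow t p).le.trans hp)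

theorem div_le_assoc (t : ℝ) (p : ℕ) : t ^ p / M.M p ≤ M.assoc t :=
  le_ciSup (M.bddAbove_assoc t) p

theorem pow_le_mul_assoc (t : ℝ) (p : ℕ) : t ^ p ≤ M.M p * M.assoc t := by
  have := M.div_le_assoc t p
  rwa [div_le_iff₀' (M.pos p)] at this

theorem one_le_assoc (t : ℝ) : 1 ≤ M.assoc t := by
  simpa [M.zero] using M.div_le_assoc t 0

theorem assoc_pos (t : ℝ) : 0 < M.assoc t := one_pos.trans_le (M.one_le_assoc t)

theorem self_le_assoc (t : ℝ) : t ≤ M.assoc t := by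
  simpa [M.one] using M.div_le_assoc t 1

theorem assoc_mono {s t : ℝ} (hs : 0 ≤ s) (hst : s ≤ t) : M.assoc s ≤ M.assoc t :=
  ciSup_le fun p => (div_le_div_of_nonneg_right (pow_le_pow_left₀ hs hst p) (M.pos p).le).trans
    (M.div_le_assoc t p)

theorem assoc_zero : M.assoc 0 = 1 := by
  refine le_antisymm (ciSup_le fun p => ?_) (M.one_le_assoc 0)
  rcases p with _ | p
  · simp [M.zero]
  · simp

theorem quot_pos (p : ℕ) : 0 < M.quot p := div_pos (M.pos _) (M.pos _)

theorem succ_eq (p : ℕ) : M.M (p + 1) = M.quot (p + 1) * M.M p := by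
  have := (M.pos p).ne'
  simp only [quot, Nat.add_sub_cancel]
  field_simp

theorem quot_le_succ (p : ℕ) : M.quot (p + 1) ≤ M.quot (p + 2) := by
  have h := M.log_convex (p + 1) (by omega)
  simp only [quot, Nat.add_sub_cancel] at h ⊢
  rw [show p + 2 - 1 = p + 1 by omega, div_le_div_iff₀ (M.pos _) (M.pos _)]
  nlinarith

theorem quot_mono {p q : ℕ} (hp : 1 ≤ p) (hpq : p ≤ q) : M.quot p ≤ M.quot q := by
  induction q, hpq using Nat.le_induction with
  | base => exact le_rfl
  | succ q hq ih =>
    obtain ⟨r, rfl⟩ : ∃ r, q = r + 1 := ⟨q - 1, by omega⟩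
    exact ih.trans (M.quot_le_succ r)

theorem mul_le_add (p q : ℕ) : M.M p * M.M q ≤ M.M (p + q) := by
  induction q with
  | zero => simp [M.zero]
  | succ q ih =>
    rw [M.succ_eq, ← add_assoc, M.succ_eq]
    have h1 := M.quot_mono (p := q + 1) (q := p + q + 1) (by omega) (by omega)
    calc M.M p * (M.quot (q + 1) * M.M q) = M.quot (q + 1) * (M.M p * M.M q) := by ring
      _ ≤ M.quot (p + q + 1) * M.M (p + q) :=
        mul_le_mul h1 ih (mul_pos (M.pos _) (M.pos _)).le (M.quot_pos _).le

theorem prod_le_sum {ι : Type*} (s : Finset ι) (α : ι → ℕ) :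
    ∏ i ∈ s, M.M (α i) ≤ M.M (∑ i ∈ s, α i) := by
  classical
  induction s using Finset.induction_on with
  | empty => simp [M.zero]
  | insert a s ha ih =>
    rw [Finset.prod_insert ha, Finset.sum_insert ha]
    exact (mul_le_mul_of_nonneg_left ih (M.pos _).le).trans (M.mul_le_add _ _)

/-! ### Consequences of (M.2) and (M.2)^* for the associated function. -/

variable {M}

/-- By (M.2) a product of the terms of index p and q at t is at most C times the term of index p + q
at Ht. The inequality (M.2) is returned as well, so that later estimates share C and H. -/
theorem M2.assoc_sq (hM : M.M2) : ∃ C H : ℝ, 1 ≤ C ∧ 1 ≤ H ∧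
    (∀ p q : ℕ, M.M (p + q) ≤ C * H ^ (p + q) * M.M p * M.M q) ∧
    ∀ t, 0 ≤ t → M.assoc t ^ 2 ≤ C * M.assoc (H * t) := by
  obtain ⟨C, H, hC, hH, h⟩ := hM
  refine ⟨C, H, hC, hH, h, fun t ht => ?_⟩
  have key : ∀ p q : ℕ, t ^ p / M.M p * (t ^ q / M.M q) ≤ C * M.assoc (H * t) := by
    intro p q
    have h1 := M.pow_le_mul_assoc (H * t) (p + q)
    have h2 := h p q
    have hp := M.pos p
    have hq := M.pos q
    rw [div_mul_div_comm, div_le_iff₀ (mul_pos hp hq), ← pow_add]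
    have h3 : H ^ (p + q) * t ^ (p + q) ≤ H ^ (p + q) * (C * M.assoc (H * t) * (M.M p * M.M q)) := by
      rw [← mul_pow]
      refine h1.trans ((mul_le_mul_of_nonneg_right h2 (M.assoc_pos _).le).trans (le_of_eq ?_))
      ring
    exact le_of_mul_le_mul_left h3 (by positivity)
  have hpos := M.assoc_pos (H * t)
  have h1 : ∀ q : ℕ, M.assoc t * (t ^ q / M.M q) ≤ C * M.assoc (H * t) := by
    intro q
    rw [assoc, Real.iSup_mul_of_nonneg (div_nonneg (pow_nonneg ht _) (M.pos q).le)]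
    exact ciSup_le fun p => key p q
  calc M.assoc t ^ 2 = M.assoc t * ⨆ q : ℕ, t ^ q / M.M q := by rw [sq]; rfl
    _ ≤ _ := by
      rw [Real.mul_iSup_of_nonneg (M.assoc_pos t).le]
      exact ciSup_le h1

theorem M2.assoc_pow (hM : M.M2) (n : ℕ) : ∃ C H : ℝ, 1 ≤ C ∧ 1 ≤ H ∧
    ∀ t, 0 ≤ t → M.assoc t ^ n ≤ C * M.assoc (H * t) := by
  obtain ⟨C₀, H₀, hC₀, hH₀, -, h₀⟩ := hM.assoc_sq
  induction n with
  | zero => exact ⟨1, 1, le_rfl, le_rfl, fun t _ => by simpa using M.one_le_assoc t⟩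
  | succ n ih =>
    obtain ⟨C, H, hC, hH, h⟩ := ih
    refine ⟨C * C₀, H₀ * H, one_le_mul_of_one_le_of_one_le hC hC₀,
      one_le_mul_of_one_le_of_one_le hH₀ hH, fun t ht => ?_⟩
    have h1 : M.assoc t ≤ M.assoc (H * t) := M.assoc_mono ht (le_mul_of_one_le_left ht hH)
    calc M.assoc t ^ (n + 1) = M.assoc t ^ n * M.assoc t := pow_succ _ _
      _ ≤ C * M.assoc (H * t) * M.assoc (H * t) :=
        mul_le_mul (h t ht) h1 (M.assoc_pos _).le
          (mul_nonneg (by linarith) (M.assoc_pos _).le)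
      _ = C * M.assoc (H * t) ^ 2 := by ring
      _ ≤ C * (C₀ * M.assoc (H₀ * (H * t))) :=
        mul_le_mul_of_nonneg_left (h₀ _ (by positivity)) (by linarith)
      _ = C * C₀ * M.assoc (H₀ * H * t) := by rw [mul_assoc H₀]; ring

/-- Going from p to p + 1 turns one of the N factors M_k, k = ⌊p/N⌋, into M_{k+1}, so the bracket
gains 2 m_{k+1}. The right side gains m_{p+N+1} ≥ m_{N(k+1)} ≥ 2 m_{k+1} as soon as k + 1 ≥ p₀; the
finitely many smaller p are paid for by c. -/
theorem M2star.exists_le (hM : M.M2star) : ∃ N : ℕ, 1 ≤ N ∧ ∃ c : ℝ, 0 < c ∧ ∀ p : ℕ,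
    c * (2 ^ p * M.M (p / N) ^ (N - p % N) * M.M (p / N + 1) ^ (p % N)) ≤ M.M (p + N) := by
  obtain ⟨p₀, N, hp₀, hN, h⟩ := hM
  refine ⟨N, hN, ?_⟩
  set D : ℕ → ℝ := fun p => 2 ^ p * M.M (p / N) ^ (N - p % N) * M.M (p / N + 1) ^ (p % N) with hD
  have hDpos : ∀ p, 0 < D p := fun p =>
    mul_pos (mul_pos (by positivity) (pow_pos (M.pos _) _)) (pow_pos (M.pos _) _)
  have hDs : ∀ p, D (p + 1) = 2 * M.quot (p / N + 1) * D p := by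
    intro p
    have hlt := Nat.mod_lt p hN
    have hdm := Nat.div_add_mod p N
    set k := p / N
    set r := p % N
    have hs := M.succ_eq k
    rcases Nat.lt_or_ge (r + 1) N with hr | hr
    · have h1 : (p + 1) / N = k := by
        rw [← hdm, add_assoc, Nat.mul_add_div (by omega), Nat.div_eq_of_lt hr, add_zero]
      have h2 : (p + 1) % N = r + 1 := by
        rw [← hdm, add_assoc, Nat.mul_add_mod, Nat.mod_eq_of_lt hr]
      simp only [hD, h1, h2]
      change _ = 2 * M.quot (k + 1) * (2 ^ p * M.M k ^ (N - r) * M.M (k + 1) ^ r)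
      obtain ⟨e, he⟩ : ∃ e, N - r = e + 1 := ⟨N - r - 1, by omega⟩
      rw [he, show N - (r + 1) = e by omega, pow_succ (M.M (k + 1)) r]
      nth_rewrite 2 [hs]
      ring
    -- The residue wraps round: all N factors have become M_{k+1}, which is the expression with
    -- quotient k + 1 and residue 0.
    · have hr' : r + 1 = N := by omega
      have h1 : (p + 1) / N = k + 1 := by
        rw [← hdm, add_assoc, hr', Nat.mul_add_div (by omega), Nat.div_self (by omega)]
      have h2 : (p + 1) % N = 0 := by
        rw [← hdm, add_assoc, hr', Nat.mul_add_mod, Nat.mod_self]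
      simp only [hD, h1, h2]
      change _ = 2 * M.quot (k + 1) * (2 ^ p * M.M k ^ (N - r) * M.M (k + 1) ^ r)
      rw [show N - r = 1 by omega, show N - 0 = r + 1 by omega, pow_succ (M.M (k + 1)) r]
      nth_rewrite 2 [hs]
      ring
  obtain ⟨c, hc, hcp⟩ : ∃ c : ℝ, 0 < c ∧ ∀ p ≤ N * p₀, c * D p ≤ M.M (p + N) := by
    obtain ⟨x, hx, hmin⟩ := Finset.exists_min_image (Finset.range (N * p₀ + 1))
      (fun p => M.M (p + N) / D p) ⟨0, by simp⟩
    refine ⟨M.M (x + N) / D x, div_pos (M.pos _) (hDpos _), fun p hp => ?_⟩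
    have := hmin p (by simp; omega)
    rwa [le_div_iff₀ (hDpos p)] at this
  refine ⟨c, hc, fun p => ?_⟩
  rcases le_total p (N * p₀) with hp | hp
  · exact hcp p hp
  · induction p, hp using Nat.le_induction with
    | base => exact hcp _ le_rfl
    | succ p hp ih =>
      change c * D (p + 1) ≤ _
      change c * D p ≤ _ at ih
      have hk : p₀ ≤ p / N := (Nat.le_div_iff_mul_le (by omega)).2 (by rwa [mul_comm])
      have h1 := h (p / N + 1) (by omega)
      have h2 : M.quot (N * (p / N + 1)) ≤ M.quot (p + N + 1) := by
        refine M.quot_mono (Nat.mul_pos (by omega) (by omega)) ?_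
        have := Nat.mul_div_le p N
        rw [mul_add]; omega
      rw [hDs, show p + 1 + N = p + N + 1 by omega, M.succ_eq]
      calc c * (2 * M.quot (p / N + 1) * D p) = 2 * M.quot (p / N + 1) * (c * D p) := by ring
        _ ≤ _ := mul_le_mul (h1.trans h2) ih (mul_pos hc (hDpos p)).le (M.quot_pos _).le

/-- Write t^r as a product of N powers with exponents ⌊r/N⌋ or ⌊r/N⌋ + 1 and bound each by its M
times `assoc`. The preceding lower bound for M_{r+N} then supplies the 2^r needed to absorb (2t)^r.
The leftover t^N costs N more powers of `assoc`, whence the exponent 2N. -/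
theorem M2star.assoc_two_mul (hM : M.M2star) : ∃ C : ℝ, 1 ≤ C ∧ ∃ n : ℕ, 1 ≤ n ∧
    ∀ t, 0 ≤ t → M.assoc (2 * t) ≤ C * M.assoc t ^ n := by
  obtain ⟨N, hN, c, hc, h⟩ := hM.exists_le
  set S : ℝ := ∑ p ∈ Finset.range N, 2 ^ p with hS
  refine ⟨max 1 (max S (2 ^ N / c)), le_max_left _ _, 2 * N, by omega, fun t ht => ?_⟩
  refine ciSup_le fun p => ?_
  have hE := M.one_le_assoc t
  have hE0 := M.assoc_pos t
  rcases Nat.lt_or_ge p N with hp | hp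
  · have h1 : (2 : ℝ) ^ p ≤ S := by
      rw [hS]
      exact Finset.single_le_sum (f := fun p => (2 : ℝ) ^ p) (fun _ _ => by positivity)
        (Finset.mem_range.2 hp)
    rw [mul_pow, mul_div_assoc]
    refine mul_le_mul (h1.trans ((le_max_left _ _).trans (le_max_right _ _)))
      ((M.div_le_assoc t p).trans (le_self_pow₀ hE (by omega)))
      (div_nonneg (pow_nonneg ht _) (M.pos _).le) (by positivity)
  · obtain ⟨r, rfl⟩ : ∃ r, p = r + N := ⟨p - N, by omega⟩
    have h1 := h r
    have hlt := Nat.mod_lt r hN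
    have hdm := Nat.div_add_mod r N
    set k := r / N
    set j := r % N
    have e1 : t ^ r ≤ (M.M k ^ (N - j) * M.M (k + 1) ^ j) * M.assoc t ^ N := by
      have : t ^ r = (t ^ k) ^ (N - j) * (t ^ (k + 1)) ^ j := by
        rw [← pow_mul, ← pow_mul, ← pow_add]
        congr 1
        rw [← hdm]
        obtain ⟨e, he⟩ : ∃ e, N = j + e := ⟨N - j, by omega⟩
        rw [he, Nat.add_sub_cancel_left]
        ring
      rw [this]
      calc (t ^ k) ^ (N - j) * (t ^ (k + 1)) ^ j
          ≤ (M.M k * M.assoc t) ^ (N - j) * (M.M (k + 1) * M.assoc t) ^ j := by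
            gcongr
            · exact pow_nonneg (mul_nonneg (M.pos _).le hE0.le) _
            · exact M.pow_le_mul_assoc t _
            · exact M.pow_le_mul_assoc t _
        _ = (M.M k ^ (N - j) * M.M (k + 1) ^ j) * (M.assoc t ^ (N - j) * M.assoc t ^ j) := by
            rw [mul_pow, mul_pow]; ring
        _ = _ := by rw [← pow_add, show N - j + j = N by omega]
    have e2 : t ^ N ≤ M.assoc t ^ N := pow_le_pow_left₀ ht (M.self_le_assoc t) N
    rw [div_le_iff₀ (M.pos _)]
    have hB : 0 < M.M k ^ (N - j) * M.M (k + 1) ^ j :=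
      mul_pos (pow_pos (M.pos _) _) (pow_pos (M.pos _) _)
    set B := M.M k ^ (N - j) * M.M (k + 1) ^ j
    calc (2 * t) ^ (r + N) = 2 ^ r * 2 ^ N * (t ^ r * t ^ N) := by rw [mul_pow, pow_add, pow_add]
      _ ≤ 2 ^ r * 2 ^ N * (B * M.assoc t ^ N * M.assoc t ^ N) := by
        gcongr
      _ = 2 ^ N / c * M.assoc t ^ (2 * N) * (c * (2 ^ r * B)) := by
        rw [two_mul, pow_add]; field_simp
      _ ≤ 2 ^ N / c * M.assoc t ^ (2 * N) * M.M (r + N) := by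
        refine mul_le_mul_of_nonneg_left ?_ (by positivity)
        rw [mul_assoc] at h1
        exact h1
      _ ≤ _ := by
        refine mul_le_mul_of_nonneg_right (mul_le_mul_of_nonneg_right
          ((le_max_right _ _).trans (le_max_right _ _)) (by positivity)) (M.pos _).le

-- The logarithm of `assoc` is a supremum of affine functions of log t, hence convex in log t.
variable (M) in
theorem assoc_interpolate {x y u : ℝ} (hx : 0 < x) (hy : 0 < y) (hu : 0 ≤ u) (hu1 : u ≤ 1) :
    M.assoc (x ^ (1 - u) * y ^ u) ≤ M.assoc x ^ (1 - u) * M.assoc y ^ u := by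
  refine ciSup_le fun p => ?_
  have h1 : (x ^ (1 - u) * y ^ u) ^ p / M.M p =
      (x ^ p / M.M p) ^ (1 - u) * (y ^ p / M.M p) ^ u := by
    have hp := M.pos p
    rw [Real.div_rpow (by positivity) hp.le, Real.div_rpow (by positivity) hp.le,
      div_mul_div_comm, ← Real.rpow_add hp, sub_add_cancel, Real.rpow_one, mul_pow,
      ← Real.rpow_natCast, ← Real.rpow_natCast, ← Real.rpow_mul hx.le, ← Real.rpow_mul hy.le,
      mul_comm (1 - u), mul_comm u, Real.rpow_mul hx.le, Real.rpow_mul hy.le, Real.rpow_natCast,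
      Real.rpow_natCast]
  rw [h1]
  have hp := M.pos p
  refine mul_le_mul (Real.rpow_le_rpow (by positivity) (M.div_le_assoc x p) (by linarith))
    (Real.rpow_le_rpow (by positivity) (M.div_le_assoc y p) hu) (by positivity)
    (Real.rpow_nonneg (M.assoc_pos x).le _)

end WeightSequence

/-! ### Slowly varying functions -/

/-- A nonnegative increasing function on `[0, ∞)` whose relative variation on `[t, 2 t]` is
controlled linearly. -/
structure SlowlyVarying (σ : ℝ → ℝ) (K : ℝ) : Prop where
  nonneg : ∀ t, 0 ≤ t → 0 ≤ σ t
  mono : MonotoneOn σ (Set.Ici 0)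
  slow : ∀ t, 0 ≤ t → ∀ l, 1 ≤ l → l ≤ 2 → σ (l * t) ≤ σ t + K * (l - 1) * (1 + σ t)

/-- Increasing functions `θ ≥ 0` with `θ (l t) ≤ l ^ 2 θ t` for `l ≥ 1`. -/
structure Moderate (θ : ℝ → ℝ) : Prop where
  nonneg : ∀ t, 0 ≤ t → 0 ≤ θ t
  mono : MonotoneOn θ (Set.Ici 0)
  le_sq : ∀ t, 0 ≤ t → ∀ l, 1 ≤ l → θ (l * t) ≤ l ^ 2 * θ t

/-- Convexity in log t compares the value at l²θ(t) with those at θ(t) and 4θ(t), the weight of the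
latter being u = log₂ l ≤ 2(l - 1). Two applications of (M.2)^* bound the value at 4θ(t) by A(1 +
σ(t)). The constant depends on M only, so one K serves for all θ. -/
theorem WeightSequence.M2star.slowlyVarying {M : WeightSequence} (hM : M.M2star) :
    ∃ K : ℝ, 0 ≤ K ∧ ∀ θ : ℝ → ℝ, Moderate θ → SlowlyVarying (fun t => Real.log (M.assoc (θ t))) K := by
  obtain ⟨C, hC, n, hn, h⟩ := hM.assoc_two_mul
  have h4 : ∀ t, 0 ≤ t → Real.log (M.assoc (4 * t)) ≤
      Real.log C + n * (Real.log C + n * Real.log (M.assoc t)) := by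
    have h2 : ∀ t, 0 ≤ t → Real.log (M.assoc (2 * t)) ≤ Real.log C + n * Real.log (M.assoc t) := by
      intro t ht
      have := Real.log_le_log (M.assoc_pos _) (h t ht)
      rwa [Real.log_mul (by linarith) (pow_pos (M.assoc_pos t) n).ne', Real.log_pow] at this
    intro t ht
    have e1 := h2 (2 * t) (by positivity)
    have e2 := mul_le_mul_of_nonneg_left (h2 t ht) (Nat.cast_nonneg (α := ℝ) n)
    rw [show 4 * t = 2 * (2 * t) by ring]
    linarith
  have hlC := Real.log_nonneg hC
  set A : ℝ := max (Real.log C + n * Real.log C) (n * n) with hA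
  have hA0 : 0 ≤ A := le_max_of_le_right (by positivity)
  refine ⟨2 * A, by positivity, fun θ hθ => ⟨?_, ?_, ?_⟩⟩
  · exact fun t _ => Real.log_nonneg (M.one_le_assoc _)
  · intro s hs t ht hst
    exact Real.log_le_log (M.assoc_pos _) (M.assoc_mono (hθ.nonneg _ hs) (hθ.mono hs ht hst))
  · intro t ht l hl hl2
    have hs := Real.log_nonneg (M.one_le_assoc (θ t))
    -- Interpolation needs positive arguments; if θ(t) = 0, then θ(lt) = 0 as well.
    rcases (hθ.nonneg t ht).eq_or_lt with h0 | h0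
    · have : θ (l * t) = 0 := le_antisymm (by simpa [← h0] using hθ.le_sq t ht l hl)
        (hθ.nonneg _ (by positivity))
      simp only [this, ← h0, M.assoc_zero, Real.log_one]
      nlinarith
    set u := Real.logb 2 l with hu
    have hu0 : 0 ≤ u := Real.logb_nonneg (by norm_num) hl
    have hu1 : u ≤ 1 := by
      rw [hu, Real.logb_le_iff_le_rpow (by norm_num) (by linarith)]
      simpa using hl2
    have hul : u ≤ 2 * (l - 1) := by
      rw [hu, Real.logb, div_le_iff₀ (Real.log_pos (by norm_num))]
      have h1 := Real.log_le_sub_one_of_pos (show 0 < l by linarith)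
      have h2 := Real.log_two_gt_d9
      nlinarith
    have e0 : (θ t) ^ (1 - u) * (4 * θ t) ^ u = l ^ 2 * θ t := by
      rw [Real.mul_rpow (by norm_num) h0.le, mul_left_comm, ← Real.rpow_add h0, sub_add_cancel,
        Real.rpow_one, show (4 : ℝ) = 2 ^ (2 : ℝ) by norm_num, ← Real.rpow_mul (by norm_num),
        mul_comm (2 : ℝ) u, Real.rpow_mul (by norm_num), hu,
        Real.rpow_logb (by norm_num) (by norm_num) (by linarith)]
      norm_num
    have e1 := M.assoc_interpolate h0 (show 0 < 4 * θ t by positivity) hu0 hu1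
    rw [e0] at e1
    have e2 := Real.log_le_log (M.assoc_pos _) ((M.assoc_mono (hθ.nonneg _ (by positivity))
      (hθ.le_sq t ht l hl)).trans e1)
    rw [Real.log_mul (Real.rpow_pos_of_pos (M.assoc_pos _) _).ne'
      (Real.rpow_pos_of_pos (M.assoc_pos _) _).ne', Real.log_rpow (M.assoc_pos _),
      Real.log_rpow (M.assoc_pos _)] at e2
    have e3 := h4 _ h0.le
    set W := Real.log (M.assoc (θ t))
    have e4 : Real.log (M.assoc (4 * θ t)) ≤ A * (1 + W) := by
      have a1 : Real.log C + n * Real.log C ≤ A := le_max_left _ _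
      have a2 : (n : ℝ) * n ≤ A := le_max_right _ _
      nlinarith [mul_le_mul_of_nonneg_right a2 hs]
    have e5 : u * Real.log (M.assoc (4 * θ t)) ≤ 2 * (l - 1) * (A * (1 + W)) :=
      mul_le_mul hul e4 (Real.log_nonneg (M.one_le_assoc _)) (by linarith)
    show Real.log (M.assoc (θ (l * t))) ≤ W + 2 * A * (l - 1) * (1 + W)
    nlinarith [mul_nonneg hu0 hs]

end Ultra

namespace Ultra

/-! ### Gaussian regularization of slowly varying functions -/

namespace SlowlyVarying

variable {σ : ℝ → ℝ} {K : ℝ}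

theorem two_mul_le (hσ : SlowlyVarying σ K) {t : ℝ} (ht : 0 ≤ t) :
    1 + σ (2 * t) ≤ (1 + K) * (1 + σ t) := by
  have := hσ.slow t ht 2 (by norm_num) le_rfl
  nlinarith

/-- The doubling inequality gives polynomial growth of degree a, where 2^a > 1 + K. -/
theorem exists_le_exp (hσ : SlowlyVarying σ K) :
    ∃ C : ℝ, 0 < C ∧ ∀ t, 0 ≤ t → 1 + σ t ≤ C * Real.exp t := by
  obtain ⟨a, ha⟩ := pow_unbounded_of_one_lt (1 + K) (one_lt_two (α := ℝ))
  have h1 := hσ.nonneg 1 one_pos.le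
  have hpow : ∀ n : ℕ, 1 + σ (2 ^ n) ≤ (2 ^ n) ^ a * (1 + σ 1) := by
    intro n
    induction n with
    | zero => simp
    | succ n ih =>
      have e := hσ.two_mul_le (t := 2 ^ n) (by positivity)
      rw [pow_succ' (2 : ℝ) n, mul_pow, mul_assoc]
      refine e.trans (mul_le_mul ha.le ih ?_ (by positivity))
      have := hσ.nonneg (2 ^ n) (by positivity)
      positivity
  refine ⟨2 ^ a * a.factorial * Real.exp 1 * (1 + σ 1), by positivity, fun t ht => ?_⟩
  have key : 1 + σ (1 + t) ≤ (2 * (1 + t)) ^ a * (1 + σ 1) := by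
    obtain ⟨n, hn, hn'⟩ := exists_nat_pow_near (show 1 ≤ 1 + t by linarith)
      (one_lt_two (α := ℝ))
    have e1 : σ (1 + t) ≤ σ (2 ^ (n + 1)) := hσ.mono (Set.mem_Ici.2 (by positivity))
      (Set.mem_Ici.2 (by positivity)) hn'.le
    have e2 := hpow (n + 1)
    refine ((add_le_add_right e1 1).trans e2).trans (mul_le_mul_of_nonneg_right
      (pow_le_pow_left₀ (by positivity) ?_ a) (by positivity))
    rw [pow_succ']; gcongr
  have e3 : σ t ≤ σ (1 + t) := hσ.mono (Set.mem_Ici.2 ht) (Set.mem_Ici.2 (by positivity))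
    (by linarith)
  have e4 : (1 + t) ^ a ≤ a.factorial * (Real.exp 1 * Real.exp t) := by
    have := Real.pow_div_factorial_le_exp (1 + t) (by positivity) a
    rw [div_le_iff₀ (by positivity), Real.exp_add] at this
    linarith
  calc 1 + σ t ≤ (2 * (1 + t)) ^ a * (1 + σ 1) := by linarith
    _ = 2 ^ a * (1 + σ 1) * (1 + t) ^ a := by rw [mul_pow]; ring
    _ ≤ 2 ^ a * (1 + σ 1) * (a.factorial * (Real.exp 1 * Real.exp t)) := by gcongr
    _ = _ := by ring

theorem measurable_abs (hσ : SlowlyVarying σ K) : Measurable fun s => σ |s| := by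
  have h : Monotone fun s => σ (max 0 s) := fun s t hst =>
    hσ.mono (Set.mem_Ici.2 (le_max_left _ _)) (Set.mem_Ici.2 (le_max_left _ _))
      (max_le_max le_rfl hst)
  have h2 := h.measurable.comp (measurable_norm (α := ℝ))
  have h3 : ((fun s => σ (max 0 s)) ∘ norm) = fun s => σ |s| := by
    ext s
    simp
  rwa [h3] at h2

/-- If |t| ≥ 1 and |s - t| ≤ |t|/4, slow variation applies with a dilation 1 + O(|s - t|/|t|).
Otherwise 1 + |t| ≤ 4|s - t| + 2, and the exponential absorbs both the values of σ and the missing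
denominator. -/
theorem exists_variation_le (hσ : SlowlyVarying σ K) (hK : 0 ≤ K) :
    ∃ C : ℝ, 0 < C ∧ ∀ t s : ℝ,
      |σ (|s|) - σ (|t|)| ≤ C * Real.exp (6 * |s - t|) * ((1 + σ |t|) / (1 + |t|)) := by
  obtain ⟨C, hC, h⟩ := hσ.exists_le_exp
  suffices H : ∀ t, 0 ≤ t → ∀ t', 0 ≤ t' → ∀ s, |t' - t| ≤ s → |σ t' - σ t| ≤
      (4 * K + 4 * C * Real.exp 1) * Real.exp (6 * s) * ((1 + σ t) / (1 + t)) by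
    refine ⟨4 * K + 4 * C * Real.exp 1, by positivity, fun t s => ?_⟩
    exact H _ (abs_nonneg _) _ (abs_nonneg _) _ (abs_abs_sub_abs_le s t)
  intro t ht t' ht' s hs
  have hs0 : 0 ≤ s := (abs_nonneg _).trans hs
  have hst := hσ.nonneg t ht
  have hst' := hσ.nonneg t' ht'
  obtain ⟨hs1, hs2⟩ := abs_le.1 hs
  have hexp : s ≤ Real.exp (6 * s) := by
    have := Real.add_one_le_exp (6 * s)
    linarith
  have hq : 0 ≤ (1 + σ t) / (1 + t) := by positivity
  by_cases hcase : 1 ≤ t ∧ s ≤ t / 4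
  · obtain ⟨h1, h4⟩ := hcase
    have hts : 4 * K * s * ((1 + σ t) / (1 + t)) ≤
        (4 * K + 4 * C * Real.exp 1) * Real.exp (6 * s) * ((1 + σ t) / (1 + t)) := by
      refine mul_le_mul_of_nonneg_right ?_ hq
      have : 0 ≤ 4 * C * Real.exp 1 * Real.exp (6 * s) := by positivity
      nlinarith
    refine le_trans ?_ hts
    have hdiv : s / t ≤ 2 * (s / (1 + t)) := by
      rw [← mul_div_assoc, div_le_div_iff₀ (by linarith) (by linarith)]
      nlinarith
    rw [mul_div_assoc']
    rcases le_total t t' with htt | htt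
    · have e := hσ.slow t ht (t' / t) (by rw [le_div_iff₀ (by linarith)]; linarith)
        (by rw [div_le_iff₀ (by linarith)]; linarith)
      rw [div_mul_cancel₀ _ (by linarith : t ≠ 0)] at e
      have e1 : t' / t - 1 ≤ 2 * (s / (1 + t)) := by
        refine le_trans ?_ hdiv
        rw [div_sub_one (by linarith)]
        exact div_le_div_of_nonneg_right hs2 ht
      have e2 : K * (t' / t - 1) * (1 + σ t) ≤ K * (2 * (s / (1 + t))) * (1 + σ t) := by gcongr
      have e3 := hσ.mono (Set.mem_Ici.2 ht) (Set.mem_Ici.2 ht') htt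
      rw [abs_of_nonneg (by linarith)]
      have e4 : 0 ≤ K * (s / (1 + t)) * (1 + σ t) := by positivity
      have e5 : 4 * K * s * (1 + σ t) / (1 + t) = 4 * (K * (s / (1 + t)) * (1 + σ t)) := by ring
      rw [e5]; linarith
    · have ht0 : 0 < t' := by linarith
      have e := hσ.slow t' ht' (t / t') (by rw [le_div_iff₀ ht0]; linarith)
        (by rw [div_le_iff₀ ht0]; linarith)
      rw [div_mul_cancel₀ _ ht0.ne'] at e
      have e3 := hσ.mono (Set.mem_Ici.2 ht') (Set.mem_Ici.2 ht) htt
      have e1 : t / t' - 1 ≤ 4 * (s / (1 + t)) := by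
        have : t / t' - 1 ≤ 2 * (s / t) := by
          rw [div_sub_one ht0.ne', ← mul_div_assoc, div_le_div_iff₀ ht0 (by linarith)]
          nlinarith
        linarith
      have e2 : K * (t / t' - 1) * (1 + σ t') ≤ K * (4 * (s / (1 + t))) * (1 + σ t) := by
        have : 0 ≤ s / (1 + t) := by positivity
        gcongr
      rw [abs_sub_comm, abs_of_nonneg (by linarith)]
      have e5 : 4 * K * s * (1 + σ t) / (1 + t) = K * (4 * (s / (1 + t))) * (1 + σ t) := by ring
      rw [e5]; linarith
  · have hlt : 1 + t ≤ 4 * s + 2 := by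
      by_contra hcon
      exact hcase ⟨by linarith, by linarith⟩
    have hbig : ∀ x, 0 ≤ x → x ≤ 5 * s + 1 → σ x ≤ C * Real.exp (5 * s + 1) := by
      intro x hx hxs
      have e1 := hσ.mono (Set.mem_Ici.2 hx) (Set.mem_Ici.2 (by positivity)) hxs
      have := h (5 * s + 1) (by positivity)
      linarith
    have b1 := hbig t ht (by linarith)
    have b2 := hbig t' ht' (by linarith)
    have b3 : |σ t' - σ t| ≤ C * Real.exp (5 * s + 1) := abs_le.2 ⟨by linarith, by linarith⟩
    have b4 : 1 ≤ 4 * Real.exp s * ((1 + σ t) / (1 + t)) := by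
      rw [mul_div_assoc', le_div_iff₀ (by linarith)]
      have := Real.add_one_le_exp s
      nlinarith [Real.exp_pos s]
    have b5 : C * Real.exp (5 * s + 1) * (4 * Real.exp s * ((1 + σ t) / (1 + t))) =
        4 * C * Real.exp 1 * Real.exp (6 * s) * ((1 + σ t) / (1 + t)) := by
      rw [show 6 * s = 5 * s + s by ring, Real.exp_add, Real.exp_add]; ring
    calc |σ t' - σ t| ≤ C * Real.exp (5 * s + 1) * 1 := by linarith
      _ ≤ C * Real.exp (5 * s + 1) * (4 * Real.exp s * ((1 + σ t) / (1 + t))) := by gcongr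
      _ = 4 * C * Real.exp 1 * Real.exp (6 * s) * ((1 + σ t) / (1 + t)) := b5
      _ ≤ _ := by
        refine mul_le_mul_of_nonneg_right (mul_le_mul_of_nonneg_right ?_ (by positivity)) hq
        linarith

end SlowlyVarying

/-- The convolution of `s ↦ σ |s|` with a Gaussian, as an entire function. -/
def gaussReg (σ : ℝ → ℝ) (z : ℂ) : ℂ :=
  ((√Real.pi)⁻¹ : ℝ) * ∫ s : ℝ, (σ |s| : ℂ) * Complex.exp (-(z - s) ^ 2)

theorem norm_cexp_neg_sub_sq (z : ℂ) (s : ℝ) :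
    ‖Complex.exp (-(z - s) ^ 2)‖ = Real.exp (-(z.re - s) ^ 2 + z.im ^ 2) := by
  rw [Complex.norm_exp]
  congr 1
  simp [sq]
  ring

theorem integrable_exp_neg_mul_sub_sq {b : ℝ} (hb : 0 < b) (x : ℝ) :
    Integrable fun s : ℝ => Real.exp (-b * (s - x) ^ 2) :=
  (integrable_exp_neg_mul_sq hb).comp_sub_right x

theorem integral_cexp_neg_sub_sq (z : ℂ) :
    ∫ s : ℝ, Complex.exp (-(z - s) ^ 2) = (√Real.pi : ℝ) := by
  have h := GaussianFourier.integral_cexp_neg_mul_sq_add_real_mul_I (b := 1) (by simp) (-z.im)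
  rw [← integral_sub_right_eq_self _ z.re] at h
  simp only [div_one] at h
  have e : ((Real.pi : ℂ) ^ (1 / 2 : ℂ)) = (√Real.pi : ℝ) := by
    rw [Real.sqrt_eq_rpow, Complex.ofReal_cpow Real.pi_pos.le]; norm_num
  rw [← e, ← h]
  congr 1
  ext s
  congr 1
  conv_lhs => rw [← Complex.re_add_im z]
  push_cast
  ring

namespace SlowlyVarying

variable {σ : ℝ → ℝ} {K : ℝ}

theorem aestronglyMeasurable_gauss (hσ : SlowlyVarying σ K) (z : ℂ) :
    AEStronglyMeasurable fun s : ℝ => (σ |s| : ℂ) * Complex.exp (-(z - s) ^ 2) :=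
  ((Complex.measurable_ofReal.comp hσ.measurable_abs).aestronglyMeasurable).mul
    (by fun_prop : Continuous fun s : ℝ => Complex.exp (-(z - s) ^ 2)).aestronglyMeasurable

/-- One Gaussian majorant, uniform for ‖z‖ ≤ R, serves for the integrand and for its derivative in
z, which is the first expression up to sign. -/
theorem gauss_bound (hσ : SlowlyVarying σ K) {C R : ℝ}
    (h : ∀ t, 0 ≤ t → 1 + σ t ≤ C * Real.exp t) {z : ℂ} (hz : ‖z‖ ≤ R) (s : ℝ) :
    ‖(σ |s| : ℂ) * Complex.exp (-(z - s) ^ 2) * (2 * (z - s))‖ ≤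
      2 * C * Real.exp (R + 2 * R ^ 2 + 4) * Real.exp (-(1 / 4) * (s - 0) ^ 2) ∧
    ‖(σ |s| : ℂ) * Complex.exp (-(z - s) ^ 2)‖ ≤
      2 * C * Real.exp (R + 2 * R ^ 2 + 4) * Real.exp (-(1 / 4) * (s - 0) ^ 2) := by
  have hs0 := hσ.nonneg |s| (abs_nonneg s)
  have hC : 0 < C := by
    have := h 0 le_rfl
    have := hσ.nonneg 0 le_rfl
    simp only [Real.exp_zero] at *
    linarith
  have h1 : ‖z - s‖ ≤ R + |s| := (norm_sub_le _ _).trans (by simpa using hz)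
  have hR : 0 ≤ R := (norm_nonneg z).trans hz
  have hre : z.re ^ 2 ≤ R ^ 2 := by
    rw [← sq_abs]
    exact pow_le_pow_left₀ (abs_nonneg _) ((Complex.abs_re_le_norm z).trans hz) 2
  have him : z.im ^ 2 ≤ R ^ 2 := by
    rw [← sq_abs]
    exact pow_le_pow_left₀ (abs_nonneg _) ((Complex.abs_im_le_norm z).trans hz) 2
  have e1 : ‖(σ |s| : ℂ)‖ ≤ C * Real.exp |s| := by
    rw [Complex.norm_real, Real.norm_of_nonneg hs0]
    have := h |s| (abs_nonneg s)
    linarith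
  have e2 : ‖Complex.exp (-(z - s) ^ 2)‖ ≤ Real.exp (-(s ^ 2 / 2) + 2 * R ^ 2) := by
    rw [norm_cexp_neg_sub_sq]
    refine Real.exp_le_exp.2 ?_
    nlinarith [sq_nonneg (2 * z.re - s)]
  have e4 : Real.exp |s| * Real.exp (-(s ^ 2 / 2) + 2 * R ^ 2) * Real.exp (R + |s|) ≤
      Real.exp (R + 2 * R ^ 2 + 4) * Real.exp (-(1 / 4) * (s - 0) ^ 2) := by
    rw [← Real.exp_add, ← Real.exp_add, ← Real.exp_add]
    refine Real.exp_le_exp.2 ?_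
    have := sq_abs s
    nlinarith [sq_nonneg (|s| - 4)]
  have e5 : ‖(σ |s| : ℂ)‖ * ‖Complex.exp (-(z - s) ^ 2)‖ ≤
      C * Real.exp |s| * Real.exp (-(s ^ 2 / 2) + 2 * R ^ 2) :=
    mul_le_mul e1 e2 (norm_nonneg _) (by positivity)
  have e6 := Real.add_one_le_exp (R + |s|)
  constructor
  · rw [norm_mul, norm_mul, norm_mul, Complex.norm_ofNat]
    have e3 : 2 * ‖z - s‖ ≤ 2 * Real.exp (R + |s|) := by linarith
    calc _ ≤ C * Real.exp |s| * Real.exp (-(s ^ 2 / 2) + 2 * R ^ 2) * (2 * Real.exp (R + |s|)) :=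
          mul_le_mul e5 e3 (by positivity) (by positivity)
      _ = 2 * C * (Real.exp |s| * Real.exp (-(s ^ 2 / 2) + 2 * R ^ 2) * Real.exp (R + |s|)) := by
          ring
      _ ≤ _ := by rw [mul_assoc (2 * C)]; exact mul_le_mul_of_nonneg_left e4 (by positivity)
  · rw [norm_mul]
    have e3 : 1 ≤ 2 * Real.exp (R + |s|) := by linarith [abs_nonneg s]
    calc _ ≤ C * Real.exp |s| * Real.exp (-(s ^ 2 / 2) + 2 * R ^ 2) * (2 * Real.exp (R + |s|)) := by
          refine e5.trans (le_mul_of_one_le_right (by positivity) e3)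
      _ = 2 * C * (Real.exp |s| * Real.exp (-(s ^ 2 / 2) + 2 * R ^ 2) * Real.exp (R + |s|)) := by
          ring
      _ ≤ _ := by rw [mul_assoc (2 * C)]; exact mul_le_mul_of_nonneg_left e4 (by positivity)

theorem integrable_gauss (hσ : SlowlyVarying σ K) (z : ℂ) :
    Integrable fun s : ℝ => (σ |s| : ℂ) * Complex.exp (-(z - s) ^ 2) := by
  obtain ⟨C, hC, h⟩ := hσ.exists_le_exp
  exact ((integrable_exp_neg_mul_sub_sq (by norm_num) 0).const_mul _).mono'
    (hσ.aestronglyMeasurable_gauss z) (ae_of_all _ fun s => (hσ.gauss_bound h le_rfl s).2)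

theorem differentiable_gaussReg (hσ : SlowlyVarying σ K) :
    Differentiable ℂ (gaussReg σ) := by
  obtain ⟨C, hC, h⟩ := hσ.exists_le_exp
  intro z₀
  refine DifferentiableAt.const_mul ?_ _
  refine (hasDerivAt_integral_of_dominated_loc_of_deriv_le
    (F' := fun (z : ℂ) (s : ℝ) => -((σ |s| : ℂ) * Complex.exp (-(z - s) ^ 2) * (2 * (z - s))))
    (Metric.ball_mem_nhds z₀ one_pos)
    (Eventually.of_forall fun z => hσ.aestronglyMeasurable_gauss z) (hσ.integrable_gauss z₀)
    ((hσ.aestronglyMeasurable_gauss z₀).mul (by fun_prop : Continuous fun s : ℝ =>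
      (2 * (z₀ - s) : ℂ)).aestronglyMeasurable).neg
    (bound := fun s => 2 * C * Real.exp ((‖z₀‖ + 1) + 2 * (‖z₀‖ + 1) ^ 2 + 4) *
      Real.exp (-(1 / 4) * (s - 0) ^ 2))
    (ae_of_all _ fun s z hz => ?_) ((integrable_exp_neg_mul_sub_sq (by norm_num) 0).const_mul _)
    (ae_of_all _ fun s z hz => ?_)).2.differentiableAt
  · rw [norm_neg]
    refine (hσ.gauss_bound h ?_ s).1
    have : ‖z - z₀‖ < 1 := by simpa [dist_eq_norm] using hz
    have := norm_le_norm_add_norm_sub' z z₀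
    linarith
  · have h1 : HasDerivAt (fun z : ℂ => -(z - s) ^ 2) (-(2 * (z - s))) z := by
      have := (((hasDerivAt_id z).sub_const (s : ℂ)).pow 2).neg
      simp only [id, Nat.cast_ofNat, Nat.reduceSub, pow_one, mul_one] at this
      exact this
    have h2 := h1.cexp.const_mul (σ |s| : ℂ)
    refine h2.congr_deriv ?_
    ring

/-- The Gaussian keeps the integral √π when its centre is complex, so σ|Re z| can be moved under the
integral. The factor exp(6|s - Re z|) of the variation estimate is harmless against the Gaussian,
and Im z contributes at most exp(k²). -/
theorem gaussReg_sub_le (hσ : SlowlyVarying σ K) (hK : 0 ≤ K) (k : ℝ) :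
    ∃ C : ℝ, 0 < C ∧ ∀ z : ℂ, |z.im| ≤ k →
      ‖gaussReg σ z - σ |z.re|‖ ≤ C * ((1 + σ |z.re|) / (1 + |z.re|)) := by
  obtain ⟨C, hC, h⟩ := hσ.exists_variation_le hK
  have hint : 0 < ∫ s : ℝ, Real.exp (-(1 / 2) * s ^ 2) := by
    rw [integral_gaussian]; positivity
  refine ⟨(√Real.pi)⁻¹ * (C * Real.exp (18 + k ^ 2) * ∫ s : ℝ, Real.exp (-(1 / 2) * s ^ 2)),
    by positivity, fun z hz => ?_⟩
  have hi : Integrable fun s : ℝ => Complex.exp (-(z - s) ^ 2) := by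
    refine (integrable_norm_iff (by fun_prop : Continuous fun s : ℝ =>
      Complex.exp (-(z - s) ^ 2)).aestronglyMeasurable).1 ?_
    simp only [norm_cexp_neg_sub_sq, Real.exp_add]
    refine Integrable.mul_const ?_ _
    refine (integrable_exp_neg_mul_sub_sq one_pos z.re).congr (ae_of_all _ fun s => ?_)
    simp only
    congr 1; ring
  have hpi : (0 : ℝ) < √Real.pi := Real.sqrt_pos.2 Real.pi_pos
  have e1 : gaussReg σ z - σ |z.re| = ((√Real.pi)⁻¹ : ℝ) *
      ∫ s : ℝ, ((σ |s| - σ |z.re| : ℝ) : ℂ) * Complex.exp (-(z - s) ^ 2) := by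
    simp only [Complex.ofReal_sub, sub_mul]
    rw [integral_sub (hσ.integrable_gauss z) (hi.const_mul _), integral_const_mul,
      integral_cexp_neg_sub_sq, mul_sub, gaussReg]
    congr 1
    have : (√Real.pi : ℂ) ≠ 0 := by exact_mod_cast hpi.ne'
    push_cast
    field_simp
  rw [e1, norm_mul, Complex.norm_real, Real.norm_of_nonneg (inv_pos.2 hpi).le, mul_assoc]
  refine mul_le_mul_of_nonneg_left ?_ (inv_pos.2 hpi).le
  set Q := (1 + σ |z.re|) / (1 + |z.re|) with hQ
  have hQ0 : 0 ≤ Q := by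
    have := hσ.nonneg |z.re| (abs_nonneg _)
    positivity
  calc _ ≤ ∫ s : ℝ, C * Real.exp (18 + k ^ 2) * Q * Real.exp (-(1 / 2) * (s - z.re) ^ 2) := by
        refine norm_integral_le_of_norm_le
          ((integrable_exp_neg_mul_sub_sq (by norm_num) z.re).const_mul _)
          (ae_of_all _ fun s => ?_)
        rw [norm_mul, norm_cexp_neg_sub_sq, Complex.norm_real, Real.norm_eq_abs]
        have a1 := h z.re s
        have a2 : z.im ^ 2 ≤ k ^ 2 := sq_le_sq' (by linarith [abs_le.1 hz]) (abs_le.1 hz).2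
        have a3 : Real.exp (6 * |s - z.re|) * Real.exp (-(z.re - s) ^ 2 + z.im ^ 2) ≤
            Real.exp (18 + k ^ 2) * Real.exp (-(1 / 2) * (s - z.re) ^ 2) := by
          rw [← Real.exp_add, ← Real.exp_add]
          refine Real.exp_le_exp.2 ?_
          have := sq_abs (s - z.re)
          nlinarith [sq_nonneg (|s - z.re| - 6)]
        calc _ ≤ C * Real.exp (6 * |s - z.re|) * Q * Real.exp (-(z.re - s) ^ 2 + z.im ^ 2) :=
              mul_le_mul_of_nonneg_right a1 (Real.exp_pos _).le
          _ = C * Q * (Real.exp (6 * |s - z.re|) * Real.exp (-(z.re - s) ^ 2 + z.im ^ 2)) := by ring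
          _ ≤ C * Q * (Real.exp (18 + k ^ 2) * Real.exp (-(1 / 2) * (s - z.re) ^ 2)) :=
              mul_le_mul_of_nonneg_left a3 (by positivity)
          _ = _ := by ring
    _ = _ := by
        rw [integral_const_mul, integral_sub_right_eq_self fun s : ℝ =>
          Real.exp (-(1 / 2) * s ^ 2)]
        ring

/-- The relative error is at most 1/2 for |Re z| ≥ 2C, and the error is bounded for smaller |Re z|
by monotonicity of σ. -/
theorem re_gaussReg_bounds (hσ : SlowlyVarying σ K) (hK : 0 ≤ K) (k : ℝ) :
    ∃ C : ℝ, 0 < C ∧ ∀ z : ℂ, |z.im| ≤ k →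
      σ |z.re| / 2 - C ≤ (gaussReg σ z).re ∧ (gaussReg σ z).re ≤ 2 * σ |z.re| + C := by
  obtain ⟨C, hC, h⟩ := hσ.gaussReg_sub_le hK k
  have hs2 := hσ.nonneg (2 * C) (by positivity)
  refine ⟨C * (1 + σ (2 * C)) + 1, by positivity, fun z hz => ?_⟩
  have h1 := h z hz
  have h2 : |(gaussReg σ z).re - σ (|z.re|)| ≤ C * ((1 + σ |z.re|) / (1 + |z.re|)) := by
    refine le_trans ?_ h1
    have := Complex.abs_re_le_norm (gaussReg σ z - σ |z.re|)
    simpa using this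
  have hs := hσ.nonneg |z.re| (abs_nonneg _)
  have h3 : C * ((1 + σ |z.re|) / (1 + |z.re|)) ≤ σ |z.re| / 2 + (C * (1 + σ (2 * C)) + 1) := by
    have ha := abs_nonneg z.re
    rcases le_total |z.re| (2 * C) with hle | hle
    · have e1 := hσ.mono (Set.mem_Ici.2 ha) (Set.mem_Ici.2 (by positivity)) hle
      have e2 : (1 + σ |z.re|) / (1 + |z.re|) ≤ 1 + σ (2 * C) :=
        (div_le_self (by positivity) (by linarith)).trans (by linarith)
      have := mul_le_mul_of_nonneg_left e2 hC.le
      linarith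
    · have e2 : C * ((1 + σ |z.re|) / (1 + |z.re|)) ≤ (1 + σ |z.re|) / 2 := by
        rw [mul_div_assoc', div_le_div_iff₀ (by linarith) (by norm_num)]
        nlinarith
      have : 0 ≤ C * (1 + σ (2 * C)) := by positivity
      linarith
  have := abs_le.1 h2
  constructor <;> linarith

end SlowlyVarying

theorem gaussReg_ofReal (σ : ℝ → ℝ) (x : ℝ) : ∃ r : ℝ, gaussReg σ x = r := by
  refine ⟨(√Real.pi)⁻¹ * ∫ s : ℝ, σ |s| * Real.exp (-(x - s) ^ 2), ?_⟩
  rw [gaussReg]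
  push_cast
  congr 1
  rw [← integral_complex_ofReal]
  congr 1
  ext s
  push_cast
  ring_nf

end Ultra

namespace Ultra

/-! ### Inverse Fourier transforms of entire functions -/

theorem integrable_div_one_add_sq (D : ℝ) : Integrable fun x : ℝ => D / (1 + x ^ 2) := by
  simpa only [div_eq_mul_inv] using integrable_inv_one_add_sq.const_mul D

theorem one_add_sq_le_exp (y : ℝ) : 1 + y ^ 2 ≤ Real.exp (2 * |y|) := by
  have h := Real.quadratic_le_exp_of_nonneg (show 0 ≤ 2 * |y| by positivity)
  have := sq_abs y
  nlinarith [abs_nonneg y]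

theorem exp_neg_mul_abs_le {k : ℝ} (hk : 2 ≤ k) (y : ℝ) :
    Real.exp (-k * |y|) ≤ (1 + y ^ 2)⁻¹ := by
  rw [neg_mul, Real.exp_neg]
  refine inv_anti₀ (by positivity) ((one_add_sq_le_exp y).trans (Real.exp_le_exp.2 ?_))
  nlinarith [abs_nonneg y]

theorem integrable_ofReal_of_le {G : ℂ → ℂ} (hG : Continuous G) {B : ℝ} (c : ℝ)
    (h : ∀ z : ℂ, |z.im| ≤ |c| → ‖G z‖ ≤ B / (1 + z.re ^ 2)) :
    Integrable fun x : ℝ => G (x + c * Complex.I) := by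
  refine (integrable_div_one_add_sq B).mono' (Continuous.aestronglyMeasurable (by fun_prop))
    (ae_of_all _ fun x => ?_)
  simpa using h (x + c * Complex.I) (by simp)

/-- Cauchy's theorem on the rectangle with corners ±R and ±R + ci; each vertical side contributes at
most B|c|/(1 + R²). -/
theorem integral_shift_eq {G : ℂ → ℂ} (hG : Differentiable ℂ G) {B : ℝ} (c : ℝ)
    (h : ∀ z : ℂ, |z.im| ≤ |c| → ‖G z‖ ≤ B / (1 + z.re ^ 2)) :
    ∫ x : ℝ, G (x + c * Complex.I) = ∫ x : ℝ, G x := by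
  have hB : 0 ≤ B := by simpa using (norm_nonneg _).trans (h 0 (by simp))
  have i1 : Integrable fun x : ℝ => G (x + c * Complex.I) :=
    integrable_ofReal_of_le hG.continuous c h
  have i0 : Integrable fun x : ℝ => G x := by
    simpa using integrable_ofReal_of_le hG.continuous (B := B) 0
      (fun z hz => h z (hz.trans (by simp)))
  have t1 := intervalIntegral_tendsto_integral i1 tendsto_neg_atTop_atBot tendsto_id
  have t0 := intervalIntegral_tendsto_integral i0 tendsto_neg_atTop_atBot tendsto_id
  have hv : ∀ s : ℝ, |s| = 1 → Tendsto (fun R : ℝ => ∫ y in (0 : ℝ)..c, G ((s * R : ℝ) + y * Complex.I))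
      atTop (𝓝 0) := by
    intro s hs
    refine squeeze_zero_norm (a := fun R : ℝ => B * (1 + R ^ 2)⁻¹ * |c - 0|) (fun R => ?_) ?_
    · refine intervalIntegral.norm_integral_le_of_norm_le_const fun y hy => ?_
      have hy' : |y| ≤ |c| := by
        have := Set.abs_sub_left_of_mem_uIcc (Set.uIoc_subset_uIcc hy)
        simpa using this
      refine (h _ (by simpa using hy')).trans (le_of_eq ?_)
      have : (s * R) ^ 2 = R ^ 2 := by rw [mul_pow, ← sq_abs s, hs]; ring
      simp only [Complex.add_re, Complex.ofReal_re, Complex.mul_re, Complex.I_re, mul_zero,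
        Complex.ofReal_im, Complex.I_im, mul_one, sub_self, add_zero, this]
      rw [div_eq_mul_inv]
    · have : Tendsto (fun R : ℝ => (1 + R ^ 2)⁻¹) atTop (𝓝 0) :=
        tendsto_inv_atTop_zero.comp
          (tendsto_atTop_add_const_left _ _ (tendsto_pow_atTop two_ne_zero))
      simpa using (this.const_mul B).mul_const |c - 0|
  have key : ∀ R : ℝ, (∫ x in (-R)..R, G (x + c * Complex.I)) = (∫ x in (-R)..R, G x) +
      Complex.I • (∫ y in (0 : ℝ)..c, G ((1 * R : ℝ) + y * Complex.I)) -
      Complex.I • ∫ y in (0 : ℝ)..c, G ((-1 * R : ℝ) + y * Complex.I) := by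
    intro R
    have := Complex.integral_boundary_rect_eq_zero_of_differentiableOn G (-R : ℝ)
      (R + c * Complex.I) hG.differentiableOn
    simp only [Complex.ofReal_re, Complex.ofReal_im, Complex.add_re, Complex.mul_re, Complex.I_re,
      mul_zero, Complex.I_im, mul_one, sub_self, add_zero, Complex.add_im, Complex.mul_im,
      zero_add, Complex.ofReal_zero, zero_mul] at this
    rw [one_mul, neg_one_mul]
    rw [sub_eq_zero] at this
    rw [← this]; ring
  have t2 := (t0.add ((hv 1 (by simp)).const_smul Complex.I)).sub
    ((hv (-1) (by simp)).const_smul Complex.I)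
  simp only [smul_zero, add_zero, sub_zero] at t2
  refine tendsto_nhds_unique t1 (t2.congr fun R => ?_)
  exact (key R).symm

/-- The inverse Fourier transform of the restriction of `E` to the real line. -/
def invF (E : ℂ → ℂ) (x : ℝ) : ℂ :=
  ∫ ξ : ℝ, E ξ * Complex.exp (2 * Real.pi * x * ξ * Complex.I)

theorem norm_cexp_two_pi (x : ℝ) (z : ℂ) :
    ‖Complex.exp (2 * Real.pi * x * z * Complex.I)‖ = Real.exp (-(2 * Real.pi * x * z.im)) := by
  rw [Complex.norm_exp]
  congr 1
  simp

/-- Shift the contour to height k on the side given by the sign of x. This gains exp(-2πk|x|), more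
than is claimed; π is the integral of 1/(1 + ξ²). -/
theorem norm_invF_le {E : ℂ → ℂ} (hE : Differentiable ℂ E) {k D : ℝ} (hk : 0 ≤ k)
    (h : ∀ z : ℂ, |z.im| ≤ k → ‖E z‖ ≤ D / (1 + z.re ^ 2)) (x : ℝ) :
    ‖invF E x‖ ≤ Real.pi * D * Real.exp (-k * |x|) := by
  have hD : 0 ≤ D := by simpa using (norm_nonneg _).trans (h 0 (by simpa using hk))
  obtain ⟨c, hc, hcx⟩ : ∃ c : ℝ, |c| = k ∧ x * c = k * |x| := by
    rcases le_total 0 x with hx | hx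
    · exact ⟨k, abs_of_nonneg hk, by rw [abs_of_nonneg hx, mul_comm]⟩
    · exact ⟨-k, by rw [abs_neg, abs_of_nonneg hk], by rw [abs_of_nonpos hx]; ring⟩
  have hG : Differentiable ℂ fun z => E z * Complex.exp (2 * Real.pi * x * z * Complex.I) := by
    fun_prop
  have hb : ∀ z : ℂ, |z.im| ≤ |c| → ‖E z * Complex.exp (2 * Real.pi * x * z * Complex.I)‖ ≤
      (D * Real.exp (2 * Real.pi * |x| * k)) / (1 + z.re ^ 2) := by
    intro z hz
    rw [hc] at hz
    rw [norm_mul, norm_cexp_two_pi, mul_div_right_comm]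
    refine mul_le_mul (h z hz) (Real.exp_le_exp.2 ?_) (Real.exp_pos _).le (by positivity)
    calc -(2 * Real.pi * x * z.im) ≤ |2 * Real.pi * x * z.im| := neg_le_abs _
      _ = 2 * Real.pi * |x| * |z.im| := by
        rw [abs_mul, abs_mul, abs_of_pos (by positivity : 0 < 2 * Real.pi)]
      _ ≤ _ := by gcongr
  rw [invF, ← integral_shift_eq hG c hb]
  calc _ ≤ ∫ ξ : ℝ, D * Real.exp (-k * |x|) / (1 + ξ ^ 2) := by
        refine norm_integral_le_of_norm_le (integrable_div_one_add_sq _) (ae_of_all _ fun ξ => ?_)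
        rw [norm_mul, norm_cexp_two_pi, mul_div_right_comm]
        have h1 := h (ξ + c * Complex.I) (by simp [hc])
        simp only [Complex.add_re, Complex.ofReal_re, Complex.mul_re, Complex.I_re, mul_zero,
          Complex.ofReal_im, Complex.I_im, mul_one, sub_self, add_zero] at h1
        refine mul_le_mul h1 (Real.exp_le_exp.2 ?_) (Real.exp_pos _).le (by positivity)
        simp only [Complex.add_im, Complex.ofReal_im, Complex.mul_im, Complex.ofReal_re,
          Complex.I_im, mul_one, Complex.I_re, mul_zero, add_zero, zero_add]
        rw [mul_assoc _ x c, hcx]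
        have h3 : 0 ≤ k * |x| := by positivity
        nlinarith [Real.pi_gt_three]
    _ = _ := by
        simp only [div_eq_mul_inv]
        rw [integral_const_mul, integral_univ_inv_one_add_sq]; ring

theorem hasDerivAt_invF {E : ℂ → ℂ} (hE : Continuous E) {D : ℝ}
    (h0 : ∀ x : ℝ, ‖E x‖ ≤ D / (1 + x ^ 2))
    (h1 : ∀ x : ℝ, ‖2 * Real.pi * Complex.I * x * E x‖ ≤ D / (1 + x ^ 2)) (x : ℝ) :
    HasDerivAt (invF E) (invF (fun z => 2 * Real.pi * Complex.I * z * E z) x) x := by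
  have hn : ∀ x ξ : ℝ, ‖Complex.exp (2 * Real.pi * x * ξ * Complex.I)‖ = 1 := by
    intro x ξ
    rw [norm_cexp_two_pi]; simp
  refine (hasDerivAt_integral_of_dominated_loc_of_deriv_le (s := Set.univ)
    (F := fun (y : ℝ) (ξ : ℝ) => E ξ * Complex.exp (2 * Real.pi * y * ξ * Complex.I))
    (F' := fun (y : ℝ) (ξ : ℝ) => 2 * Real.pi * Complex.I * ξ * E ξ *
      Complex.exp (2 * Real.pi * y * ξ * Complex.I)) univ_mem
    (Eventually.of_forall fun y => Continuous.aestronglyMeasurable (by fun_prop))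
    ((integrable_div_one_add_sq D).mono' (Continuous.aestronglyMeasurable (by fun_prop))
      (ae_of_all _ fun ξ => ?_))
    (Continuous.aestronglyMeasurable (by fun_prop))
    (bound := fun ξ => D / (1 + ξ ^ 2))
    (ae_of_all _ fun ξ y _ => ?_) (integrable_div_one_add_sq D)
    (ae_of_all _ fun ξ y _ => ?_)).2
  · rw [norm_mul, hn, mul_one]; exact h0 ξ
  · rw [norm_mul, hn, mul_one]; exact h1 ξ
  · have e1 : HasDerivAt (fun y : ℝ => 2 * Real.pi * (y : ℂ) * ξ * Complex.I)
        (2 * Real.pi * ξ * Complex.I) y := by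
      have := ((((hasDerivAt_id y).ofReal_comp).const_mul (2 * Real.pi : ℂ)).mul_const
        (ξ : ℂ)).mul_const Complex.I
      simpa using this
    refine (e1.cexp.const_mul (E ξ)).congr_deriv ?_
    ring

/-- A sequence of functions on the line, each the derivative of the preceding one. -/
def IsJet (a : ℕ → ℝ → ℂ) : Prop := ∀ n x, HasDerivAt (a n) (a (n + 1) x) x

theorem IsJet.continuous {a : ℕ → ℝ → ℂ} (h : IsJet a) (n : ℕ) : Continuous (a n) :=
  continuous_iff_continuousAt.2 fun x => (h n x).continuousAt

theorem isJet_invF {E : ℂ → ℂ} (hE : Continuous E)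
    (h : ∀ n : ℕ, ∃ D : ℝ, ∀ x : ℝ, ‖(2 * Real.pi * Complex.I * x) ^ n * E x‖ ≤ D / (1 + x ^ 2)) :
    IsJet fun n => invF fun z => (2 * Real.pi * Complex.I * z) ^ n * E z := by
  intro n x
  obtain ⟨D, hD⟩ := h n
  obtain ⟨D', hD'⟩ := h (n + 1)
  have := hasDerivAt_invF (E := fun z => (2 * Real.pi * Complex.I * z) ^ n * E z) (by fun_prop)
    (D := max D D') (fun x => (hD x).trans (by gcongr; exact le_max_left _ _))
    (fun x => by
      have := (hD' x).trans (div_le_div_of_nonneg_right (le_max_right D D') (by positivity))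
      rwa [pow_succ', mul_assoc] at this) x
  refine this.congr_deriv ?_
  congr 1
  ext z
  ring

open FourierTransform in
theorem fourier_invF {E : ℂ → ℂ} (hE : Continuous E) (h0 : Integrable fun x : ℝ => E x)
    (h1 : Integrable (invF E)) (ξ : ℝ) :
    ∫ u : ℝ, invF E u * Complex.exp (-(2 * Real.pi * u * ξ * Complex.I)) = E ξ := by
  have e1 : 𝓕⁻ (fun x : ℝ => E x) = invF E := by
    ext x
    rw [Real.fourierInv_eq', invF]
    congr 1
    ext v
    rw [smul_eq_mul, mul_comm]
    congr 2
    simp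
    ring
  have e2 : 𝓕 (fun x : ℝ => E x) = fun x => invF E (-x) := by
    ext x
    rw [Real.fourier_eq', invF]
    congr 1
    ext v
    rw [smul_eq_mul, mul_comm]
    congr 2
    simp
    ring
  have hc : Continuous fun x : ℝ => E x := by fun_prop
  have h := hc.fourier_fourierInv_eq h0 (by rw [e2]; exact h1.comp_neg)
  rw [e1] at h
  have h2 := congrFun h ξ
  rw [Real.fourier_eq'] at h2
  rw [← h2]
  congr 1
  ext v
  rw [smul_eq_mul, mul_comm]
  congr 2
  simp
  ring

end Ultra

namespace Ultra

/-! ### One-dimensional kernels -/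

/-- The entire function `exp (-q)`, where `q` is the Gaussian regularization of `log ∘ a`. -/
def expSymbol (a : ℝ → ℝ) (z : ℂ) : ℂ := Complex.exp (-gaussReg (fun t => Real.log (a t)) z)

/-- The sequence of derivatives of the inverse Fourier transform of `exp (-q)`. -/
def kernelJet (a : ℝ → ℝ) (n : ℕ) : ℝ → ℂ :=
  invF fun z => (2 * Real.pi * Complex.I * z) ^ n * expSymbol a z

variable {M : WeightSequence} {θ : ℝ → ℝ} {K : ℝ}

theorem differentiable_expSymbol {a : ℝ → ℝ} (hσ : SlowlyVarying (fun t => Real.log (a t)) K) :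
    Differentiable ℂ (expSymbol a) :=
  hσ.differentiable_gaussReg.neg.cexp

/-- Exponentiation of log(a)/2 - C ≤ Re q ≤ 2 log(a) + C; the square in the first bound avoids a
square root of `a`. -/
theorem expSymbol_bounds {a : ℝ → ℝ} (ha : ∀ t, 0 < a t)
    (hσ : SlowlyVarying (fun t => Real.log (a t)) K) (hK : 0 ≤ K) (k : ℝ) :
    ∃ C : ℝ, 0 < C ∧ ∀ z : ℂ, |z.im| ≤ k →
      ‖expSymbol a z‖ ^ 2 * a |z.re| ≤ C ^ 2 ∧ ‖(expSymbol a z)⁻¹‖ ≤ C * a |z.re| ^ 2 := by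
  obtain ⟨C, hC, h⟩ := hσ.re_gaussReg_bounds hK k
  refine ⟨Real.exp C, Real.exp_pos C, fun z hz => ?_⟩
  obtain ⟨h1, h2⟩ := h z hz
  have e0 : ‖expSymbol a z‖ = Real.exp (-(gaussReg (fun t => Real.log (a t)) z).re) := by
    rw [expSymbol, Complex.norm_exp, Complex.neg_re]
  have e1 : a |z.re| = Real.exp (Real.log (a |z.re|)) := (Real.exp_log (ha _)).symm
  rw [norm_inv, e0, ← Real.exp_neg, neg_neg]
  constructor
  · rw [e1, ← Real.exp_nat_mul, ← Real.exp_nat_mul, ← Real.exp_add]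
    refine Real.exp_le_exp.2 ?_
    push_cast
    linarith
  · rw [e1, ← Real.exp_nat_mul, ← Real.exp_add]
    refine Real.exp_le_exp.2 ?_
    push_cast
    linarith

namespace WeightSequence

theorem assoc_le_mul_assoc (M : WeightSequence) {s t u : ℝ} (hu : 0 ≤ u)
    (h : u ≤ s + t) : M.assoc u ≤ M.assoc (2 * s) * M.assoc (2 * t) := by
  rcases le_total s t with hst | hst
  · exact (M.assoc_mono hu (by linarith)).trans
      (le_mul_of_one_le_left (M.assoc_pos _).le (M.one_le_assoc _))
  · exact (M.assoc_mono hu (by linarith)).trans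
      (le_mul_of_one_le_right (M.assoc_pos _).le (M.one_le_assoc _))

/-- The symbol `E` decays at the rate `h` on all horizontal strips. -/
def Decays (M : WeightSequence) (h : ℝ) (E : ℂ → ℂ) : Prop :=
  ∀ k : ℝ, 0 ≤ k → ∃ C : ℝ, ∀ n : ℕ, ∀ z : ℂ, |z.im| ≤ k →
    ‖(2 * Real.pi * Complex.I * z) ^ n * E z‖ ≤ C * M.M n / h ^ n / (1 + z.re ^ 2)

/-- The power |2πz|^n is at most M_n/h^n times `assoc` at 2πh|z|, and |z| ≤ |Re z| + k splits off a
factor depending only on k. The rest is controlled by the square root of `a`, which is the decay of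
the symbol. -/
theorem decays_expSymbol (M : WeightSequence) (hK : 0 ≤ K) {a : ℝ → ℝ} (ha : ∀ t, 0 < a t)
    (hσ : SlowlyVarying (fun t => Real.log (a t)) K) {h : ℝ}
    (hh : 0 < h) (hb : ∃ C, ∀ t, 0 ≤ t →
      (M.assoc (4 * Real.pi * h * t) * (1 + t ^ 2)) ^ 2 ≤ C * a t) :
    M.Decays h (expSymbol a) := by
  intro k hk
  obtain ⟨C, hC, h1⟩ := expSymbol_bounds ha hσ hK k
  obtain ⟨B, hB⟩ := hb
  have hB0 : 0 ≤ B := by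
    by_contra hneg
    have := (sq_nonneg _).trans (hB 0 le_rfl)
    have := mul_neg_of_neg_of_pos (not_le.1 hneg) (ha 0)
    linarith
  set L := M.assoc (4 * Real.pi * h * k)
  have hL : 0 < L := M.assoc_pos _
  refine ⟨√B * C * L, fun n z hz => ?_⟩
  obtain ⟨h2, -⟩ := h1 z hz
  have hr := abs_nonneg z.re
  have h3 := hB |z.re| hr
  rw [sq_abs] at h3
  set r := |z.re|
  have hpi := Real.pi_pos
  have e1 : ‖z‖ ≤ r + k := (Complex.norm_le_abs_re_add_abs_im z).trans (by gcongr)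
  have e2 : ‖2 * Real.pi * Complex.I * z‖ ^ n ≤ M.M n / h ^ n * (M.assoc (4 * Real.pi * h * r) * L) := by
    have a1 : ‖2 * Real.pi * Complex.I * z‖ = 2 * Real.pi * ‖z‖ := by
      rw [norm_mul, norm_mul, norm_mul, Complex.norm_I, Complex.norm_real, Complex.norm_ofNat,
        Real.norm_of_nonneg hpi.le, mul_one]
    rw [a1, div_mul_eq_mul_div, le_div_iff₀ (by positivity), ← mul_pow]
    refine (M.pow_le_mul_assoc _ n).trans (mul_le_mul_of_nonneg_left ?_ (M.pos n).le)
    have := M.assoc_le_mul_assoc (s := 2 * Real.pi * h * r) (t := 2 * Real.pi * h * k)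
      (u := 2 * Real.pi * ‖z‖ * h) (by positivity)
      (by have : 2 * Real.pi * h * ‖z‖ ≤ 2 * Real.pi * h * (r + k) := by gcongr
          linarith)
    rwa [show 2 * (2 * Real.pi * h * r) = 4 * Real.pi * h * r by ring,
      show 2 * (2 * Real.pi * h * k) = 4 * Real.pi * h * k by ring] at this
  have e3 : M.assoc (4 * Real.pi * h * r) * (1 + z.re ^ 2) * ‖expSymbol a z‖ ≤ √B * C := by
    refine abs_le_of_sq_le_sq' ?_ (by positivity) |>.2
    rw [mul_pow, mul_pow √B, Real.sq_sqrt hB0]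
    calc _ ≤ B * a r * ‖expSymbol a z‖ ^ 2 := by gcongr
      _ = B * (‖expSymbol a z‖ ^ 2 * a r) := by ring
      _ ≤ _ := by gcongr
  rw [norm_mul, norm_pow, le_div_iff₀ (by positivity)]
  have hM := M.pos n
  calc _ ≤ M.M n / h ^ n * (M.assoc (4 * Real.pi * h * r) * L) * ‖expSymbol a z‖ *
        (1 + z.re ^ 2) := by gcongr
    _ = M.M n / h ^ n * L * (M.assoc (4 * Real.pi * h * r) * (1 + z.re ^ 2) * ‖expSymbol a z‖) := by
        ring
    _ ≤ M.M n / h ^ n * L * (√B * C) := by gcongr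
    _ = _ := by ring

/-- The jet `a` has the regularity `h` and decays faster than all exponentials. -/
def JetBound (M : WeightSequence) (h : ℝ) (a : ℕ → ℝ → ℂ) : Prop :=
  ∀ k : ℝ, 0 ≤ k → ∃ C : ℝ, ∀ n y, ‖a n y‖ ≤ C * M.M n / h ^ n * Real.exp (-k * |y|)

theorem Decays.jetBound {h : ℝ} {E : ℂ → ℂ} (hE : Differentiable ℂ E) (hd : M.Decays h E) :
    M.JetBound h fun n => invF fun z => (2 * Real.pi * Complex.I * z) ^ n * E z := by
  intro k hk
  obtain ⟨C, hC⟩ := hd k hk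
  refine ⟨Real.pi * C, fun n y => ?_⟩
  refine (norm_invF_le (by fun_prop) hk (hC n) y).trans (le_of_eq ?_)
  ring

theorem Decays.isJet {h : ℝ} {E : ℂ → ℂ} (hE : Continuous E) (hd : M.Decays h E) :
    IsJet fun n => invF fun z => (2 * Real.pi * Complex.I * z) ^ n * E z := by
  obtain ⟨C, hC⟩ := hd 0 le_rfl
  exact isJet_invF hE fun n => ⟨_, fun x => by simpa using hC n x (by simp)⟩

end WeightSequence

end Ultra

/-! ### Kernels that undo the symbol near a given frequency. -/

namespace Ultra

variable {M : WeightSequence} {θ : ℝ → ℝ} {K : ℝ}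

/-- The inverse Fourier transform of `z ↦ exp (q z) exp (-q₀ (z - τ))`. -/
def shiftedKernel (a a₀ : ℝ → ℝ) (τ : ℝ) : ℝ → ℂ :=
  invF fun z => (expSymbol a z)⁻¹ * expSymbol a₀ (z - τ)

theorem differentiable_shiftedSymbol {a a₀ : ℝ → ℝ}
    (hσ : SlowlyVarying (fun t => Real.log (a t)) K)
    (hσ₀ : SlowlyVarying (fun t => Real.log (a₀ t)) K) (τ : ℂ) :
    Differentiable ℂ fun z => (expSymbol a z)⁻¹ * expSymbol a₀ (z - τ) := by
  have h1 := differentiable_expSymbol hσ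
  have h2 := differentiable_expSymbol hσ₀
  exact (h1.inv fun z => Complex.exp_ne_zero _).mul
    (h2.comp (differentiable_id.sub_const τ))

/-- The growth of exp(q) is at most that of a² at r = |Re z|, while the second factor is
concentrated near τ. The hypothesis `hcmp` splits the growth at r into growth at t = |τ| and a part
that the decay at s = |Re z - τ| absorbs. -/
theorem shiftedSymbol_le {a a₀ : ℝ → ℝ} (ha : ∀ t, 0 < a t) (ha₀ : ∀ t, 0 < a₀ t)
    (hσ : SlowlyVarying (fun t => Real.log (a t)) K)
    (hσ₀ : SlowlyVarying (fun t => Real.log (a₀ t)) K) (hK : 0 ≤ K) {A : ℕ} {B : ℝ} (hB : 0 ≤ B)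
    (hcmp : ∀ r s t, 0 ≤ r → 0 ≤ s → 0 ≤ t → r ≤ s + t →
      (a r ^ 2 * (1 + r ^ 2)) ^ 2 ≤ B * (a t ^ A * (1 + t ^ 2)) ^ 2 * a₀ s) (k : ℝ) :
    ∃ C : ℝ, 0 < C ∧ ∀ (τ : ℝ) (z : ℂ), |z.im| ≤ k →
      ‖(expSymbol a z)⁻¹ * expSymbol a₀ (z - τ)‖ ≤
        C * (a |τ| ^ A * (1 + τ ^ 2)) / (1 + z.re ^ 2) := by
  obtain ⟨C, hC, h⟩ := expSymbol_bounds ha hσ hK k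
  obtain ⟨C₀, hC₀, h₀⟩ := expSymbol_bounds ha₀ hσ₀ hK k
  refine ⟨C * (√B * C₀) + 1, by positivity, fun τ z hz => ?_⟩
  obtain ⟨-, h1⟩ := h z hz
  obtain ⟨h2, -⟩ := h₀ (z - τ) (by simpa using hz)
  have h3 := hcmp |z.re| |(z - τ).re| |τ| (abs_nonneg _) (abs_nonneg _) (abs_nonneg _) (by
    have := abs_add_le (z - τ).re τ
    simpa using this)
  rw [sq_abs, sq_abs] at h3
  set r := |z.re|
  set s := |(z - τ).re|
  set T := a |τ| ^ A * (1 + τ ^ 2)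
  have hT : 0 ≤ T := mul_nonneg (pow_nonneg (ha _).le _) (by positivity)
  have e3 : a r ^ 2 * (1 + z.re ^ 2) * ‖expSymbol a₀ (z - τ)‖ ≤ T * (√B * C₀) := by
    refine abs_le_of_sq_le_sq' ?_ (by positivity) |>.2
    rw [mul_pow, mul_pow T, mul_pow √B, Real.sq_sqrt hB]
    calc _ ≤ B * T ^ 2 * a₀ s * ‖expSymbol a₀ (z - τ)‖ ^ 2 := by gcongr
      _ = B * T ^ 2 * (‖expSymbol a₀ (z - τ)‖ ^ 2 * a₀ s) := by ring
      _ ≤ B * T ^ 2 * C₀ ^ 2 := by gcongr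
      _ = _ := by ring
  rw [norm_mul, le_div_iff₀ (by positivity)]
  calc _ ≤ C * a r ^ 2 * ‖expSymbol a₀ (z - τ)‖ * (1 + z.re ^ 2) := by gcongr
    _ = C * (a r ^ 2 * (1 + z.re ^ 2) * ‖expSymbol a₀ (z - τ)‖) := by ring
    _ ≤ C * (T * (√B * C₀)) := by gcongr
    _ ≤ _ := by nlinarith

theorem stronglyMeasurable_shiftedKernel {a a₀ : ℝ → ℝ}
    (hσ : SlowlyVarying (fun t => Real.log (a t)) K)
    (hσ₀ : SlowlyVarying (fun t => Real.log (a₀ t)) K) :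
    StronglyMeasurable (Function.uncurry (shiftedKernel a a₀)) := by
  have h1 := (differentiable_expSymbol hσ).continuous
  have h2 := (differentiable_expSymbol hσ₀).continuous
  have h3 : Continuous fun z => (expSymbol a z)⁻¹ := h1.inv₀ fun z => Complex.exp_ne_zero _
  refine StronglyMeasurable.integral_prod_right (f := fun (p : ℝ × ℝ) (ξ : ℝ) =>
    ((expSymbol a ξ)⁻¹ * expSymbol a₀ (ξ - p.1)) *
      Complex.exp (2 * Real.pi * p.2 * ξ * Complex.I)) ?_
  refine Continuous.stronglyMeasurable ?_
  have h4 : Continuous fun p : (ℝ × ℝ) × ℝ => (expSymbol a p.2)⁻¹ :=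
    h3.comp (by fun_prop : Continuous fun p : (ℝ × ℝ) × ℝ => (p.2 : ℂ))
  have h5 : Continuous fun p : (ℝ × ℝ) × ℝ => expSymbol a₀ (p.2 - p.1.1) :=
    h2.comp (by fun_prop : Continuous fun p : (ℝ × ℝ) × ℝ => (p.2 - p.1.1 : ℂ))
  have h6 : Continuous fun p : (ℝ × ℝ) × ℝ =>
      Complex.exp (2 * Real.pi * p.1.2 * p.2 * Complex.I) := by fun_prop
  exact (h4.mul h5).mul h6

theorem integrable_of_exp_bound {f : ℝ → ℂ} (hf : AEStronglyMeasurable f) {C : ℝ}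
    (h : ∀ y, ‖f y‖ ≤ C * Real.exp (-2 * |y|)) : Integrable f := by
  have hC : 0 ≤ C := by simpa using (norm_nonneg _).trans (h 0)
  refine (integrable_div_one_add_sq C).mono' hf (ae_of_all _ fun y => (h y).trans ?_)
  rw [div_eq_mul_inv]
  exact mul_le_mul_of_nonneg_left (exp_neg_mul_abs_le le_rfl y) hC

/-- Fubini applies to the product of `invF E` and F, and Fourier inversion recovers E; integrability
of `invF F` is not needed. -/
theorem integral_mul_invF_sub {E F : ℂ → ℂ} (hE : Continuous E)
    (hEi : Integrable fun x : ℝ => E x) (hFi : Integrable fun x : ℝ => F x)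
    (hψ : Integrable (invF E)) (y : ℝ) :
    ∫ u : ℝ, invF E u * invF F (y - u) = invF (fun z => E z * F z) y := by
  have hF1 : ∀ u : ℝ, invF E u * invF F (y - u) = ∫ ξ : ℝ, invF E u *
      (F ξ * Complex.exp (2 * Real.pi * (y - u : ℝ) * ξ * Complex.I)) := by
    intro u
    rw [integral_const_mul]
    rfl
  simp_rw [hF1]
  rw [integral_integral_swap]
  · rw [invF]
    congr 1
    ext ξ
    rw [← fourier_invF hE hEi hψ ξ, ← integral_mul_const, ← integral_mul_const]
    congr 1
    ext u
    have e : Complex.exp (2 * Real.pi * (y - u : ℝ) * ξ * Complex.I) =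
        Complex.exp (-(2 * Real.pi * u * ξ * Complex.I)) *
          Complex.exp (2 * Real.pi * y * ξ * Complex.I) := by
      rw [← Complex.exp_add]
      congr 1
      push_cast
      ring
    rw [e]
    ring
  · have := hψ.mul_prod hFi
    refine (this.mul_bdd (c := 1) (g := fun p : ℝ × ℝ =>
      Complex.exp (2 * Real.pi * (y - p.1 : ℝ) * p.2 * Complex.I))
      (Continuous.aestronglyMeasurable (by fun_prop))
      (ae_of_all _ fun p => ?_)).congr (ae_of_all _ fun p => ?_)
    · have := norm_cexp_two_pi (y - p.1) p.2
      rw [this]; simp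
    · simp only [Function.uncurry]
      ring

theorem invF_comp_sub (E : ℂ → ℂ) (τ y : ℝ) :
    invF (fun z => E (z - τ)) y = Complex.exp (2 * Real.pi * τ * y * Complex.I) * invF E y := by
  rw [invF, invF, ← integral_add_right_eq_self _ τ, ← integral_const_mul]
  congr 1
  ext ξ
  rw [mul_left_comm, ← Complex.exp_add]
  congr 2
  · push_cast; ring
  · push_cast; ring

/-- The symbol is real on the real line, so its inverse transform is Hermitian. -/
theorem invF_expSymbol_neg (a : ℝ → ℝ) (y : ℝ) :
    invF (expSymbol a) (-y) = (starRingEnd ℂ) (invF (expSymbol a) y) := by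
  rw [invF, invF, ← integral_conj]
  congr 1
  ext ξ
  rw [map_mul, ← Complex.exp_conj]
  congr 2
  · obtain ⟨r, hr⟩ := gaussReg_ofReal (fun t => Real.log (a t)) ξ
    rw [expSymbol, hr, ← Complex.exp_conj]
    simp
  · simp only [map_mul, Complex.conj_ofReal, Complex.conj_I, map_ofNat]
    push_cast
    ring

/-- The symbol is positive on the real line, and the value at 0 is its integral. -/
theorem invF_expSymbol_zero_ne {a : ℝ → ℝ} (hσ : SlowlyVarying (fun t => Real.log (a t)) K)
    (hi : Integrable fun x : ℝ => expSymbol a x) : invF (expSymbol a) 0 ≠ 0 := by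
  have h0 : ∀ ξ : ℝ, expSymbol a ξ = (‖expSymbol a ξ‖ : ℝ) := by
    intro ξ
    obtain ⟨r, hr⟩ := gaussReg_ofReal (fun t => Real.log (a t)) ξ
    rw [expSymbol, hr, ← Complex.ofReal_neg, ← Complex.ofReal_exp, Complex.norm_real,
      Real.norm_of_nonneg (Real.exp_pos _).le]
  have h1 : invF (expSymbol a) 0 = (∫ ξ : ℝ, ‖expSymbol a ξ‖ : ℝ) := by
    rw [← integral_complex_ofReal, invF]
    congr 1
    ext ξ
    rw [← h0]
    simp
  rw [h1, Complex.ofReal_ne_zero]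
  have hc : Continuous fun ξ : ℝ => ‖expSymbol a ξ‖ := by
    have := (differentiable_expSymbol hσ).continuous
    fun_prop
  refine ((integral_pos_iff_support_of_nonneg (fun ξ => norm_nonneg _) hi.norm).2 ?_).ne'
  have : Function.support (fun ξ : ℝ => ‖expSymbol a ξ‖) = Set.univ :=
    Set.eq_univ_of_forall fun ξ => norm_ne_zero_iff.2 (Complex.exp_ne_zero _)
  rw [this]
  simp

/-- By Hermitian symmetry the integrand is the squared modulus of a continuous function that does
not vanish at 0. This integral normalizes the deconvolution. -/
theorem integral_mul_neg_ne_zero {a : ℝ → ℝ} (hσ : SlowlyVarying (fun t => Real.log (a t)) K)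
    (hi : Integrable fun x : ℝ => expSymbol a x) (hc : Continuous (invF (expSymbol a)))
    (hb : Integrable fun y => ‖invF (expSymbol a) y‖ ^ 2) :
    ∫ y, invF (expSymbol a) y * invF (expSymbol a) (-y) ≠ 0 := by
  have h1 : ∫ y, invF (expSymbol a) y * invF (expSymbol a) (-y) =
      (∫ y, ‖invF (expSymbol a) y‖ ^ 2 : ℝ) := by
    rw [← integral_complex_ofReal]
    congr 1
    ext y
    rw [invF_expSymbol_neg, Complex.mul_conj']
    push_cast
    rfl
  rw [h1, Complex.ofReal_ne_zero]
  refine ((integral_pos_iff_support_of_nonneg (fun ξ => by positivity) hb).2 ?_).ne'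
  refine IsOpen.measure_pos _ ((hc.norm.pow 2).isOpen_support) ⟨0, ?_⟩
  exact pow_ne_zero 2 (norm_ne_zero_iff.2 (invF_expSymbol_zero_ne hσ hi))

end Ultra

/-! ### Comparison of growth rates and construction of the kernels. -/

namespace Ultra

namespace WeightSequence

variable {M : WeightSequence}

theorem M2star.assoc_four_mul (hM : M.M2star) : ∃ C : ℝ, 1 ≤ C ∧ ∃ m : ℕ,
    ∀ t, 0 ≤ t → M.assoc (4 * t) ≤ C * M.assoc t ^ m := by
  obtain ⟨C, hC, n, -, h⟩ := hM.assoc_two_mul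
  refine ⟨C * C ^ n, one_le_mul_of_one_le_of_one_le hC (one_le_pow₀ hC), n * n, fun t ht => ?_⟩
  calc M.assoc (4 * t) = M.assoc (2 * (2 * t)) := by ring_nf
    _ ≤ C * M.assoc (2 * t) ^ n := h _ (by positivity)
    _ ≤ C * (C * M.assoc t ^ n) ^ n := by
      have := M.assoc_pos (2 * t)
      gcongr
      exact h t ht
    _ = _ := by rw [mul_pow, ← pow_mul, mul_assoc]

theorem moderate_mul_one_add {L : ℝ} (hL : 0 ≤ L) : Moderate fun t => L * (t * (1 + t)) where
  nonneg t ht := by positivity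
  mono s hs t ht hst := by
    have : 0 ≤ s := hs
    dsimp only
    gcongr
  le_sq t ht l hl := by
    have h1 : l * t * (1 + l * t) ≤ l ^ 2 * (t * (1 + t)) := by
      have : l * t ≤ l ^ 2 * t := by
        rw [sq]
        exact mul_le_mul_of_nonneg_right (le_mul_of_one_le_left (by linarith) hl) ht
      nlinarith
    calc L * (l * t * (1 + l * t)) ≤ L * (l ^ 2 * (t * (1 + t))) := by gcongr
      _ = _ := by ring

theorem one_add_sq_le (M : WeightSequence) {t : ℝ} (ht : 0 ≤ t) :
    1 + t ^ 2 ≤ 2 * M.assoc (4 * (t * (1 + t))) := by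
  have h1 := M.one_le_assoc (4 * (t * (1 + t)))
  have h2 := M.self_le_assoc (4 * (t * (1 + t)))
  nlinarith

/-- The function `θ` grows so fast that `exp (-q)` has the regularity `h`. -/
def Dominates (M : WeightSequence) (h : ℝ) (a : ℝ → ℝ) : Prop :=
  ∃ C, ∀ t, 0 ≤ t → (M.assoc (4 * Real.pi * h * t) * (1 + t ^ 2)) ^ 2 ≤ C * a t

/-- The quadratic growth of t(1 + t) overtakes 4πht for every h: either 4πh ≤ 1 + t, or t is bounded
and only a constant is lost. Hence the window is regular at all scales. -/
theorem dominates_moderate (M : WeightSequence) {C H : ℝ}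
    (h6 : ∀ t, 0 ≤ t → M.assoc t ^ 6 ≤ C * M.assoc (H * t)) {h : ℝ} (hh : 0 < h) :
    M.Dominates h fun t => M.assoc (H * 4 * (t * (1 + t))) := by
  have hpi := Real.pi_pos
  refine ⟨4 * M.assoc ((4 * Real.pi * h) ^ 2) ^ 2 * C, fun t ht => ?_⟩
  have hx : 0 ≤ 4 * (t * (1 + t)) := by positivity
  have e1 := M.one_add_sq_le ht
  have e2 := h6 _ hx
  have e0 := M.one_le_assoc (4 * (t * (1 + t)))
  have e3 : M.assoc (4 * Real.pi * h * t) ≤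
      M.assoc ((4 * Real.pi * h) ^ 2) * M.assoc (4 * (t * (1 + t))) := by
    rcases le_total (4 * Real.pi * h) (1 + t) with hle | hle
    · refine (M.assoc_mono (by positivity) ?_).trans
        (le_mul_of_one_le_left (M.assoc_pos _).le (M.one_le_assoc _))
      nlinarith
    · refine (M.assoc_mono (by positivity) ?_).trans
        (le_mul_of_one_le_right (M.assoc_pos _).le (M.one_le_assoc _))
      rw [sq]
      gcongr
      linarith
  rw [← mul_assoc H] at e2
  have e4 := M.assoc_pos ((4 * Real.pi * h) ^ 2)
  set X := M.assoc (4 * (t * (1 + t)))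
  set B := M.assoc ((4 * Real.pi * h) ^ 2)
  calc _ ≤ (B * X * (2 * X)) ^ 2 := by
        have := (M.assoc_pos (4 * Real.pi * h * t)).le
        gcongr
    _ = 4 * B ^ 2 * X ^ 4 := by ring
    _ ≤ 4 * B ^ 2 * X ^ 6 := by gcongr <;> norm_num [e0]
    _ ≤ 4 * B ^ 2 * (C * M.assoc (H * 4 * (t * (1 + t)))) := by gcongr
    _ = _ := by ring

/-- Since r ≤ 2 max(s, t), the value at θ(r) is at most the product of those at θ(2s) and θ(2t). The
first is left to the window through θ(2s) ≤ 4s(1 + s); the second returns to θ(t) by θ(2t) ≤ 4θ(t)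
and (M.2)^*. -/
theorem compare_moderate (M : WeightSequence) {C₂ C H : ℝ} {m : ℕ} (hC₂ : 1 ≤ C₂)
    (h4 : ∀ t, 0 ≤ t → M.assoc (4 * t) ≤ C₂ * M.assoc t ^ m)
    (h6 : ∀ t, 0 ≤ t → M.assoc t ^ 6 ≤ C * M.assoc (H * t)) {θ : ℝ → ℝ} (hθ : Moderate θ)
    (hle : ∀ t, 0 ≤ t → θ t ≤ t * (1 + t)) (r s t : ℝ) (hr : 0 ≤ r) (hs : 0 ≤ s) (ht : 0 ≤ t)
    (hrst : r ≤ s + t) :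
    (M.assoc (θ r) ^ 2 * (1 + r ^ 2)) ^ 2 ≤ 16 * C₂ ^ 4 * C *
      (M.assoc (θ t) ^ (2 * m) * (1 + t ^ 2)) ^ 2 * M.assoc (H * 4 * (s * (1 + s))) := by
  have e1 := M.one_add_sq_le hs
  have e2 := h6 (4 * (s * (1 + s))) (by positivity)
  rw [← mul_assoc H] at e2
  have e3 : M.assoc (θ (2 * s)) ≤ M.assoc (4 * (s * (1 + s))) := by
    refine M.assoc_mono (hθ.nonneg _ (by positivity)) ((hle _ (by positivity)).trans ?_)
    nlinarith
  have e4 : M.assoc (θ (2 * t)) ≤ C₂ * M.assoc (θ t) ^ m := by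
    refine (M.assoc_mono (hθ.nonneg _ (by positivity)) (hθ.le_sq t ht 2 (by norm_num))).trans ?_
    rw [show (2 : ℝ) ^ 2 = 4 by norm_num]
    exact h4 _ (hθ.nonneg t ht)
  have hmono : ∀ x, r ≤ x → M.assoc (θ r) ≤ M.assoc (θ x) := fun x hx =>
    M.assoc_mono (hθ.nonneg _ hr) (hθ.mono hr (Set.mem_Ici.2 (hr.trans hx)) hx)
  have e5 : M.assoc (θ r) ≤ M.assoc (θ (2 * s)) * M.assoc (θ (2 * t)) := by
    rcases le_total s t with hst | hst
    · exact (hmono _ (by linarith)).trans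
        (le_mul_of_one_le_left (M.assoc_pos _).le (M.one_le_assoc _))
    · exact (hmono _ (by linarith)).trans
        (le_mul_of_one_le_right (M.assoc_pos _).le (M.one_le_assoc _))
  have p1 := M.assoc_pos (4 * (s * (1 + s)))
  have p2 := M.assoc_pos (θ t)
  have p3 := M.assoc_pos (θ r)
  have e6 : M.assoc (θ r) ≤ M.assoc (4 * (s * (1 + s))) * (C₂ * M.assoc (θ t) ^ m) :=
    e5.trans (mul_le_mul e3 e4 (M.assoc_pos _).le p1.le)
  have e7 : 1 + r ^ 2 ≤ 2 * ((1 + s ^ 2) * (1 + t ^ 2)) := by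
    have : r ^ 2 ≤ (s + t) ^ 2 := pow_le_pow_left₀ hr hrst 2
    nlinarith [sq_nonneg (s - t), mul_nonneg (sq_nonneg s) (sq_nonneg t)]
  set X := M.assoc (4 * (s * (1 + s)))
  set T := M.assoc (θ t)
  calc _ ≤ ((X * (C₂ * T ^ m)) ^ 2 * (2 * (2 * X * (1 + t ^ 2)))) ^ 2 := by
        gcongr
        exact e7.trans (by gcongr)
    _ = 16 * C₂ ^ 4 * X ^ 6 * (T ^ (2 * m) * (1 + t ^ 2)) ^ 2 := by rw [mul_comm 2 m, pow_mul]; ring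
    _ ≤ 16 * C₂ ^ 4 * (C * M.assoc (H * 4 * (s * (1 + s)))) * (T ^ (2 * m) * (1 + t ^ 2)) ^ 2 := by
        gcongr
    _ = _ := by ring

theorem JetBound.integrable {h : ℝ} {a : ℕ → ℝ → ℂ} (hb : M.JetBound h a) (hc : Continuous (a 0)) :
    Integrable (a 0) := by
  obtain ⟨C, hC⟩ := hb 2 (by norm_num)
  exact integrable_of_exp_bound (C := C) hc.aestronglyMeasurable fun y => by
    simpa [M.zero] using hC 0 y

theorem Decays.integrable {h : ℝ} {E : ℂ → ℂ} (hE : Continuous E) (hd : M.Decays h E) :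
    Integrable fun x : ℝ => E x := by
  obtain ⟨C, hC⟩ := hd 0 le_rfl
  refine (integrable_div_one_add_sq C).mono' (Continuous.aestronglyMeasurable (by fun_prop))
    (ae_of_all _ fun x => ?_)
  simpa [M.zero] using hC 0 x (by simp)

/-- Existence of a window `g`, of convolutors `ψ` with prescribed decay of their Fourier transforms,
and of kernels `κ` with `ψ ∗ κ τ = exp (2 π i τ ·) g`. -/
theorem exists_kernels (hM : M.M2) (hM' : M.M2star) : ∃ (g : ℕ → ℝ → ℂ) (A : ℕ), IsJet g ∧
    (∀ h, 0 < h → M.JetBound h g) ∧ ∫ y, g 0 y * g 0 (-y) ≠ 0 ∧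
    ∀ θ, Moderate θ → (∀ t, 0 ≤ t → θ t ≤ t * (1 + t)) →
      (∃ h, 0 < h ∧ M.Dominates h fun t => M.assoc (θ t)) →
      ∃ (ψ : ℕ → ℝ → ℂ) (κ : ℝ → ℝ → ℂ), IsJet ψ ∧
        (∀ h, 0 < h → (M.Dominates h fun t => M.assoc (θ t)) → M.JetBound h ψ) ∧
        StronglyMeasurable (Function.uncurry κ) ∧
        (∀ k, 0 ≤ k → ∃ C, ∀ τ y, ‖κ τ y‖ ≤
          C * (M.assoc (θ |τ|) ^ A * (1 + τ ^ 2)) * Real.exp (-k * |y|)) ∧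
        ∀ τ y, ∫ u, ψ 0 u * κ τ (y - u) =
          Complex.exp (2 * Real.pi * τ * y * Complex.I) * g 0 y := by
  obtain ⟨C₂, hC₂, m, h4⟩ := hM'.assoc_four_mul
  -- The sixth power is what `compare_moderate` uses: four factors from the squared square of
  -- `assoc`, two from the squared polynomial weight.
  obtain ⟨C, H, hC, hH, h6⟩ := hM.assoc_pow 6
  obtain ⟨K, hK, hslow⟩ := hM'.slowlyVarying
  set a₀ : ℝ → ℝ := fun t => M.assoc (H * 4 * (t * (1 + t))) with ha₀
  have hσ₀ : SlowlyVarying (fun t => Real.log (a₀ t)) K :=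
    hslow _ (moderate_mul_one_add (by positivity))
  have hd₀ : ∀ h, 0 < h → M.Decays h (expSymbol a₀) := fun h hh =>
    M.decays_expSymbol hK (fun t => M.assoc_pos _) hσ₀ hh (M.dominates_moderate h6 hh)
  have hE₀ := differentiable_expSymbol hσ₀
  have hj₀ : IsJet (kernelJet a₀) := (hd₀ 1 one_pos).isJet hE₀.continuous
  have hb₀ : ∀ h, 0 < h → M.JetBound h (kernelJet a₀) := fun h hh => (hd₀ h hh).jetBound hE₀
  have hz : ∀ a : ℝ → ℝ, kernelJet a 0 = invF (expSymbol a) := fun a => by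
    simp [kernelJet]
  -- The window symbol is built on 4Ht(1 + t), which is strong enough for all θ(t) ≤ t(1 + t) at
  -- once; so g and the exponent A do not depend on θ.
  refine ⟨kernelJet a₀, 2 * m, hj₀, hb₀, ?_, fun θ hθ hle hdom => ?_⟩
  · rw [hz]
    have hc := hj₀.continuous 0
    rw [hz] at hc
    refine integral_mul_neg_ne_zero hσ₀ ((hd₀ 1 one_pos).integrable hE₀.continuous) hc ?_
    obtain ⟨B, hB⟩ := hb₀ 1 one_pos 2 (by norm_num)
    have hB' : ∀ y, ‖invF (expSymbol a₀) y‖ ≤ B * Real.exp (-2 * |y|) := fun y => by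
      simpa [M.zero, hz] using hB 0 y
    have hB0 : 0 ≤ B := by simpa using (norm_nonneg _).trans (hB' 0)
    refine (integrable_div_one_add_sq (B ^ 2)).mono' (hc.norm.pow 2).aestronglyMeasurable
      (ae_of_all _ fun y => ?_)
    rw [norm_pow, norm_norm, div_eq_mul_inv]
    have e1 : Real.exp (-2 * |y|) ≤ 1 := Real.exp_le_one_iff.2 (by nlinarith [abs_nonneg y])
    calc _ ≤ (B * Real.exp (-2 * |y|)) ^ 2 := pow_le_pow_left₀ (norm_nonneg _) (hB' y) 2
      _ = B ^ 2 * (Real.exp (-2 * |y|) * Real.exp (-2 * |y|)) := by ring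
      _ ≤ B ^ 2 * (Real.exp (-2 * |y|) * 1) := by gcongr
      _ ≤ B ^ 2 * (1 + y ^ 2)⁻¹ := by
        rw [mul_one]
        exact mul_le_mul_of_nonneg_left (exp_neg_mul_abs_le le_rfl y) (by positivity)
  set a : ℝ → ℝ := fun t => M.assoc (θ t) with ha
  have hσ : SlowlyVarying (fun t => Real.log (a t)) K := hslow _ hθ
  have hd : ∀ h, 0 < h → M.Dominates h a → M.Decays h (expSymbol a) := fun h hh hdm =>
    M.decays_expSymbol hK (fun t => M.assoc_pos _) hσ hh hdm
  have hE := differentiable_expSymbol hσ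
  obtain ⟨h₁, hh₁, hdom₁⟩ := hdom
  have hj : IsJet (kernelJet a) := (hd h₁ hh₁ hdom₁).isJet hE.continuous
  have hb : ∀ h, 0 < h → M.Dominates h a → M.JetBound h (kernelJet a) := fun h hh hdm =>
    (hd h hh hdm).jetBound hE
  have hs := shiftedSymbol_le (a := a) (a₀ := a₀) (fun t => M.assoc_pos _) (fun t => M.assoc_pos _)
    hσ hσ₀ hK (A := 2 * m) (B := 16 * C₂ ^ 4 * C) (by positivity)
    (M.compare_moderate hC₂ h4 h6 hθ hle)
  have hF := differentiable_shiftedSymbol hσ hσ₀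
  refine ⟨kernelJet a, shiftedKernel a a₀, hj, hb, stronglyMeasurable_shiftedKernel hσ hσ₀,
    fun k hk => ?_, fun τ y => ?_⟩
  · obtain ⟨B, -, hB⟩ := hs k
    refine ⟨Real.pi * B, fun τ y => (norm_invF_le (hF τ) hk (hB τ) y).trans (le_of_eq ?_)⟩
    ring
  · rw [hz, hz]
    obtain ⟨B, -, hB⟩ := hs 0
    have hi := (hb h₁ hh₁ hdom₁).integrable (hj.continuous 0)
    rw [hz] at hi
    have hFi := (integrable_div_one_add_sq _).mono' (Continuous.aestronglyMeasurable
      ((hF τ).continuous.comp Complex.continuous_ofReal))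
      (ae_of_all _ fun x : ℝ => hB τ x (by simp))
    have := integral_mul_invF_sub hE.continuous (F := fun z => (expSymbol a z)⁻¹ *
      expSymbol a₀ (z - τ)) ((hd h₁ hh₁ hdom₁).integrable hE.continuous) hFi hi y
    simp only [shiftedKernel]
    -- The symbol of ψ cancels its inverse in the kernel. Only the translated window symbol remains,
    -- and translation in frequency is modulation of g.
    rw [this, ← invF_comp_sub]
    congr 1
    ext z
    exact mul_inv_cancel_left₀ (Complex.exp_ne_zero _) _

end WeightSequence

end Ultra

namespace Ultra

variable {d : ℕ}

/-! ### Partial derivatives and multi-jets -/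

/-- The linear map with given partial derivatives. -/
def gradCLM (c : Fin d → ℂ) : Rd d →L[ℝ] ℂ :=
  ∑ i, (EuclideanSpace.proj i : Rd d →L[ℝ] ℝ).smulRight (c i)

theorem gradCLM_apply (c : Fin d → ℂ) (v : Rd d) : gradCLM c v = ∑ i, v i • c i := by
  simp [gradCLM]

theorem gradCLM_single (c : Fin d → ℂ) (i : Fin d) :
    gradCLM c (EuclideanSpace.single i 1) = c i := by
  rw [gradCLM_apply, Finset.sum_eq_single i]
  · simp
  · intro j _ hj
    simp [hj]
  · simp

theorem eq_gradCLM (L : Rd d →L[ℝ] ℂ) : L = gradCLM fun i => L (EuclideanSpace.single i 1) := by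
  ext v
  rw [gradCLM_apply]
  conv_lhs => rw [← (EuclideanSpace.basisFun (Fin d) ℝ).sum_repr v]
  simp [map_sum]

theorem hasFDerivAt_smooth (f : Smooth d) (x : Rd d) :
    HasFDerivAt (f : Rd d → ℂ) (gradCLM fun i => (pderiv i f : Rd d → ℂ) x) x := by
  have h := (differentiableAt_coe f x).hasFDerivAt
  rw [eq_gradCLM (fderiv ℝ (f : Rd d → ℂ) x)] at h
  exact h

theorem pderiv_apply (i : Fin d) (f : Smooth d) (x : Rd d) :
    (pderiv i f : Rd d → ℂ) x = fderiv ℝ (f : Rd d → ℂ) x (EuclideanSpace.single i 1) := rfl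

theorem pderiv_eq_of_hasFDerivAt {f : Smooth d} {c : Rd d → Fin d → ℂ}
    (h : ∀ x, HasFDerivAt (f : Rd d → ℂ) (gradCLM (c x)) x) (i : Fin d) (x : Rd d) :
    (pderiv i f : Rd d → ℂ) x = c x i := by
  rw [pderiv_apply, (h x).fderiv, gradCLM_single]

theorem pderiv_comm (i j : Fin d) (f : Smooth d) : pderiv i (pderiv j f) = pderiv j (pderiv i f) := by
  have key : ∀ (i j : Fin d) (x : Rd d), (pderiv i (pderiv j f) : Rd d → ℂ) x =
      fderiv ℝ (fderiv ℝ (f : Rd d → ℂ)) x (EuclideanSpace.single i 1)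
        (EuclideanSpace.single j 1) := by
    intro i j x
    have h1 : DifferentiableAt ℝ (fderiv ℝ (f : Rd d → ℂ)) x :=
      (((contDiff_coe f).fderiv_right (m := ∞) (by simp)).differentiable (by simp)) x
    rw [pderiv_apply]
    have h2 : ((pderiv j f : Smooth d) : Rd d → ℂ) =
        fun y => fderiv ℝ (f : Rd d → ℂ) y (EuclideanSpace.single j 1) := rfl
    rw [h2, fderiv_clm_apply h1 (differentiableAt_const _)]
    simp
  ext x
  rw [key, key]
  have h : IsSymmSndFDerivAt ℝ (f : Rd d → ℂ) x :=
    (contDiff_coe f).contDiffAt.isSymmSndFDerivAt (by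
      simp only [minSmoothness_of_isRCLikeNormedField]; exact WithTop.coe_le_coe.2 (le_top : (2 : ℕ∞) ≤ ⊤))
  exact h _ _

theorem commute_pderiv (i j : Fin d) : Commute (pderiv (d := d) i) (pderiv j) :=
  LinearMap.ext fun f => pderiv_comm i j f

/-- The multi-index `α + e_i`. -/
def bump (α : Fin d → ℕ) (i : Fin d) : Fin d → ℕ := α + Pi.single i 1

theorem len_bump (α : Fin d → ℕ) (i : Fin d) : len (bump α i) = len α + 1 := by
  simp [len, bump, Finset.sum_add_distrib]

theorem mul_prod_map_pow {R ι : Type*} [Monoid R] [DecidableEq ι] {f : ι → R}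
    (hf : ∀ i j, Commute (f i) (f j)) (α : ι → ℕ) (i : ι) (l : List ι) (hl : l.Nodup)
    (hi : i ∈ l) : f i * (l.map fun j => f j ^ α j).prod =
      (l.map fun j => f j ^ ((α + Pi.single i 1 : ι → ℕ) j)).prod := by
  induction l with
  | nil => simp at hi
  | cons a l ih =>
    simp only [List.map_cons, List.prod_cons]
    rw [List.nodup_cons] at hl
    by_cases hai : a = i
    · subst hai
      rw [← mul_assoc, ← pow_succ']
      congr 1
      · simp
      · congr 1
        refine List.map_congr_left fun j hj => ?_
        have : j ≠ a := fun h => hl.1 (h ▸ hj)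
        simp [this]
    · have hil : i ∈ l := by
        rcases List.mem_cons.1 hi with h | h
        · exact absurd h.symm hai
        · exact h
      rw [← mul_assoc, ((hf i a).pow_right (α a)).eq, mul_assoc, ih hl.2 hil]
      simp [hai]

theorem pderiv_mderiv (i : Fin d) (α : Fin d → ℕ) (f : Smooth d) :
    pderiv i (mderiv α f) = mderiv (bump α i) f := by
  have := mul_prod_map_pow (f := pderiv (d := d)) commute_pderiv α i (List.finRange d)
    (List.nodup_finRange d) (List.mem_finRange i)
  exact congrArg (fun L : Module.End ℂ (Smooth d) => L f) this

theorem mderiv_zero (f : Smooth d) : mderiv 0 f = f := by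
  simp [mderiv]

theorem exists_bump {α : Fin d → ℕ} {n : ℕ} (h : len α = n + 1) :
    ∃ (β : Fin d → ℕ) (i : Fin d), α = bump β i ∧ len β = n := by
  obtain ⟨i, hi⟩ : ∃ i, α i ≠ 0 := by
    by_contra! hcon
    simp [len, hcon] at h
  have h1 : α = bump (α - Pi.single i 1) i := by
    ext j
    by_cases hj : j = i
    · subst hj
      simp [bump]
      omega
    · simp [bump, hj]
  refine ⟨α - Pi.single i 1, i, h1, ?_⟩
  have := len_bump (α - Pi.single i 1) i
  rw [← h1] at this
  omega

/-- A family of functions indexed by multi-indices with `∂_i F_α = F_{α + e_i}`. -/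
def IsMultiJet (F : (Fin d → ℕ) → Rd d → ℂ) : Prop :=
  ∀ α x, HasFDerivAt (F α) (gradCLM fun i => F (bump α i) x) x

theorem isMultiJet_mderiv (f : Smooth d) : IsMultiJet fun α => (mderiv α f : Rd d → ℂ) := by
  intro α x
  have := hasFDerivAt_smooth (mderiv α f) x
  simp only [pderiv_mderiv] at this
  exact this

namespace IsMultiJet

variable {F : (Fin d → ℕ) → Rd d → ℂ}

theorem continuous (hF : IsMultiJet F) (α : Fin d → ℕ) : Continuous (F α) :=
  continuous_iff_continuousAt.2 fun x => (hF α x).continuousAt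

theorem contDiff (hF : IsMultiJet F) (α : Fin d → ℕ) : ContDiff ℝ ∞ (F α) := by
  refine contDiff_infty.2 fun m => ?_
  induction m generalizing α with
  | zero => exact contDiff_zero.2 (hF.continuous α)
  | succ m ih =>
    rw [Nat.cast_succ, contDiff_succ_iff_hasFDerivAt]
    refine ⟨fun x => gradCLM fun i => F (bump α i) x, ?_, hF α⟩
    simp only [gradCLM]
    refine ContDiff.sum fun i _ => ?_
    exact ((ContinuousLinearMap.smulRightL ℝ (Rd d) ℂ
      (EuclideanSpace.proj i : Rd d →L[ℝ] ℝ)).contDiff).comp (ih (bump α i))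

/-- This makes a smooth function with all its derivatives out of a family of integrals; the
induction peels one partial derivative off α. -/
theorem exists_smooth (hF : IsMultiJet F) :
    ∃ f : Smooth d, ∀ α, (mderiv α f : Rd d → ℂ) = F α := by
  let f : (Fin d → ℕ) → Smooth d := fun α => ⟨F α, hF.contDiff α⟩
  refine ⟨f 0, ?_⟩
  suffices h : ∀ n α, len α = n → mderiv α (f 0) = f α by
    intro α
    rw [h _ α rfl]
  intro n
  induction n with
  | zero =>
    intro α hα
    have : α = 0 := by
      ext i
      exact (Finset.sum_eq_zero_iff.1 hα) i (Finset.mem_univ i)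
    rw [this, mderiv_zero]
  | succ n ih =>
    intro α hα
    obtain ⟨β, i, rfl, hβ⟩ := exists_bump hα
    rw [← pderiv_mderiv, ih β hβ]
    ext x
    exact pderiv_eq_of_hasFDerivAt (f := f β) (c := fun x i => F (bump β i) x) (hF β) i x

theorem comp_sub (hF : IsMultiJet F) (y : Rd d) : IsMultiJet fun α x => F α (x - y) := by
  intro α x
  have := (hF α (x - y)).comp x ((hasFDerivAt_id x).sub_const y)
  rw [ContinuousLinearMap.comp_id] at this
  exact this

theorem const_mul (hF : IsMultiJet F) (c : ℂ) : IsMultiJet fun α x => c * F α x := by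
  intro α x
  refine ((hF α x).const_mul c).congr_fderiv ?_
  ext v
  simp only [gradCLM_apply, smul_apply, smul_eq_mul, Finset.mul_sum]
  refine Finset.sum_congr rfl fun i _ => ?_
  rw [mul_smul_comm]

/-- Differentiation under the integral sign for families of multi-jets. -/
theorem integral {X : Type*} [MeasurableSpace X] {μ : Measure X}
    {G : X → (Fin d → ℕ) → Rd d → ℂ} (hG : ∀ a, IsMultiJet (G a))
    (hm : ∀ α x, AEStronglyMeasurable (fun a => G a α x) μ)
    (hb : ∀ α R, ∃ b : X → ℝ, Integrable b μ ∧ ∀ a x, ‖x‖ ≤ R → ‖G a α x‖ ≤ b a) :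
    IsMultiJet fun α x => ∫ a, G a α x ∂μ := by
  intro α x
  have hint : ∀ α y, Integrable (fun a => G a α y) μ := by
    intro α y
    obtain ⟨b, hb, h⟩ := hb α ‖y‖
    exact hb.mono' (hm α y) (ae_of_all _ fun a => h a y le_rfl)
  have hsum : ∀ y : Rd d, (∫ a, gradCLM (fun i => G a (bump α i) y) ∂μ) =
      gradCLM fun i => ∫ a, G a (bump α i) y ∂μ := by
    intro y
    simp only [gradCLM]
    have e : ∀ i : Fin d, ∀ a, (EuclideanSpace.proj i : Rd d →L[ℝ] ℝ).smulRight
        (G a (bump α i) y) = ContinuousLinearMap.smulRightL ℝ (Rd d) ℂ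
          (EuclideanSpace.proj i : Rd d →L[ℝ] ℝ) (G a (bump α i) y) := fun i a => rfl
    simp only [e]
    rw [integral_finsetSum _ fun i _ => ContinuousLinearMap.integrable_comp _ (hint _ _)]
    refine Finset.sum_congr rfl fun i _ => ?_
    rw [ContinuousLinearMap.integral_comp_comm _ (hint _ _)]
    rfl
  choose b hbi hbb using fun i : Fin d => hb (bump α i) (‖x‖ + 1)
  have h := hasFDerivAt_integral_of_dominated_of_fderiv_le (μ := μ) (𝕜 := ℝ)
    (F := fun y a => G a α y) (F' := fun y a => gradCLM fun i => G a (bump α i) y) (x₀ := x)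
    (s := Metric.ball x 1) (bound := fun a => ∑ i : Fin d,
      ‖(EuclideanSpace.proj i : Rd d →L[ℝ] ℝ)‖ * b i a) (Metric.ball_mem_nhds x one_pos)
    (Eventually.of_forall fun y => hm α y) (hint α x) ?_ (ae_of_all _ fun a y hy => ?_)
    (integrable_finsetSum _ fun i _ => (hbi i).const_mul _) (ae_of_all _ fun a y _ => hG a α y)
  · exact h.congr_fderiv (hsum x)
  · simp only [gradCLM]
    refine Finset.aestronglyMeasurable_fun_sum _ fun i _ => ?_
    exact (ContinuousLinearMap.smulRightL ℝ (Rd d) ℂ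
      (EuclideanSpace.proj i : Rd d →L[ℝ] ℝ)).continuous.comp_aestronglyMeasurable (hm _ _)
  · refine (norm_sum_le _ _).trans (Finset.sum_le_sum fun i _ => ?_)
    rw [ContinuousLinearMap.norm_smulRight_apply]
    refine mul_le_mul_of_nonneg_left (hbb i a y ?_) (norm_nonneg _)
    have : ‖y - x‖ < 1 := by simpa [dist_eq_norm] using hy
    have := norm_le_norm_add_norm_sub' y x
    linarith

end IsMultiJet

/-! ### Tensor products -/

/-- The tensor product of `d` copies of a jet. -/
def tens (a : ℕ → ℝ → ℂ) (α : Fin d → ℕ) (x : Rd d) : ℂ := ∏ j, a (α j) (x j)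

theorem isMultiJet_tens {a : ℕ → ℝ → ℂ} (ha : IsJet a) : IsMultiJet (tens (d := d) a) := by
  intro α x
  have h1 : ∀ j : Fin d, HasFDerivAt (fun y : Rd d => a (α j) (y j))
      ((EuclideanSpace.proj j : Rd d →L[ℝ] ℝ).smulRight (a (α j + 1) (x j))) x := by
    intro j
    have h2 : HasFDerivAt (fun y : Rd d => y j) (EuclideanSpace.proj j : Rd d →L[ℝ] ℝ) x :=
      (EuclideanSpace.proj j : Rd d →L[ℝ] ℝ).hasFDerivAt
    refine ((ha (α j) (x j)).hasFDerivAt.comp x h2).congr_fderiv ?_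
    ext v
    simp
  have h3 := HasFDerivAt.finsetProd (u := Finset.univ) fun j _ => h1 j
  refine h3.congr_fderiv ?_
  simp only [gradCLM]
  refine Finset.sum_congr rfl fun i _ => ?_
  ext v
  simp only [smul_apply, ContinuousLinearMap.smulRight_apply, tens, smul_eq_mul]
  rw [mul_smul_comm]
  congr 1
  rw [← Finset.prod_erase_mul _ _ (Finset.mem_univ i)]
  congr 1
  · refine Finset.prod_congr rfl fun j hj => ?_
    simp [bump, Finset.ne_of_mem_erase hj]
  · simp [bump]

theorem integral_prod_coord (f : Fin d → ℝ → ℂ) :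
    ∫ x : Rd d, ∏ j, f j (x j) = ∏ j, ∫ s, f j s := by
  rw [← integral_fintype_prod_volume_eq_prod]
  exact (EuclideanSpace.volume_preserving_symm_measurableEquiv_toLp (Fin d)).integral_comp'
    (fun y => ∏ j, f j (y j))

theorem integrable_prod_coord {f : Fin d → ℝ → ℝ} (hf : ∀ j, Integrable (f j)) :
    Integrable fun x : Rd d => ∏ j, f j (x j) := by
  have := Integrable.fintype_prod hf
  exact (EuclideanSpace.volume_preserving_symm_measurableEquiv_toLp (Fin d)).integrable_comp_of_integrable this

end Ultra

namespace Ultra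

variable {d : ℕ}

/-! ### Weighted bounds -/

/-- An integrable majorant on `ℝ^d`. -/
def maj (x : Rd d) : ℝ := ∏ j, (1 + x j ^ 2)⁻¹

theorem maj_pos (x : Rd d) : 0 < maj x := Finset.prod_pos fun _ _ => by positivity

theorem integrable_maj : Integrable (maj (d := d)) :=
  integrable_prod_coord fun _ => integrable_inv_one_add_sq

theorem norm_le_sum_abs (x : Rd d) : ‖x‖ ≤ ∑ j, |x j| := by
  have h := (EuclideanSpace.basisFun (Fin d) ℝ).sum_repr x
  conv_lhs => rw [← h]
  refine (norm_sum_le _ _).trans (Finset.sum_le_sum fun j _ => ?_)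
  rw [norm_smul]
  simp

theorem abs_coord_le (x : Rd d) (j : Fin d) : |x j| ≤ ‖x‖ := by
  simpa using PiLp.norm_apply_le x j

/-- The part κ of the rate pays for exp(-κ‖x‖), as ‖x‖ ≤ ∑|x_j|; the remaining rate 2 leaves the
integrable majorant. -/
theorem prod_exp_le {κ : ℝ} (hκ : 0 ≤ κ) (x : Rd d) :
    ∏ j, Real.exp (-(κ + 2) * |x j|) ≤ Real.exp (-κ * ‖x‖) * maj x := by
  have h1 : ∏ j, Real.exp (-(κ + 2) * |x j|) =
      Real.exp (-κ * ∑ j, |x j|) * ∏ j, Real.exp (-2 * |x j|) := by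
    rw [Finset.mul_sum, Real.exp_sum, ← Finset.prod_mul_distrib]
    refine Finset.prod_congr rfl fun j _ => ?_
    rw [← Real.exp_add]
    ring_nf
  rw [h1]
  refine mul_le_mul (Real.exp_le_exp.2 ?_) ?_ (Finset.prod_nonneg fun _ _ => (Real.exp_pos _).le)
    (Real.exp_pos _).le
  · have := norm_le_sum_abs x
    nlinarith
  · exact Finset.prod_le_prod (fun _ _ => (Real.exp_pos _).le)
      fun j _ => exp_neg_mul_abs_le le_rfl (x j)

/-- The weight `w₁` dominates the translates of `w₀` up to an exponential. -/
structure Dom (w₀ w₁ : Weight d) (κ c : ℝ) : Prop where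
  nonneg : 0 ≤ κ
  pos : 0 < c
  le : ∀ x y, w₀ (x + y) ≤ c * w₁ x * Real.exp (κ * ‖y‖)

theorem Dom.inv_le {w₀ w₁ : Weight d} {κ c : ℝ} (h : Dom w₀ w₁ κ c) (x z : Rd d) :
    (w₁ (x - z))⁻¹ ≤ c * Real.exp (κ * ‖z‖) * (w₀ x)⁻¹ := by
  have h1 := h.le (x - z) z
  rw [sub_add_cancel] at h1
  have p0 := w₀.pos x
  have p1 := w₁.pos (x - z)
  rw [← div_eq_mul_inv, le_div_iff₀ p0, inv_mul_le_iff₀ p1]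
  linarith

/-- The exponential lost in translating the weight cancels against the decay of the kernel, and `maj
z` is left for the integration. -/
theorem Dom.kernel_le {w₀ w₁ : Weight d} {κ c : ℝ} (h : Dom w₀ w₁ κ c) {A B a b : ℝ} {x z : Rd d}
    (hA : 0 ≤ A) (ha0 : 0 ≤ a) (ha : a ≤ A * ∏ j, Real.exp (-(κ + 2) * |z j|))
    (hB : 0 ≤ B) (hb : b ≤ B * (w₁ (x - z))⁻¹) :
    a * b ≤ A * B * c * (w₀ x)⁻¹ * maj z := by
  have p0 := inv_pos.2 (w₀.pos x)
  have p1 := inv_pos.2 (w₁.pos (x - z))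
  have hc := h.pos
  have hm := maj_pos z
  have e0 : 0 ≤ ∏ j, Real.exp (-(κ + 2) * |z j|) :=
    Finset.prod_nonneg fun _ _ => (Real.exp_pos _).le
  calc a * b ≤ a * (B * (w₁ (x - z))⁻¹) := by gcongr
    _ ≤ (A * (Real.exp (-κ * ‖z‖) * maj z)) * (B * (c * Real.exp (κ * ‖z‖) * (w₀ x)⁻¹)) := by
      gcongr
      · exact ha.trans (by gcongr; exact prod_exp_le h.nonneg z)
      · exact h.inv_le x z
    _ = A * B * c * (w₀ x)⁻¹ * maj z * (Real.exp (-κ * ‖z‖) * Real.exp (κ * ‖z‖)) := by ring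
    _ = _ := by rw [← Real.exp_add]; simp

/-- The norm of `φ` in `B^{M,h}_w` is at most `C`. -/
def Bnd (M : WeightSequence) (h : ℝ) (w : Weight d) (C : ℝ) (φ : Smooth d) : Prop :=
  ∀ α x, ‖(mderiv α φ : Rd d → ℂ) x‖ ≤ C * (M.M (len α) / h ^ len α) * (w x)⁻¹

theorem Bnd.nonneg {M : WeightSequence} {h : ℝ} {w : Weight d} {C : ℝ} {φ : Smooth d}
    (hb : Bnd M h w C φ) : 0 ≤ C := by
  have h1 := (norm_nonneg _).trans (hb 0 0)
  have h2 := inv_pos.2 (w.pos 0)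
  simp only [len, Pi.zero_apply, Finset.sum_const_zero, M.zero, pow_zero, div_one, mul_one] at h1
  exact nonneg_of_mul_nonneg_left h1 h2

/-- A quantitative form of `JetBound`. -/
def JBnd (M : WeightSequence) (h k C : ℝ) (g : ℕ → ℝ → ℂ) : Prop :=
  ∀ n y, ‖g n y‖ ≤ C * M.M n / h ^ n * Real.exp (-k * |y|)

theorem JBnd.nonneg {M : WeightSequence} {h k C : ℝ} {g : ℕ → ℝ → ℂ} (hg : JBnd M h k C g) :
    0 ≤ C := by
  simpa [M.zero] using (norm_nonneg _).trans (hg 0 0)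

theorem JBnd.tens_le {M : WeightSequence} {h k C : ℝ} {g : ℕ → ℝ → ℂ} (hg : JBnd M h k C g)
    (hh : 0 < h) (β : Fin d → ℕ) (z : Rd d) :
    ‖tens g β z‖ ≤ C ^ d * (M.M (len β) / h ^ len β) * ∏ j, Real.exp (-k * |z j|) := by
  have hC := hg.nonneg
  rw [tens, norm_prod]
  calc _ ≤ ∏ j, (C * M.M (β j) / h ^ β j * Real.exp (-k * |z j|)) :=
        Finset.prod_le_prod (fun _ _ => norm_nonneg _) fun j _ => hg _ _
    _ = C ^ d * ((∏ j, M.M (β j)) / h ^ len β) * ∏ j, Real.exp (-k * |z j|) := by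
        rw [Finset.prod_mul_distrib, Finset.prod_div_distrib, Finset.prod_mul_distrib, len,
          Finset.prod_pow_eq_pow_sum, Finset.prod_const, Finset.card_univ, Fintype.card_fin,
          mul_div_assoc]
    _ ≤ _ := by
        have e0 : 0 ≤ ∏ j, Real.exp (-k * |z j|) :=
          Finset.prod_nonneg fun _ _ => (Real.exp_pos _).le
        have := M.prod_le_sum Finset.univ β
        gcongr
        exact this

/-! ### The short-time Fourier transform -/

/-- The character `z ↦ exp (2 π i ⟨z, t⟩)`. -/
def chr (t z : Rd d) : ℂ := Complex.exp (2 * Real.pi * (inner ℝ z t : ℝ) * Complex.I)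

theorem norm_chr (t z : Rd d) : ‖chr t z‖ = 1 := by
  rw [chr, Complex.norm_exp]
  simp

theorem chr_eq_prod (t z : Rd d) :
    chr t z = ∏ j, Complex.exp (2 * Real.pi * (t j) * (z j) * Complex.I) := by
  rw [← Complex.exp_sum, chr, ← Finset.sum_mul]
  congr 2
  rw [PiLp.inner_apply, Complex.ofReal_sum, Finset.mul_sum]
  refine Finset.sum_congr rfl fun j _ => ?_
  simp
  ring

theorem continuous_chr : Continuous fun p : Rd d × Rd d => chr p.1 p.2 := by
  unfold chr
  fun_prop

end Ultra

namespace Ultra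

variable {d : ℕ}

theorem hasLineDerivAt_chr (t z : Rd d) (i : Fin d) :
    HasLineDerivAt ℝ (chr t) (2 * Real.pi * Complex.I * t i * chr t z) z
      (EuclideanSpace.single i 1) := by
  have e1 : ∀ s : ℝ, (inner ℝ (z + s • EuclideanSpace.single i (1 : ℝ)) t : ℝ) =
      inner ℝ z t + s * t i := by
    intro s
    rw [inner_add_left, inner_smul_left]
    simp [EuclideanSpace.inner_single_left]
  have e2 : HasDerivAt (fun s : ℝ => 2 * Real.pi * ((inner ℝ z t + s * t i : ℝ) : ℂ) * Complex.I)
      (2 * Real.pi * t i * Complex.I) 0 := by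
    have h0 : HasDerivAt (fun s : ℝ => (inner ℝ z t : ℝ) + s * t i) (t i) 0 := by
      simpa using ((hasDerivAt_id (0 : ℝ)).mul_const (t i)).const_add (inner ℝ z t : ℝ)
    exact (h0.ofReal_comp.const_mul (2 * Real.pi : ℂ)).mul_const Complex.I
  have e3 := e2.cexp
  simp only [HasLineDerivAt, chr, e1]
  refine e3.congr_deriv ?_
  simp only [zero_mul, add_zero]
  ring

/-- The short-time Fourier transform with derivatives on both factors. -/
def stft (g : ℕ → ℝ → ℂ) (φ : Smooth d) (β α : Fin d → ℕ) (t x : Rd d) : ℂ :=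
  ∫ z : Rd d, tens g β z * chr t z * (mderiv α φ : Rd d → ℂ) (x - z)

section

variable {M : WeightSequence} {w₀ w₁ : Weight d} {κ c h Cφ Cg : ℝ} {g : ℕ → ℝ → ℂ} {φ : Smooth d}

theorem stft_integrand_le (hw : Dom w₀ w₁ κ c) (hh : 0 < h) (hφ : Bnd M h w₁ Cφ φ)
    (hg : JBnd M h (κ + 2) Cg g) (β α : Fin d → ℕ) (t x z : Rd d) :
    ‖tens g β z * chr t z * (mderiv α φ : Rd d → ℂ) (x - z)‖ ≤
      Cg ^ d * (M.M (len β) / h ^ len β) * (Cφ * (M.M (len α) / h ^ len α)) * c * (w₀ x)⁻¹ *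
        maj z := by
  have hMα := M.pos (len α)
  have hMβ := M.pos (len β)
  have hCg := hg.nonneg
  have hCφ := hφ.nonneg
  rw [norm_mul, norm_mul, norm_chr, mul_one]
  exact hw.kernel_le (by positivity) (norm_nonneg _) (hg.tens_le hh β z) (by positivity) (hφ α _)

theorem continuous_stft_integrand (hj : IsJet g) (φ : Smooth d) (β α : Fin d → ℕ) :
    Continuous fun p : (Rd d × Rd d) × Rd d =>
      tens g β p.2 * chr p.1.1 p.2 * (mderiv α φ : Rd d → ℂ) (p.1.2 - p.2) := by
  have h1 := ((isMultiJet_tens (d := d) hj).continuous β).comp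
    (continuous_snd : Continuous fun p : (Rd d × Rd d) × Rd d => p.2)
  have h2 := continuous_chr.comp
    (by fun_prop : Continuous fun p : (Rd d × Rd d) × Rd d => (p.1.1, p.2))
  have h3 := (contDiff_coe (mderiv α φ)).continuous.comp
    (by fun_prop : Continuous fun p : (Rd d × Rd d) × Rd d => p.1.2 - p.2)
  exact (h1.mul h2).mul h3

theorem aestronglyMeasurable_stft_integrand (hj : IsJet g) (φ : Smooth d) (β α : Fin d → ℕ)
    (t x : Rd d) : AEStronglyMeasurable
      fun z => tens g β z * chr t z * (mderiv α φ : Rd d → ℂ) (x - z) :=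
  ((continuous_stft_integrand hj φ β α).comp
    (by fun_prop : Continuous fun z : Rd d => ((t, x), z))).aestronglyMeasurable

theorem integrable_stft_integrand (hj : IsJet g) (hw : Dom w₀ w₁ κ c) (hh : 0 < h)
    (hφ : Bnd M h w₁ Cφ φ) (hg : JBnd M h (κ + 2) Cg g) (β α : Fin d → ℕ) (t x : Rd d) :
    Integrable fun z => tens g β z * chr t z * (mderiv α φ : Rd d → ℂ) (x - z) :=
  (integrable_maj.const_mul _).mono' (aestronglyMeasurable_stft_integrand hj φ β α t x)
    (ae_of_all _ fun z => stft_integrand_le hw hh hφ hg β α t x z)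

theorem stronglyMeasurable_stft (hj : IsJet g) (φ : Smooth d) (β α : Fin d → ℕ) :
    StronglyMeasurable fun p : Rd d × Rd d => stft g φ β α p.1 p.2 :=
  StronglyMeasurable.integral_prod_right (f := fun (p : Rd d × Rd d) z =>
    tens g β z * chr p.1 z * (mderiv α φ : Rd d → ℂ) (p.2 - z))
    (continuous_stft_integrand hj φ β α).stronglyMeasurable

theorem norm_stft_le (hw : Dom w₀ w₁ κ c) (hh : 0 < h)
    (hφ : Bnd M h w₁ Cφ φ) (hg : JBnd M h (κ + 2) Cg g) (β α : Fin d → ℕ) (t x : Rd d) :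
    ‖stft g φ β α t x‖ ≤ Cg ^ d * (M.M (len β) / h ^ len β) * (Cφ * (M.M (len α) / h ^ len α)) *
      c * (w₀ x)⁻¹ * ∫ z : Rd d, maj z := by
  rw [← integral_const_mul]
  exact norm_integral_le_of_norm_le (integrable_maj.const_mul _)
    (ae_of_all _ fun z => stft_integrand_le hw hh hφ hg β α t x z)

/-- Integration by parts in z: the factor 2πi t_i is the derivative of the character, and the minus
sign inside φ(x - z) produces a difference. -/
theorem two_pi_mul_stft (hj : IsJet g) (hw : Dom w₀ w₁ κ c) (hh : 0 < h)
    (hφ : Bnd M h w₁ Cφ φ) (hg : JBnd M h (κ + 2) Cg g) (β α : Fin d → ℕ) (t x : Rd d)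
    (i : Fin d) : 2 * Real.pi * Complex.I * t i * stft g φ β α t x =
      stft g φ β (bump α i) t x - stft g φ (bump β i) α t x := by
  have hi := integrable_stft_integrand (φ := φ) hj hw hh hφ hg
  have hf : ∀ z : Rd d, HasLineDerivAt ℝ (fun z => tens g β z * chr t z)
      (tens g (bump β i) z * chr t z + 2 * Real.pi * Complex.I * t i * (tens g β z * chr t z)) z
      (EuclideanSpace.single i 1) := by
    intro z
    have h1 := ((isMultiJet_tens (d := d) hj) β z).hasLineDerivAt (EuclideanSpace.single i 1)
    rw [gradCLM_single] at h1
    have h2 := hasLineDerivAt_chr t z i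
    simp only [HasLineDerivAt] at h1 h2 ⊢
    refine (h1.mul h2).congr_deriv ?_
    simp only [zero_smul, add_zero]
    ring
  have hg' : ∀ z : Rd d, HasLineDerivAt ℝ (fun z => (mderiv α φ : Rd d → ℂ) (x - z))
      (-(mderiv (bump α i) φ : Rd d → ℂ) (x - z)) z (EuclideanSpace.single i 1) := by
    intro z
    have h1 := (isMultiJet_mderiv φ α (x - z)).comp z ((hasFDerivAt_id z).const_sub x)
    have h2 := h1.hasLineDerivAt (EuclideanSpace.single i 1)
    refine HasDerivAt.congr_deriv h2 ?_
    simp [gradCLM_single]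
  have key := integral_bilinear_hasLineDerivAt_right_eq_neg_left_of_integrable (μ := volume)
    (B := ContinuousLinearMap.mul ℝ ℂ)
    (f := fun z => tens g β z * chr t z) (g := fun z => (mderiv α φ : Rd d → ℂ) (x - z))
    (f' := fun z => tens g (bump β i) z * chr t z +
      2 * Real.pi * Complex.I * t i * (tens g β z * chr t z))
    (g' := fun z => -(mderiv (bump α i) φ : Rd d → ℂ) (x - z))
    ?_ ?_ ?_ (fun z _ => hf z) (fun z _ => hg' z)
  · simp only [ContinuousLinearMap.mul_apply', mul_neg, add_mul] at key
    rw [integral_neg, integral_add (hi _ _ t x)] at key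
    · simp only [mul_assoc (2 * Real.pi * Complex.I * (t i : ℂ))] at key
      rw [integral_const_mul] at key
      simp only [stft]
      linear_combination key
    · simp only [mul_assoc (2 * Real.pi * Complex.I * (t i : ℂ))]
      exact (hi _ _ t x).const_mul _
  · simp only [ContinuousLinearMap.mul_apply', add_mul]
    refine (hi _ _ t x).add ?_
    simp only [mul_assoc (2 * Real.pi * Complex.I * (t i : ℂ))]
    exact (hi _ _ t x).const_mul _
  · simp only [ContinuousLinearMap.mul_apply', mul_neg]
    exact (hi _ _ t x).neg
  · exact hi _ _ t x

/-- Each factor t_i places one derivative on φ or on g. The two resulting terms are absorbed by 2π ≥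
2, so no combinatorial constant accumulates. -/
theorem pow_mul_stft_le (hj : IsJet g) (hw : Dom w₀ w₁ κ c) (hh : 0 < h)
    (hφ : Bnd M h w₁ Cφ φ) (hg : JBnd M h (κ + 2) Cg g) (t x : Rd d) (i : Fin d) (p : ℕ)
    (β α : Fin d → ℕ) : |t i| ^ p * ‖stft g φ β α t x‖ ≤ Cg ^ d * Cφ * c * (w₀ x)⁻¹ *
      (∫ z : Rd d, maj z) * (M.M (len β + len α + p) / h ^ (len β + len α + p)) := by
  induction p generalizing β α with
  | zero =>
    refine (by simp : _ ≤ ‖stft g φ β α t x‖).trans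
      ((norm_stft_le hw hh hφ hg β α t x).trans ?_)
    have hI : 0 ≤ ∫ z : Rd d, maj z := integral_nonneg fun z => (maj_pos z).le
    have h1 : M.M (len β) / h ^ len β * (M.M (len α) / h ^ len α) ≤
        M.M (len β + len α) / h ^ (len β + len α) := by
      rw [div_mul_div_comm, ← pow_add]
      exact div_le_div_of_nonneg_right (M.mul_le_add _ _) (by positivity)
    have hCg := hg.nonneg
    have hCφ := hφ.nonneg
    have hc := hw.pos
    have p0 := inv_pos.2 (w₀.pos x)
    calc _ = Cg ^ d * Cφ * c * (w₀ x)⁻¹ * (∫ z : Rd d, maj z) *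
          (M.M (len β) / h ^ len β * (M.M (len α) / h ^ len α)) := by ring
      _ ≤ _ := by rw [add_zero]; gcongr
  | succ p ih =>
    have e0 := congrArg norm (two_pi_mul_stft hj hw hh hφ hg β α t x i)
    rw [norm_mul, norm_mul, norm_mul, norm_mul, Complex.norm_I, Complex.norm_real,
      Complex.norm_ofNat, Real.norm_of_nonneg Real.pi_pos.le, mul_one, Complex.norm_real,
      Real.norm_eq_abs] at e0
    have e1 : 2 * (|t i| * ‖stft g φ β α t x‖) ≤
        ‖stft g φ β (bump α i) t x‖ + ‖stft g φ (bump β i) α t x‖ := by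
      refine le_trans ?_ (e0.le.trans (norm_sub_le _ _))
      have : 0 ≤ |t i| * ‖stft g φ β α t x‖ := by positivity
      nlinarith [Real.pi_gt_three]
    have i1 := ih β (bump α i)
    have i2 := ih (bump β i) α
    rw [len_bump] at i1 i2
    rw [show len β + (len α + 1) + p = len β + len α + (p + 1) by ring] at i1
    rw [show len β + 1 + len α + p = len β + len α + (p + 1) by ring] at i2
    have e2 := mul_le_mul_of_nonneg_left e1 (pow_nonneg (abs_nonneg (t i)) p)
    rw [pow_succ]
    linarith

/-- Decay of the short-time Fourier transform in the frequency variable. -/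
theorem stft_mul_assoc_le {C₀ H : ℝ} (hC₀ : 1 ≤ C₀) (hH : 1 ≤ H)
    (hM : ∀ p q : ℕ, M.M (p + q) ≤ C₀ * H ^ (p + q) * M.M p * M.M q)
    (hj : IsJet g) (hw : Dom w₀ w₁ κ c) (hh : 0 < h)
    (hφ : Bnd M h w₁ Cφ φ) (hg : JBnd M h (κ + 2) Cg g) (α : Fin d → ℕ) (t x : Rd d) :
    ‖stft g φ 0 α t x‖ * M.assoc (h / H * ‖WithLp.ofLp t‖) ≤
      C₀ * c * (∫ z : Rd d, maj z) * (Cφ * Cg ^ d) *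
        (M.M (len α) / (h / H) ^ len α) * (w₀ x)⁻¹ := by
  have hI : 0 ≤ ∫ z : Rd d, maj z := integral_nonneg fun z => (maj_pos z).le
  have hCg := hg.nonneg
  have hCφ := hφ.nonneg
  have hc := hw.pos
  have p0 := inv_pos.2 (w₀.pos x)
  have hH0 : 0 < H := by linarith
  have hl0 : len (0 : Fin d → ℕ) = 0 := by simp [len]
  set Q := Cg ^ d * Cφ * c * (w₀ x)⁻¹ * (∫ z : Rd d, maj z) with hQ
  have hQ0 : 0 ≤ Q := by positivity
  have hMp := M.pos
  have key : ∀ p : ℕ, ‖WithLp.ofLp t‖ ^ p * ‖stft g φ 0 α t x‖ ≤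
      Q * (C₀ * H ^ (len α + p) * M.M (len α) * M.M p / h ^ (len α + p)) := by
    intro p
    have e1 : ‖WithLp.ofLp t‖ ^ p * ‖stft g φ 0 α t x‖ ≤
        Q * (M.M (len α + p) / h ^ (len α + p)) := by
      rcases Nat.eq_zero_or_pos p with rfl | hp
      · have := norm_stft_le hw hh hφ hg 0 α t x
        rw [hl0, M.zero] at this
        simp only [pow_zero, one_mul, add_zero, div_one, mul_one] at this ⊢
        refine this.trans (le_of_eq ?_)
        rw [hQ]; ring
      -- The norm of `WithLp.ofLp t` is the maximum norm, attained at a coordinate unless d = 0,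
      -- when it vanishes.
      · rcases Nat.eq_zero_or_pos d with rfl | hd
        · have : ‖WithLp.ofLp t‖ = 0 := by simp [Subsingleton.elim (WithLp.ofLp t) 0]
          rw [this, zero_pow hp.ne', zero_mul]
          have := M.pos (len α + p)
          positivity
        · obtain ⟨i, -, hi⟩ := Finset.exists_max_image Finset.univ (fun i => |t i|)
            ⟨⟨0, hd⟩, Finset.mem_univ _⟩
          have hN : ‖WithLp.ofLp t‖ ≤ |t i| :=
            (pi_norm_le_iff_of_nonneg (abs_nonneg _)).2 fun j => hi j (Finset.mem_univ j)
          have := pow_mul_stft_le hj hw hh hφ hg t x i p 0 α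
          rw [hl0, zero_add] at this
          refine le_trans ?_ this
          gcongr
    -- Here (M.2) separates |α| from p; its factor H^(|α| + p) is the reason for h/H in place of h
    -- on both sides.
    refine e1.trans (mul_le_mul_of_nonneg_left ?_ hQ0)
    exact div_le_div_of_nonneg_right (hM _ _) (by positivity)
  rw [WeightSequence.assoc, Real.mul_iSup_of_nonneg (norm_nonneg _)]
  refine ciSup_le fun p => ?_
  have k := key p
  have hMα := hMp (len α)
  have hMq := hMp p
  calc ‖stft g φ 0 α t x‖ * ((h / H * ‖WithLp.ofLp t‖) ^ p / M.M p)
      = (‖WithLp.ofLp t‖ ^ p * ‖stft g φ 0 α t x‖) * ((h / H) ^ p / M.M p) := by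
        rw [mul_pow]; ring
    _ ≤ Q * (C₀ * H ^ (len α + p) * M.M (len α) * M.M p / h ^ (len α + p)) *
        ((h / H) ^ p / M.M p) := by gcongr
    _ = _ := by
        rw [hQ, div_pow, div_pow, pow_add, pow_add]
        field_simp

end

end Ultra

namespace Ultra

variable {d : ℕ} {M : WeightSequence} {w₀ w₁ : Weight d} {κ c h Cφ Cg : ℝ} {g : ℕ → ℝ → ℂ}
  {φ : Smooth d}

theorem Weight.exists_inv_le (w : Weight d) (R : ℝ) :
    ∃ C, 0 ≤ C ∧ ∀ x, ‖x‖ ≤ R → (w x)⁻¹ ≤ C := by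
  have hc : Continuous fun x => (w x)⁻¹ := w.continuous.inv₀ fun x => (w.pos x).ne'
  obtain ⟨C, hC⟩ := (isCompact_closedBall (0 : Rd d) R).bddAbove_image hc.continuousOn
  exact ⟨max C 0, le_max_right _ _, fun x hx =>
    (hC ⟨x, by simpa using hx, rfl⟩).trans (le_max_left _ _)⟩

/-- The integrated form of `IsMultiJet.integral` with a weighted bound. -/
theorem IsMultiJet.integral_of_weight {X : Type*} [MeasurableSpace X] {μ : Measure X}
    {G : X → (Fin d → ℕ) → Rd d → ℂ} (hG : ∀ a, IsMultiJet (G a))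
    (hm : ∀ α x, AEStronglyMeasurable (fun a => G a α x) μ) {m : X → ℝ} (hmi : Integrable m μ)
    (hm0 : ∀ a, 0 ≤ m a) (w : Weight d) {B : (Fin d → ℕ) → ℝ}
    (hb : ∀ a α x, ‖G a α x‖ ≤ B α * (w x)⁻¹ * m a) :
    IsMultiJet fun α x => ∫ a, G a α x ∂μ := by
  refine IsMultiJet.integral hG hm fun α R => ?_
  obtain ⟨C, hC, h⟩ := w.exists_inv_le R
  refine ⟨fun a => |B α| * C * m a, hmi.const_mul _, fun a x hx => (hb a α x).trans ?_⟩
  have := inv_pos.2 (w.pos x)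
  exact mul_le_mul_of_nonneg_right (mul_le_mul (le_abs_self _) (h x hx) this.le (abs_nonneg _))
    (hm0 a)

theorem isMultiJet_stft (hj : IsJet g) (hw : Dom w₀ w₁ κ c) (hh : 0 < h)
    (hφ : Bnd M h w₁ Cφ φ) (hg : JBnd M h (κ + 2) Cg g) (t : Rd d) :
    IsMultiJet fun α x => stft g φ 0 α t x := by
  refine IsMultiJet.integral_of_weight (μ := volume)
    (G := fun z α x => tens g 0 z * chr t z * (mderiv α φ : Rd d → ℂ) (x - z))
    (fun z => ((isMultiJet_mderiv φ).comp_sub z).const_mul _)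
    (fun α x => aestronglyMeasurable_stft_integrand hj φ 0 α t x) integrable_maj
    (fun z => (maj_pos z).le) w₀
    (fun z α x => stft_integrand_le hw hh hφ hg 0 α t x z)

open FourierTransform in
/-- Fourier inversion for the short-time Fourier transform. -/
theorem integral_chr_mul_stft (hj : IsJet g) (hw : Dom w₀ w₁ κ c) (hh : 0 < h)
    (hφ : Bnd M h w₁ Cφ φ) (hg : JBnd M h (κ + 2) Cg g) (x v : Rd d)
    (hi : Integrable fun t => stft g φ 0 0 t (x - v)) :
    ∫ t, chr t v * stft g φ 0 0 t (x - v) = tens g 0 (-v) * (φ : Rd d → ℂ) x := by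
  set Φ : Rd d → ℂ := fun z => tens g 0 z * (φ : Rd d → ℂ) (x - v - z) with hΦ
  have e1 : 𝓕⁻ Φ = fun t => stft g φ 0 0 t (x - v) := by
    ext t
    rw [Real.fourierInv_eq', stft]
    congr 1
    ext z
    rw [mderiv_zero, smul_eq_mul, hΦ, chr]
    simp only
    push_cast
    ring
  have e2 : 𝓕 Φ = fun t => stft g φ 0 0 (-t) (x - v) := by
    ext t
    rw [← congrFun e1 (-t), Real.fourierInv_eq', Real.fourier_eq']
    congr 1
    ext z
    rw [inner_neg_right]
    congr 3
    push_cast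
    ring
  have hc : Continuous Φ :=
    ((isMultiJet_tens hj).continuous 0).mul ((contDiff_coe φ).continuous.comp (by fun_prop))
  have hΦi : Integrable Φ := by
    have := integrable_stft_integrand (φ := φ) hj hw hh hφ hg 0 0 0 (x - v)
    simpa [mderiv_zero, chr] using this
  have h3 := hc.fourier_fourierInv_eq hΦi (by rw [e2]; exact hi.comp_neg)
  -- Evaluation at -v makes the argument of φ equal to x - v + v = x for every v.
  have h4 := congrFun h3 (-v)
  rw [e1, Real.fourier_eq'] at h4
  simp only [hΦ, sub_neg_eq_add, sub_add_cancel] at h4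
  rw [← h4]
  congr 1
  ext t
  rw [smul_eq_mul, chr]
  congr 2
  rw [inner_neg_right, real_inner_comm]
  push_cast
  ring

/-! ### Fubini for triple convolutions -/

/-- The substitution v = u + y lets the integral over u be done first, which exposes ψ * k_t. After
the substitution the majorant is the integrand of a convolution of integrable functions, so the
interchange remains legitimate. -/
theorem assoc_fubini {ψ : Rd d → ℂ} {k S : Rd d → Rd d → ℂ} (hψ : StronglyMeasurable ψ)
    (hk : StronglyMeasurable (Function.uncurry k)) (hS : StronglyMeasurable (Function.uncurry S))
    {C : ℝ} (hb : ∀ u t y, ‖ψ u‖ * ‖k t y‖ * ‖S t (u + y)‖ ≤ C * (maj u * maj t * maj y)) :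
    ∫ u, ψ u * ∫ p : Rd d × Rd d, k p.1 p.2 * S p.1 (u + p.2) =
      ∫ t, ∫ v, (∫ u, ψ u * k t (v - u)) * S t v := by
  have hC : 0 ≤ C := by
    have h0 : 0 ≤ ‖ψ 0‖ * ‖k 0 0‖ * ‖S 0 (0 + 0)‖ := by positivity
    have h1 := h0.trans (hb 0 0 0)
    have h2 := mul_pos (mul_pos (maj_pos (0 : Rd d)) (maj_pos (0 : Rd d))) (maj_pos (0 : Rd d))
    exact nonneg_of_mul_nonneg_left h1 h2
  have hm3 : StronglyMeasurable fun q : Rd d × (Rd d × Rd d) =>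
      ψ q.1 * (k q.2.1 q.2.2 * S q.2.1 (q.1 + q.2.2)) := by
    refine (hψ.comp_measurable measurable_fst).mul ((hk.comp_measurable
      (g := fun q : Rd d × (Rd d × Rd d) => (q.2.1, q.2.2)) (by fun_prop)).mul ?_)
    exact hS.comp_measurable (g := fun q : Rd d × (Rd d × Rd d) => (q.2.1, q.1 + q.2.2))
      (by fun_prop)
  have hmaj2 : Integrable (fun p : Rd d × Rd d => maj p.1 * maj p.2) (volume.prod volume) :=
    integrable_maj.mul_prod integrable_maj
  have hi3 : Integrable (fun q : Rd d × (Rd d × Rd d) =>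
      ψ q.1 * (k q.2.1 q.2.2 * S q.2.1 (q.1 + q.2.2))) (volume.prod (volume.prod volume)) := by
    refine ((integrable_maj.mul_prod hmaj2).const_mul C).mono' hm3.aestronglyMeasurable
      (ae_of_all _ fun q => ?_)
    rw [norm_mul, norm_mul, ← mul_assoc]
    exact (hb q.1 q.2.1 q.2.2).trans (le_of_eq (by ring))
  have s1 : ∫ u, ψ u * ∫ p : Rd d × Rd d, k p.1 p.2 * S p.1 (u + p.2) =
      ∫ u, ∫ p : Rd d × Rd d, ψ u * (k p.1 p.2 * S p.1 (u + p.2)) := by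
    simp_rw [integral_const_mul]
  rw [s1, Measure.volume_eq_prod, integral_integral_swap (f := fun u (p : Rd d × Rd d) =>
    ψ u * (k p.1 p.2 * S p.1 (u + p.2))) hi3]
  have hi2 := hi3.integral_prod_right
  rw [integral_prod _ hi2]
  congr 1
  ext t
  have hmt : StronglyMeasurable fun q : Rd d × Rd d => ψ q.1 * (k t q.2 * S t (q.1 + q.2)) :=
    hm3.comp_measurable (g := fun q : Rd d × Rd d => (q.1, (t, q.2))) (by fun_prop)
  have hit : Integrable (fun q : Rd d × Rd d => ψ q.1 * (k t q.2 * S t (q.1 + q.2)))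
      (volume.prod volume) := by
    refine (hmaj2.const_mul (C * maj t)).mono' hmt.aestronglyMeasurable (ae_of_all _ fun q => ?_)
    rw [norm_mul, norm_mul, ← mul_assoc]
    exact (hb q.1 t q.2).trans (le_of_eq (by ring))
  rw [← integral_integral_swap (f := fun u y => ψ u * (k t y * S t (u + y))) hit]
  have s3 : ∀ u, ∫ y, ψ u * (k t y * S t (u + y)) = ∫ v, ψ u * (k t (v - u) * S t v) := by
    intro u
    rw [← integral_sub_right_eq_self _ u]
    simp only [add_sub_cancel]
  simp_rw [s3]
  have hmt' : StronglyMeasurable fun q : Rd d × Rd d => ψ q.1 * (k t (q.2 - q.1) * S t q.2) := by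
    have := hmt.comp_measurable (g := fun q : Rd d × Rd d => (q.1, q.2 - q.1)) (by fun_prop)
    simpa only [Function.comp_def, add_sub_cancel] using this
  have hit' : Integrable (fun q : Rd d × Rd d => ψ q.1 * (k t (q.2 - q.1) * S t q.2))
      (volume.prod volume) := by
    have hc := (Integrable.convolution_integrand (ContinuousLinearMap.mul ℝ ℝ)
      (integrable_maj (d := d)) (integrable_maj (d := d))).swap
    refine (hc.const_mul (C * maj t)).mono' hmt'.aestronglyMeasurable (ae_of_all _ fun q => ?_)
    have := hb q.1 t (q.2 - q.1)
    rw [add_sub_cancel] at this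
    rw [norm_mul, norm_mul, ← mul_assoc]
    refine this.trans (le_of_eq ?_)
    simp only [Prod.fst_swap, Prod.snd_swap, Function.comp, ContinuousLinearMap.mul_apply']
    ring
  rw [integral_integral_swap (f := fun u v => ψ u * (k t (v - u) * S t v)) hit']
  congr 1
  ext v
  rw [← integral_mul_const]
  simp only [mul_assoc]

end Ultra

namespace Ultra

variable {d : ℕ}

/-! ### Deconvolution -/

/-- Bounds on `φ` and on the window `g` at all scales `h ≥ h₀` that are good enough to
deconvolve `φ`. -/
def Tame (M : WeightSequence) (g : ℕ → ℝ → ℂ) (θ : ℝ → ℝ) (A : ℕ) (H h₀ D κ : ℝ) (w : Weight d)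
    (φ : Smooth d) : Prop :=
  ∀ τ, 0 ≤ τ → ∃ h Cφ Cg, h₀ ≤ h ∧ Bnd M h w Cφ φ ∧ JBnd M h (κ + 2) Cg g ∧
    Cφ * Cg ^ d * M.assoc (θ τ) ^ (A * d) * (1 + τ ^ 2) ^ (2 * d) ≤ D * M.assoc (h / H * τ)

/-- The tensor product of kernels depending on a parameter. -/
def ktens (k : ℝ → ℝ → ℂ) (t y : Rd d) : ℂ := ∏ j, k (t j) (y j)

theorem stronglyMeasurable_ktens {k : ℝ → ℝ → ℂ} (hk : StronglyMeasurable (Function.uncurry k)) :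
    StronglyMeasurable (Function.uncurry (ktens (d := d) k)) := by
  refine Finset.stronglyMeasurable_fun_prod (s := Finset.univ)
    (f := fun j (p : Rd d × Rd d) => k (p.1 j) (p.2 j)) fun j _ => ?_
  exact hk.comp_measurable (g := fun p : Rd d × Rd d => (p.1 j, p.2 j)) (by fun_prop)

theorem prod_one_add_sq_le (t : Rd d) :
    (∏ j, (1 + t j ^ 2)) ^ 2 ≤ (1 + ‖WithLp.ofLp t‖ ^ 2) ^ (2 * d) := by
  rw [mul_comm 2 d, pow_mul]
  have h1 : ∏ j, (1 + t j ^ 2) ≤ (1 + ‖WithLp.ofLp t‖ ^ 2) ^ d := by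
    calc ∏ j, (1 + t j ^ 2) ≤ ∏ _j : Fin d, (1 + ‖WithLp.ofLp t‖ ^ 2) := by
          refine Finset.prod_le_prod (fun _ _ => by positivity) fun j _ => ?_
          have := norm_le_pi_norm (WithLp.ofLp t) j
          rw [Real.norm_eq_abs] at this
          rw [← sq_abs (t j)]
          gcongr
      _ = _ := by simp
  exact pow_le_pow_left₀ (Finset.prod_nonneg fun _ _ => by positivity) h1 2

theorem prod_one_add_sq_mul_maj (t : Rd d) : (∏ j, (1 + t j ^ 2)) * maj t = 1 := by
  rw [maj, ← Finset.prod_mul_distrib]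
  exact Finset.prod_eq_one fun j _ => mul_inv_cancel₀ (by positivity)

theorem one_le_prod_one_add_sq (t : Rd d) : 1 ≤ ∏ j, (1 + t j ^ 2) := by
  calc (1 : ℝ) = ∏ _j : Fin d, 1 := by simp
    _ ≤ _ := Finset.prod_le_prod (fun _ _ => zero_le_one) fun j _ => by
      linarith [sq_nonneg (t j)]

section

variable {M : WeightSequence} {w₀ w₁ w₂ : Weight d} {κ₀ c₀ κ₁ c₁ C₀ H h₀ D Ck : ℝ}
  {g : ℕ → ℝ → ℂ} {φ : Smooth d} {θ : ℝ → ℝ} {A : ℕ} {k : ℝ → ℝ → ℂ}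

/-- The decay estimate is used at the scale h attached to the frequency ‖t‖. Of the square of P =
∏(1 + t_j²) provided by `Tame`, one factor is kept for the kernels and the other becomes `maj t`; h
≥ h₀ keeps the regularity in x uniform in t. -/
theorem Tame.stft_le (hφ : Tame M g θ A H h₀ D κ₁ w₂ φ) (hC₀ : 1 ≤ C₀) (hH : 1 ≤ H)
    (hM : ∀ p q : ℕ, M.M (p + q) ≤ C₀ * H ^ (p + q) * M.M p * M.M q) (hh₀ : 0 < h₀)
    (hj : IsJet g) (hw : Dom w₁ w₂ κ₁ c₁) (α : Fin d → ℕ) (t x : Rd d) :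
    ‖stft g φ 0 α t x‖ * M.assoc (θ ‖WithLp.ofLp t‖) ^ (A * d) * (∏ j, (1 + t j ^ 2)) ≤
      C₀ * c₁ * (∫ z : Rd d, maj z) * D * (M.M (len α) / (h₀ / H) ^ len α) * (w₁ x)⁻¹ * maj t := by
  obtain ⟨h, Cφ, Cg, hh, hb, hg, hle⟩ := hφ ‖WithLp.ofLp t‖ (norm_nonneg _)
  have hh1 : 0 < h := hh₀.trans_le hh
  have hs := stft_mul_assoc_le hC₀ hH hM hj hw hh1 hb hg α t x
  have hI : 0 ≤ ∫ z : Rd d, maj z := integral_nonneg fun z => (maj_pos z).le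
  have hCg := hg.nonneg
  have hCφ := hb.nonneg
  have hc := hw.pos
  have p0 := inv_pos.2 (w₁.pos x)
  have hMα := M.pos (len α)
  have hE := M.assoc_pos (h / H * ‖WithLp.ofLp t‖)
  have hE' := M.assoc_pos (θ ‖WithLp.ofLp t‖)
  have hpr := prod_one_add_sq_le t
  have hpm := prod_one_add_sq_mul_maj t
  have hp1 := one_le_prod_one_add_sq t
  have hm := maj_pos t
  set P := ∏ j, (1 + t j ^ 2)
  set N := ‖WithLp.ofLp t‖
  set E := M.assoc (h / H * N)
  set T := M.assoc (θ N) ^ (A * d)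
  have hT : 0 < T := pow_pos hE' _
  have e1 : (h₀ / H) ^ len α ≤ (h / H) ^ len α := by gcongr
  have e2 : M.M (len α) / (h / H) ^ len α ≤ M.M (len α) / (h₀ / H) ^ len α := by gcongr
  have e3 : Cφ * Cg ^ d * T * (P ^ 2) ≤ D * E := le_trans (by gcongr) hle
  refine le_of_mul_le_mul_right ?_ hE
  have hMh : 0 < M.M (len α) / (h₀ / H) ^ len α := by positivity
  set Q := M.M (len α) / (h₀ / H) ^ len α
  calc ‖stft g φ 0 α t x‖ * T * P * E
      = (‖stft g φ 0 α t x‖ * E) * (T * P * (P * maj t)) := by rw [hpm]; ring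
    _ ≤ (C₀ * c₁ * (∫ z : Rd d, maj z) * (Cφ * Cg ^ d) * Q * (w₁ x)⁻¹) * (T * P * (P * maj t)) := by
        refine mul_le_mul_of_nonneg_right (hs.trans ?_) (by positivity)
        gcongr
    _ = C₀ * c₁ * (∫ z : Rd d, maj z) * Q * (w₁ x)⁻¹ * maj t * (Cφ * Cg ^ d * T * P ^ 2) := by ring
    _ ≤ C₀ * c₁ * (∫ z : Rd d, maj z) * Q * (w₁ x)⁻¹ * maj t * (D * E) := by gcongr
    _ = _ := by ring

theorem Tame.nonneg (hφ : Tame M g θ A H h₀ D κ₁ w₂ φ) : 0 ≤ D := by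
  obtain ⟨h, Cφ, Cg, hh, hb, hg, hle⟩ := hφ 0 le_rfl
  have hCg := hg.nonneg
  have hCφ := hb.nonneg
  have hE := M.assoc_pos (h / H * 0)
  have hE' := M.assoc_pos (θ 0)
  have : 0 ≤ Cφ * Cg ^ d * M.assoc (θ 0) ^ (A * d) * (1 + 0 ^ 2) ^ (2 * d) := by positivity
  exact nonneg_of_mul_nonneg_left (this.trans hle) hE

theorem norm_ktens_le (hθ : Moderate θ) (hCk : 0 ≤ Ck)
    (hk : ∀ τ y, ‖k τ y‖ ≤ Ck * (M.assoc (θ |τ|) ^ A * (1 + τ ^ 2)) * Real.exp (-(κ₀ + 2) * |y|))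
    (t y : Rd d) :
    ‖ktens k t y‖ ≤ (Ck ^ d * M.assoc (θ ‖WithLp.ofLp t‖) ^ (A * d) * ∏ j, (1 + t j ^ 2)) *
      ∏ j, Real.exp (-(κ₀ + 2) * |y j|) := by
  rw [ktens, norm_prod]
  have hE := M.assoc_pos (θ ‖WithLp.ofLp t‖)
  calc _ ≤ ∏ j, (Ck * (M.assoc (θ ‖WithLp.ofLp t‖) ^ A * (1 + t j ^ 2)) *
        Real.exp (-(κ₀ + 2) * |y j|)) := by
        refine Finset.prod_le_prod (fun _ _ => norm_nonneg _) fun j _ => (hk _ _).trans ?_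
        have e0 := (M.assoc_pos (θ |t j|)).le
        have e1 : M.assoc (θ |t j|) ≤ M.assoc (θ ‖WithLp.ofLp t‖) := by
          have := norm_le_pi_norm (WithLp.ofLp t) j
          rw [Real.norm_eq_abs] at this
          exact M.assoc_mono (hθ.nonneg _ (abs_nonneg _))
            (hθ.mono (Set.mem_Ici.2 (abs_nonneg _)) (Set.mem_Ici.2 (norm_nonneg _)) this)
        gcongr
    _ = _ := by
        rw [Finset.prod_mul_distrib, Finset.prod_mul_distrib, Finset.prod_mul_distrib,
          Finset.prod_const, Finset.prod_const, Finset.card_univ, Fintype.card_fin, ← pow_mul]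
        ring

/-- The integrand of the deconvolution of `φ`. -/
def deconvIntegrand (k : ℝ → ℝ → ℂ) (g : ℕ → ℝ → ℂ) (φ : Smooth d) (p : Rd d × Rd d)
    (α : Fin d → ℕ) (x : Rd d) : ℂ := ktens k p.1 p.2 * stft g φ 0 α p.1 (x - p.2)

/-- The growth of the kernels in t is exactly the factor carried by `Tame.stft_le`, so the two
cancel. -/
theorem Tame.deconvIntegrand_le (hφ : Tame M g θ A H h₀ D κ₁ w₂ φ) (hC₀ : 1 ≤ C₀) (hH : 1 ≤ H)
    (hM : ∀ p q : ℕ, M.M (p + q) ≤ C₀ * H ^ (p + q) * M.M p * M.M q) (hh₀ : 0 < h₀)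
    (hj : IsJet g) (hw' : Dom w₀ w₁ κ₀ c₀) (hw : Dom w₁ w₂ κ₁ c₁) (hθ : Moderate θ) (hCk : 0 ≤ Ck)
    (hk : ∀ τ y, ‖k τ y‖ ≤ Ck * (M.assoc (θ |τ|) ^ A * (1 + τ ^ 2)) * Real.exp (-(κ₀ + 2) * |y|))
    (p : Rd d × Rd d) (α : Fin d → ℕ) (x : Rd d) :
    ‖deconvIntegrand k g φ p α x‖ ≤ C₀ * c₁ * (∫ z : Rd d, maj z) * Ck ^ d * c₀ * D *
      (M.M (len α) / (h₀ / H) ^ len α) * (w₀ x)⁻¹ * (maj p.1 * maj p.2) := by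
  obtain ⟨t, y⟩ := p
  have hs := hφ.stft_le hC₀ hH hM hh₀ hj hw α t (x - y)
  have hkt := norm_ktens_le (d := d) hθ hCk hk t y
  have hp1 := one_le_prod_one_add_sq t
  have hE' := M.assoc_pos (θ ‖WithLp.ofLp t‖)
  have hD := hφ.nonneg
  have hI : 0 ≤ ∫ z : Rd d, maj z := integral_nonneg fun z => (maj_pos z).le
  have hc := hw.pos
  have hMα := M.pos (len α)
  have hm := maj_pos t
  set P := ∏ j, (1 + t j ^ 2)
  set T := M.assoc (θ ‖WithLp.ofLp t‖) ^ (A * d)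
  have hT : 0 < T := pow_pos hE' _
  set Q := C₀ * c₁ * (∫ z : Rd d, maj z) * D * (M.M (len α) / (h₀ / H) ^ len α) with hQ
  have hQ0 : 0 ≤ Q := by positivity
  have hTP : 0 < T * P := by positivity
  have hs' : ‖stft g φ 0 α t (x - y)‖ ≤ (Q * maj t / (T * P)) * (w₁ (x - y))⁻¹ := by
    rw [div_mul_eq_mul_div, le_div_iff₀ hTP]
    calc _ = ‖stft g φ 0 α t (x - y)‖ * T * P := by ring
      _ ≤ _ := hs
      _ = _ := by rw [hQ]; ring
  rw [deconvIntegrand, norm_mul]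
  refine (hw'.kernel_le (by positivity) (norm_nonneg _) hkt (by positivity) hs').trans
    (le_of_eq ?_)
  rw [hQ]
  field_simp

theorem stronglyMeasurable_deconvIntegrand (hkm : StronglyMeasurable (Function.uncurry k))
    (hj : IsJet g) (φ : Smooth d) (α : Fin d → ℕ) (x : Rd d) :
    StronglyMeasurable fun p => deconvIntegrand k g φ p α x :=
  (stronglyMeasurable_ktens hkm).mul ((stronglyMeasurable_stft hj φ 0 α).comp_measurable
    (g := fun p : Rd d × Rd d => (p.1, x - p.2)) (by fun_prop))

theorem integrable_maj_prod :
    Integrable fun p : Rd d × Rd d => maj p.1 * maj p.2 :=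
  integrable_maj.mul_prod integrable_maj

theorem Tame.exists_smooth (hφ : Tame M g θ A H h₀ D κ₁ w₂ φ) (hC₀ : 1 ≤ C₀) (hH : 1 ≤ H)
    (hM : ∀ p q : ℕ, M.M (p + q) ≤ C₀ * H ^ (p + q) * M.M p * M.M q) (hh₀ : 0 < h₀)
    (hj : IsJet g) (hw' : Dom w₀ w₁ κ₀ c₀) (hw : Dom w₁ w₂ κ₁ c₁) (hθ : Moderate θ) (hCk : 0 ≤ Ck)
    (hkm : StronglyMeasurable (Function.uncurry k))
    (hk : ∀ τ y, ‖k τ y‖ ≤ Ck * (M.assoc (θ |τ|) ^ A * (1 + τ ^ 2)) * Real.exp (-(κ₀ + 2) * |y|)) :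
    ∃ f : Smooth d, ∀ α x, (mderiv α f : Rd d → ℂ) x = ∫ p, deconvIntegrand k g φ p α x := by
  have hle := hφ.deconvIntegrand_le hC₀ hH hM hh₀ hj hw' hw hθ hCk hk
  have hjet : IsMultiJet fun α x => ∫ p, deconvIntegrand k g φ p α x := by
    obtain ⟨h, Cφ, Cg, hh, hb, hg, -⟩ := hφ 0 le_rfl
    refine IsMultiJet.integral_of_weight (fun p => ?_)
      (fun α x => (stronglyMeasurable_deconvIntegrand hkm hj φ α x).aestronglyMeasurable)
      integrable_maj_prod (fun p => (mul_pos (maj_pos _) (maj_pos _)).le) w₀ hle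
    exact ((isMultiJet_stft hj hw (hh₀.trans_le hh) hb hg p.1).comp_sub p.2).const_mul _
  obtain ⟨f, hf⟩ := hjet.exists_smooth
  exact ⟨f, fun α x => congrFun (hf α) x⟩

theorem Tame.bnd (hφ : Tame M g θ A H h₀ D κ₁ w₂ φ) (hC₀ : 1 ≤ C₀) (hH : 1 ≤ H)
    (hM : ∀ p q : ℕ, M.M (p + q) ≤ C₀ * H ^ (p + q) * M.M p * M.M q) (hh₀ : 0 < h₀)
    (hj : IsJet g) (hw' : Dom w₀ w₁ κ₀ c₀) (hw : Dom w₁ w₂ κ₁ c₁) (hθ : Moderate θ) (hCk : 0 ≤ Ck)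
    (hk : ∀ τ y, ‖k τ y‖ ≤ Ck * (M.assoc (θ |τ|) ^ A * (1 + τ ^ 2)) * Real.exp (-(κ₀ + 2) * |y|))
    {f : Smooth d}
    (hf : ∀ α x, (mderiv α f : Rd d → ℂ) x = ∫ p, deconvIntegrand k g φ p α x) :
    Bnd M (h₀ / H) w₀ (C₀ * c₁ * (∫ z : Rd d, maj z) * Ck ^ d * c₀ *
      (∫ p : Rd d × Rd d, maj p.1 * maj p.2) * D) f := by
  intro α x
  rw [hf]
  refine (norm_integral_le_of_norm_le (integrable_maj_prod.const_mul _) (ae_of_all _ fun p =>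
    hφ.deconvIntegrand_le hC₀ hH hM hh₀ hj hw' hw hθ hCk hk p α x)).trans (le_of_eq ?_)
  rw [integral_const_mul]
  ring

end

end Ultra

/-! ### The reproducing identity and the deconvolution operator. -/

namespace Ultra

variable {d : ℕ}

theorem integral_ktens_conv {ψ : ℕ → ℝ → ℂ} {k : ℝ → ℝ → ℂ} {g : ℕ → ℝ → ℂ}
    (hconv : ∀ τ y, ∫ u, ψ 0 u * k τ (y - u) =
      Complex.exp (2 * Real.pi * τ * y * Complex.I) * g 0 y) (t v : Rd d) :
    ∫ u, tens ψ 0 u * ktens k t (v - u) = chr t v * tens g 0 v := by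
  have h := integral_prod_coord (d := d) fun j u => ψ 0 u * k (t j) (v j - u)
  simp only [hconv] at h
  rw [Finset.prod_mul_distrib, ← chr_eq_prod] at h
  rw [show tens g 0 v = ∏ j, g 0 (v j) from rfl, ← h]
  congr 1
  ext u
  rw [Finset.prod_mul_distrib]
  rfl

theorem conv_eq (ψ φ : Smooth d) (x : Rd d) :
    conv ψ φ x = ∫ u, (ψ : Rd d → ℂ) u * (φ : Rd d → ℂ) (x - u) := rfl

variable {M : WeightSequence} {w w₀ w₁ w₂ : Weight d} {κ c κ₀ c₀ κ₁ c₁ C₀ H h₀ D Ck Cψ Cg : ℝ}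
  {g ψ : ℕ → ℝ → ℂ} {φ : Smooth d} {θ : ℝ → ℝ} {A : ℕ} {k : ℝ → ℝ → ℂ}

/-- Fubini brings ψ to the kernels and yields the modulated window. With the integral over t
innermost, inversion gives g(v) g(-v) φ(x), and the integral over v factors into d equal ones. Each
of the three integrations (window, kernel, ψ) uses up one weight comparison. -/
theorem Tame.integral_conv_deconv (hφ : Tame M g θ A H h₀ D κ₁ w₂ φ) (hC₀ : 1 ≤ C₀) (hH : 1 ≤ H)
    (hM : ∀ p q : ℕ, M.M (p + q) ≤ C₀ * H ^ (p + q) * M.M p * M.M q) (hh₀ : 0 < h₀)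
    (hj : IsJet g) (hw'' : Dom w w₀ κ c) (hw' : Dom w₀ w₁ κ₀ c₀) (hw : Dom w₁ w₂ κ₁ c₁)
    (hθ : Moderate θ) (hCk : 0 ≤ Ck) (hkm : StronglyMeasurable (Function.uncurry k))
    (hk : ∀ τ y, ‖k τ y‖ ≤ Ck * (M.assoc (θ |τ|) ^ A * (1 + τ ^ 2)) * Real.exp (-(κ₀ + 2) * |y|))
    (hψj : IsJet ψ) {hψ₀ : ℝ} (hψ0 : 0 < hψ₀) (hψ : JBnd M hψ₀ (κ + 2) Cψ ψ)
    (hg : JBnd M h₀ (κ₀ + 2) Cg g)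
    (hconv : ∀ τ y, ∫ u, ψ 0 u * k τ (y - u) =
      Complex.exp (2 * Real.pi * τ * y * Complex.I) * g 0 y) (x : Rd d) :
    ∫ u, tens ψ 0 u * ∫ p, deconvIntegrand k g φ p 0 (x - u) =
      (∫ y, g 0 y * g 0 (-y)) ^ d * (φ : Rd d → ℂ) x := by
  have hD := hφ.nonneg
  have hI : 0 ≤ ∫ z : Rd d, maj z := integral_nonneg fun z => (maj_pos z).le
  have hc := hw.pos
  have hc0 := hw'.pos
  have hl0 : len (0 : Fin d → ℕ) = 0 := by simp [len]
  have hCψ := hψ.nonneg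
  have hCg := hg.nonneg
  set S : Rd d → Rd d → ℂ := fun t v => stft g φ 0 0 t (x - v) with hS
  have hSm : StronglyMeasurable (Function.uncurry S) :=
    (stronglyMeasurable_stft hj φ 0 0).comp_measurable
      (g := fun p : Rd d × Rd d => (p.1, x - p.2)) (by fun_prop)
  have hψm : Continuous (tens (d := d) ψ 0) := (isMultiJet_tens hψj).continuous 0
  have hgm : Continuous (tens (d := d) g 0) := (isMultiJet_tens hj).continuous 0
  have s1 : ∀ u, ∫ p, deconvIntegrand k g φ p 0 (x - u) =
      ∫ p : Rd d × Rd d, ktens k p.1 p.2 * S p.1 (u + p.2) := by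
    intro u
    simp only [deconvIntegrand, hS, sub_sub]
  simp_rw [s1]
  have hψle := fun u => hψ.tens_le (d := d) hψ0 0 u
  simp only [hl0, M.zero, pow_zero, div_one, mul_one] at hψle
  have hgle := fun u => hg.tens_le (d := d) hh₀ 0 u
  simp only [hl0, M.zero, pow_zero, div_one, mul_one] at hgle
  rw [assoc_fubini hψm.stronglyMeasurable (stronglyMeasurable_ktens hkm) hSm
    (C := Cψ ^ d * (C₀ * c₁ * (∫ z : Rd d, maj z) * Ck ^ d * c₀ * D) * c * (w x)⁻¹)]
  · simp_rw [integral_ktens_conv hconv]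
    have hSle : ∀ t y : Rd d, ‖stft g φ 0 0 t y‖ ≤
        (C₀ * c₁ * (∫ z : Rd d, maj z) * D * maj t) * (w₁ y)⁻¹ := by
      intro t y
      have h1 := hφ.stft_le hC₀ hH hM hh₀ hj hw 0 t y
      simp only [hl0, M.zero, pow_zero, div_one, mul_one] at h1
      have h2 : 1 ≤ M.assoc (θ ‖WithLp.ofLp t‖) ^ (A * d) * ∏ j, (1 + t j ^ 2) :=
        one_le_mul_of_one_le_of_one_le (one_le_pow₀ (M.one_le_assoc _)) (one_le_prod_one_add_sq t)
      rw [mul_assoc] at h1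
      refine (le_mul_of_one_le_right (norm_nonneg _) h2).trans (h1.trans (le_of_eq ?_))
      ring
    have hint : Integrable (fun p : Rd d × Rd d => chr p.1 p.2 * tens g 0 p.2 * S p.1 p.2)
        (volume.prod volume) := by
      refine (integrable_maj_prod.const_mul (Cg ^ d *
        (C₀ * c₁ * (∫ z : Rd d, maj z) * D) * c₀ * (w₀ x)⁻¹)).mono' ?_ (ae_of_all _ fun p => ?_)
      · refine StronglyMeasurable.aestronglyMeasurable ?_
        exact ((continuous_chr (d := d)).stronglyMeasurable.mul
          (hgm.comp continuous_snd).stronglyMeasurable).mul hSm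
      · rw [norm_mul, norm_mul, norm_chr, one_mul]
        have hm := maj_pos p.1
        refine (hw'.kernel_le (by positivity) (norm_nonneg _) (hgle p.2) (by positivity)
          (hSle p.1 (x - p.2))).trans (le_of_eq ?_)
        ring
    rw [integral_integral_swap (f := fun t v => chr t v * tens g 0 v * S t v) hint]
    have hinner : ∀ v, ∫ t, chr t v * tens g 0 v * S t v =
        tens g 0 v * tens g 0 (-v) * (φ : Rd d → ℂ) x := by
      intro v
      obtain ⟨h, Cφ, Cg', hh, hb, hg', -⟩ := hφ 0 le_rfl
      have h1 := integral_chr_mul_stft hj hw (hh₀.trans_le hh) hb hg' x v ?_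
      · rw [mul_assoc, ← h1, ← integral_const_mul]
        congr 1
        ext t
        simp only [hS]
        ring
      · have h2 : Integrable fun t : Rd d =>
            C₀ * c₁ * (∫ z : Rd d, maj z) * D * maj t * (w₁ (x - v))⁻¹ :=
          (integrable_maj.const_mul _).mul_const _
        refine h2.mono' ?_ (ae_of_all _ fun t => hSle t (x - v))
        exact ((stronglyMeasurable_stft hj φ 0 0).comp_measurable
          (g := fun t : Rd d => (t, x - v)) (by fun_prop)).aestronglyMeasurable
    simp_rw [hinner]
    rw [integral_mul_const]
    congr 1
    have h3 := integral_prod_coord (d := d) fun _ y => g 0 y * g 0 (-y)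
    rw [Finset.prod_const, Finset.card_univ, Fintype.card_fin] at h3
    rw [← h3]
    congr 1
    ext v
    rw [Finset.prod_mul_distrib]
    rfl
  · intro u t y
    have h1 := hφ.deconvIntegrand_le hC₀ hH hM hh₀ hj hw' hw hθ hCk hk (t, y) 0 (x - u)
    simp only [hl0, M.zero, pow_zero, div_one, mul_one, deconvIntegrand, norm_mul, sub_sub] at h1
    rw [mul_assoc]
    have hm := maj_pos t
    have hm' := maj_pos y
    refine (hw''.kernel_le (B := C₀ * c₁ * (∫ z : Rd d, maj z) * Ck ^ d * c₀ * D *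
      (maj t * maj y)) (by positivity) (norm_nonneg _) (hψle u) (by positivity)
      (h1.trans (le_of_eq (by ring)))).trans (le_of_eq ?_)
    ring

/-- The constant in the deconvolution estimate. -/
def deconvConst (d : ℕ) (C₀ c₀ c₁ Ck : ℝ) (a : ℂ) : ℝ :=
  ‖a‖ * (C₀ * c₁ * (∫ z : Rd d, maj z) * Ck ^ d * c₀ * (∫ p : Rd d × Rd d, maj p.1 * maj p.2))

theorem Bnd.smul {h C : ℝ} {f : Smooth d} (hf : Bnd M h w C f) (a : ℂ) :
    Bnd M h w (‖a‖ * C) (a • f) := by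
  intro α x
  have h1 : ‖(mderiv α (a • f) : Rd d → ℂ) x‖ = ‖a‖ * ‖(mderiv α f : Rd d → ℂ) x‖ := by
    rw [map_smul]; exact norm_smul a _
  rw [h1, mul_assoc, mul_assoc]
  refine mul_le_mul_of_nonneg_left ?_ (norm_nonneg a)
  rw [← mul_assoc]
  exact hf α x

theorem JBnd.mono {h k k' C : ℝ} {a : ℕ → ℝ → ℂ} (ha : JBnd M h k C a) (hh : 0 < h)
    (hk : k' ≤ k) : JBnd M h k' C a := by
  intro n y
  have h1 := ha.nonneg
  have h2 := M.pos n
  refine (ha n y).trans (mul_le_mul_of_nonneg_left (Real.exp_le_exp.2 ?_) (by positivity))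
  have := abs_nonneg y
  nlinarith

/-- All constituents of the deconvolution: a window `g`, a convolutor `ψ`, and kernels `k`. -/
structure Deconvolver (M : WeightSequence) (g : ℕ → ℝ → ℂ) (A : ℕ) (θ : ℝ → ℝ) (ψ : ℕ → ℝ → ℂ)
    (k : ℝ → ℝ → ℂ) : Prop where
  jet : IsJet g
  bound : ∀ h, 0 < h → M.JetBound h g
  ne_zero : ∫ y, g 0 y * g 0 (-y) ≠ 0
  moderate : Moderate θ
  jet' : IsJet ψ
  bound' : ∃ h, 0 < h ∧ M.JetBound h ψ
  measurable : StronglyMeasurable (Function.uncurry k)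
  kernel_le : ∀ κ, 0 ≤ κ → ∃ C, ∀ τ y, ‖k τ y‖ ≤
    C * (M.assoc (θ |τ|) ^ A * (1 + τ ^ 2)) * Real.exp (-κ * |y|)
  integral_eq : ∀ τ y, ∫ u, ψ 0 u * k τ (y - u) = Complex.exp (2 * Real.pi * τ * y * Complex.I) * g 0 y

theorem Deconvolver.exists_kernel_le (hd : Deconvolver M g A θ ψ k) (hκ : 0 ≤ κ) :
    ∃ C, 0 ≤ C ∧ ∀ τ y, ‖k τ y‖ ≤
      C * (M.assoc (θ |τ|) ^ A * (1 + τ ^ 2)) * Real.exp (-κ * |y|) := by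
  obtain ⟨C, hC⟩ := hd.kernel_le κ hκ
  refine ⟨C, ?_, hC⟩
  have e := (norm_nonneg _).trans (hC 0 0)
  have := pow_pos (M.assoc_pos (θ |0|)) A
  simp only [abs_zero, mul_zero, Real.exp_zero, mul_one, ne_eq, OfNat.ofNat_ne_zero,
    not_false_eq_true, zero_pow, add_zero] at e this
  exact nonneg_of_mul_nonneg_left e this

/-- Deconvolution with uniform bounds. -/
theorem Deconvolver.exists_deconv (hd : Deconvolver M g A θ ψ k) (hC₀ : 1 ≤ C₀) (hH : 1 ≤ H)
    (hM : ∀ p q : ℕ, M.M (p + q) ≤ C₀ * H ^ (p + q) * M.M p * M.M q) {Ψ : Smooth d}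
    (hΨ : (Ψ : Rd d → ℂ) = tens ψ 0) :
    ∃ T : Smooth d → Smooth d,
      (∀ φ, (∃ (w w₀ w₁ w₂ : Weight d) (κ c κ₀ c₀ κ₁ c₁ h₀ D : ℝ), Dom w w₀ κ c ∧ Dom w₀ w₁ κ₀ c₀ ∧
        Dom w₁ w₂ κ₁ c₁ ∧ 0 < h₀ ∧ Tame M g θ A H h₀ D κ₁ w₂ φ) →
        conv Ψ (T φ) = (φ : Rd d → ℂ)) ∧
      ∀ (w₀ w₁ w₂ : Weight d) (κ₀ c₀ κ₁ c₁ : ℝ), Dom w₀ w₁ κ₀ c₀ → Dom w₁ w₂ κ₁ c₁ →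
        ∃ B, ∀ φ h₀ D, 0 < h₀ → Tame M g θ A H h₀ D κ₁ w₂ φ → Bnd M (h₀ / H) w₀ (B * D) (T φ) := by
  classical
  set a : ℂ := ((∫ y, g 0 y * g 0 (-y)) ^ d)⁻¹ with ha
  -- The defining integral does not involve the weights. One function per φ is chosen, 0 if φ is
  -- never tame, so a single T works for all choices of weights.
  have key : ∀ φ : Smooth d, ∃ f : Smooth d, (∃ (w₀ w₁ w₂ : Weight d) (κ₀ c₀ κ₁ c₁ h₀ D : ℝ),
      Dom w₀ w₁ κ₀ c₀ ∧ Dom w₁ w₂ κ₁ c₁ ∧ 0 < h₀ ∧ Tame M g θ A H h₀ D κ₁ w₂ φ) →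
      ∀ α x, (mderiv α f : Rd d → ℂ) x = ∫ p, deconvIntegrand k g φ p α x := by
    intro φ
    by_cases hex : ∃ (w₀ w₁ w₂ : Weight d) (κ₀ c₀ κ₁ c₁ h₀ D : ℝ),
      Dom w₀ w₁ κ₀ c₀ ∧ Dom w₁ w₂ κ₁ c₁ ∧ 0 < h₀ ∧ Tame M g θ A H h₀ D κ₁ w₂ φ
    · obtain ⟨w₀, w₁, w₂, κ₀, c₀, κ₁, c₁, h₀, D, h1, h2, h3, h4⟩ := hex
      obtain ⟨Ck, hCk0, hCk⟩ := hd.exists_kernel_le (κ := κ₀ + 2) (by linarith [h1.nonneg])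
      obtain ⟨f, hf⟩ := h4.exists_smooth hC₀ hH hM h3 hd.jet h1 h2 hd.moderate hCk0
        hd.measurable hCk
      exact ⟨f, fun _ => hf⟩
    · exact ⟨0, fun h => absurd h hex⟩
  choose T₀ hT₀ using key
  refine ⟨fun φ => a • T₀ φ, ?_, ?_⟩
  · rintro φ ⟨w, w₀, w₁, w₂, κ, c, κ₀, c₀, κ₁, c₁, h₀, D, h0, h1, h2, h3, h4⟩
    have hf := hT₀ φ ⟨w₀, w₁, w₂, κ₀, c₀, κ₁, c₁, h₀, D, h1, h2, h3, h4⟩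
    obtain ⟨Ck, hCk0, hCk⟩ := hd.exists_kernel_le (κ := κ₀ + 2) (by linarith [h1.nonneg])
    obtain ⟨hψ₀, hψ0, hψb⟩ := hd.bound'
    obtain ⟨Cψ, hCψ⟩ := hψb (κ + 2) (by linarith [h0.nonneg])
    obtain ⟨Cg, hCg⟩ := hd.bound h₀ h3 (κ₀ + 2) (by linarith [h1.nonneg])
    ext x
    have h5 := h4.integral_conv_deconv hC₀ hH hM h3 hd.jet h0 h1 h2 hd.moderate hCk0
      hd.measurable hCk hd.jet' hψ0 hCψ hCg hd.integral_eq x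
    have h6 : ∀ u, ((a • T₀ φ : Smooth d) : Rd d → ℂ) (x - u) =
        a * ∫ p, deconvIntegrand k g φ p 0 (x - u) := by
      intro u
      rw [← hf 0 (x - u), mderiv_zero]
      rfl
    rw [conv_eq, hΨ]
    simp_rw [h6, mul_left_comm _ a]
    rw [integral_const_mul, h5, ha, ← mul_assoc, inv_mul_cancel₀ (pow_ne_zero d hd.ne_zero),
      one_mul]
  · intro w₀ w₁ w₂ κ₀ c₀ κ₁ c₁ h1 h2
    obtain ⟨Ck, hCk0, hCk⟩ := hd.exists_kernel_le (κ := κ₀ + 2) (by linarith [h1.nonneg])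
    refine ⟨deconvConst d C₀ c₀ c₁ Ck a, fun φ h₀ D h3 h4 => ?_⟩
    have hf := hT₀ φ ⟨w₀, w₁, w₂, κ₀, c₀, κ₁, c₁, h₀, D, h1, h2, h3, h4⟩
    have h5 := (h4.bnd hC₀ hH hM h3 hd.jet h1 h2 hd.moderate hCk0 hCk hf).smul a
    rw [deconvConst, mul_assoc ‖a‖]
    exact h5

end Ultra

namespace Ultra

variable {d : ℕ} {M : WeightSequence}

/-! ### Membership and boundedness in terms of uniform estimates -/

theorem bnd_iff {h : PosReal} {w : Weight d} {C : ℝ} {φ : Smooth d} :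
    Bnd M h w C φ ↔ ∀ a, term M h w φ a ≤ C := by
  refine ⟨fun H a => ?_, fun H α x => ?_⟩
  · have hM := M.pos (len a.1)
    have hw := w.pos a.2
    have hh := pow_pos h.2 (len a.1)
    have h1 := H a.1 a.2
    rw [term, div_le_iff₀ hM]
    calc (h : ℝ) ^ len a.1 * ‖(mderiv a.1 φ : Rd d → ℂ) a.2‖ * w a.2
        ≤ (h : ℝ) ^ len a.1 * (C * (M.M (len a.1) / (h : ℝ) ^ len a.1) * (w a.2)⁻¹) * w a.2 := by
          gcongr
      _ = C * M.M (len a.1) := by field_simp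
  · have hM := M.pos (len α)
    have hw := w.pos x
    have hh := pow_pos h.2 (len α)
    have h1 := H (α, x)
    rw [term, div_le_iff₀ hM] at h1
    calc ‖(mderiv α φ : Rd d → ℂ) x‖
        = (h : ℝ) ^ len α * ‖(mderiv α φ : Rd d → ℂ) x‖ * w x / ((h : ℝ) ^ len α * w x) := by
          field_simp
      _ ≤ C * M.M (len α) / ((h : ℝ) ^ len α * w x) := by gcongr
      _ = _ := by field_simp

theorem mem_BSpace_iff {h : PosReal} {w : Weight d} {φ : Smooth d} :
    φ ∈ BSpace M h w ↔ ∃ C, Bnd M h w C φ := by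
  simp only [bnd_iff]
  refine ⟨fun ⟨C, hC⟩ => ⟨C, fun a => hC ⟨a, rfl⟩⟩, fun ⟨C, hC⟩ => ⟨C, ?_⟩⟩
  rintro _ ⟨a, rfl⟩
  exact hC a

theorem Bnd.mem {h : PosReal} {w : Weight d} {C : ℝ} {φ : Smooth d} (hb : Bnd M h w C φ) :
    φ ∈ BSpace M h w := mem_BSpace_iff.2 ⟨C, hb⟩

theorem Bnd.mono {h k : PosReal} {w u : Weight d} {C : ℝ} {φ : Smooth d} (hb : Bnd M k u C φ)
    (hk : (h : ℝ) ≤ k) (hw : ∀ x, w x ≤ u x) : Bnd M h w C φ :=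
  bnd_iff.2 fun a => (term_mono M hk hw φ a).trans (bnd_iff.1 hb a)

theorem Bnd.mono_const {h : PosReal} {w : Weight d} {C C' : ℝ} {φ : Smooth d}
    (hb : Bnd M h w C φ) (hC : C ≤ C') : Bnd M h w C' φ :=
  bnd_iff.2 fun a => (bnd_iff.1 hb a).trans hC

theorem bNorm_le {h : PosReal} {w : Weight d} {C : ℝ} {φ : BSpace M h w}
    (hb : Bnd M h w C φ) : BNorm M h w φ ≤ C :=
  ciSup_le (bnd_iff.1 hb)

theorem bnd_bNorm {h : PosReal} {w : Weight d} (φ : BSpace M h w) :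
    Bnd M h w (BNorm M h w φ) φ :=
  bnd_iff.2 fun a => le_ciSup φ.2 a

theorem mem_projSpace_iff {ι : Type} {h : ι → PosReal} {w : ι → Weight d} {φ : Smooth d} :
    φ ∈ projSpace M h w ↔ ∀ i, ∃ C, Bnd M (h i) (w i) C φ := by
  simp only [projSpace, Submodule.mem_iInf, mem_BSpace_iff]

theorem isVonNBounded_topology_iff {E ι : Type*} [AddCommGroup E] [Module ℂ E] [Nonempty ι]
    (p : SeminormFamily ℂ E ι) (s : Set E) :
    @Bornology.IsVonNBounded ℂ E _ _ _ p.moduleFilterBasis.topology s ↔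
      ∀ i, ∃ r > 0, ∀ x ∈ s, p i x < r := by
  let _ : TopologicalSpace E := p.moduleFilterBasis.topology
  have hs : WithSeminorms p := ⟨rfl⟩
  exact hs.isVonNBounded_iff_seminorm_bounded

theorem boundedIn_projSpace_iff {ι : Type} [Nonempty ι] {h : ι → PosReal} {w : ι → Weight d}
    {A : Set (Smooth d)} : BoundedIn (projSpace M h w) (projTopology M h w) A ↔
      ∀ i, ∃ C, ∀ φ ∈ A, Bnd M (h i) (w i) C φ := by
  set p : SeminormFamily ℂ (projSpace M h w) ι := fun i =>
    (BNorm M (h i) (w i)).comp (Submodule.inclusion (iInf_le _ i)) with hp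
  have key := isVonNBounded_topology_iff p
  constructor
  · rintro ⟨hA, hb⟩ i
    obtain ⟨r, -, hr⟩ := (key _).1 hb i
    exact ⟨r, fun φ hφ => (bnd_bNorm (M := M) (h := h i) (w := w i)
      ⟨φ, (Submodule.mem_iInf _).1 (hA hφ) i⟩).mono_const (hr ⟨φ, hA hφ⟩ hφ).le⟩
  · intro H
    refine ⟨fun φ hφ => mem_projSpace_iff.2 fun i => (H i).imp fun C hC => hC φ hφ,
      (key _).2 fun i => ?_⟩
    obtain ⟨C, hC⟩ := H i
    refine ⟨max C 0 + 1, by positivity, fun φ hφ => lt_of_le_of_lt ?_ (lt_add_one _)⟩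
    exact (bNorm_le (φ := Submodule.inclusion (iInf_le _ i) φ) (hC φ hφ)).trans (le_max_left _ _)

theorem boundedIn_singleton_projSpace {ι : Type} [Nonempty ι] {h : ι → PosReal}
    {w : ι → Weight d} {φ : Smooth d} (hφ : φ ∈ projSpace M h w) :
    BoundedIn (projSpace M h w) (projTopology M h w) {φ} :=
  boundedIn_projSpace_iff.2 fun i => (mem_projSpace_iff.1 hφ i).imp fun C hC χ hχ => by
    rw [Set.mem_singleton_iff.1 hχ]; exact hC

/-! ### Bounded sets of the Roumieu inductive limit. -/

theorem boundedIn_BVRoumieu_of_bnd {V : DecreasingWeightSystem d} {A : Set (Smooth d)} {n : ℕ+}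
    {C : ℝ} (hA : ∀ φ ∈ A, Bnd M (posInv n) (V.v n) C φ) :
    BoundedIn (BVRoumieu M V) (BVRoumieuTop M V) A := by
  have key := isVonNBounded_topology_iff (ι := BVRoumieuSeminorm M V) fun p => p.1
  refine ⟨fun φ hφ => ⟨n, (hA φ hφ).mem⟩, (key _).2 fun p => ?_⟩
  obtain ⟨D, hD⟩ := p.2 n
  refine ⟨|D| * max C 0 + 1, by positivity, fun φ hφ => lt_of_le_of_lt ?_ (lt_add_one _)⟩
  have h1 := hD ⟨φ, (hA φ hφ).mem⟩
  have h2 : BNorm M (posInv n) (V.v n) ⟨φ, (hA φ hφ).mem⟩ ≤ C := bNorm_le (hA φ hφ)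
  exact h1.trans (mul_le_mul (le_abs_self D) (h2.trans (le_max_left _ _)) (apply_nonneg _ _)
    (abs_nonneg D))

/-- For n ≥ m the n-th term is dominated by the m-th norm. For the finitely many n ≤ m, the terms at
a fixed point differ by a factor independent of φ. -/
theorem exists_term_le (V : DecreasingWeightSystem d) (a : ℕ+ → (Fin d → ℕ) × Rd d) (m : ℕ+) :
    ∃ K : ℝ, ∀ (φ : Smooth d) (D : ℝ), Bnd M (posInv m) (V.v m) D φ →
      ∀ n : ℕ+, term M (posInv n) (V.v n) φ (a n) ≤ K * D := by
  have hsm : ∀ n : ℕ+, ∃ K : ℝ, 0 ≤ K ∧ ∀ φ : Smooth d, term M (posInv n) (V.v n) φ (a n) ≤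
      K * term M (posInv m) (V.v m) φ (a n) := by
    intro n
    have hp := pow_pos (posInv m).2 (len (a n).1)
    have hq := pow_pos (posInv n).2 (len (a n).1)
    have hv := (V.v m).pos (a n).2
    have hu := (V.v n).pos (a n).2
    have hM := M.pos (len (a n).1)
    refine ⟨(posInv n : ℝ) ^ len (a n).1 * V.v n (a n).2 /
      ((posInv m : ℝ) ^ len (a n).1 * V.v m (a n).2), by positivity, fun φ => le_of_eq ?_⟩
    unfold term
    field_simp
  choose K hK0 hK using hsm
  refine ⟨1 + ∑ i ∈ Finset.Icc 1 m, K i, fun φ D hD n => ?_⟩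
  have hD0 := hD.nonneg
  have hS : 0 ≤ ∑ i ∈ Finset.Icc 1 m, K i := Finset.sum_nonneg fun i _ => hK0 i
  rcases le_total m n with h | h
  · refine ((term_mono M (one_div_le_one_div_of_le (posNat m).2 (Nat.cast_le.2 h))
      (V.anti m n h) φ (a n)).trans (bnd_iff.1 hD _)).trans ?_
    nlinarith
  · have h2 : K n ≤ ∑ i ∈ Finset.Icc 1 m, K i :=
      Finset.single_le_sum (fun i _ => hK0 i) (Finset.mem_Icc.2 ⟨one_le, h⟩)
    calc _ ≤ K n * term M (posInv m) (V.v m) φ (a n) := hK n φ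
      _ ≤ K n * D := mul_le_mul_of_nonneg_left (bnd_iff.1 hD _) (hK0 n)
      _ ≤ _ := mul_le_mul_of_nonneg_right (by linarith) hD0

theorem bddAbove_term (V : DecreasingWeightSystem d) (a : ℕ+ → (Fin d → ℕ) × Rd d)
    (φ : BVRoumieu M V) :
    BddAbove (Set.range fun n : ℕ+ => term M (posInv n) (V.v n) (φ : Smooth d) (a n)) := by
  obtain ⟨m, hm⟩ := φ.2
  obtain ⟨D, hD⟩ := mem_BSpace_iff.1 hm
  obtain ⟨K, hK⟩ := exists_term_le (M := M) V a m
  refine ⟨K * D, ?_⟩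
  rintro _ ⟨n, rfl⟩
  exact hK φ D hD n

/-- The seminorm on `B^{M}_V` given by the values of the norms of the steps at single points. -/
def pointSeminorm (M : WeightSequence) (V : DecreasingWeightSystem d)
    (a : ℕ+ → (Fin d → ℕ) × Rd d) : Seminorm ℂ (BVRoumieu M V) :=
  Seminorm.of (fun φ => ⨆ n : ℕ+, term M (posInv n) (V.v n) (φ : Smooth d) (a n))
    (fun φ χ => ciSup_le fun n => (term_add_le M _ _ (φ : Smooth d) χ _).trans
      (add_le_add (le_ciSup (bddAbove_term V a φ) n) (le_ciSup (bddAbove_term V a χ) n)))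
    (fun c φ => by
      rw [Real.mul_iSup_of_nonneg (norm_nonneg c)]
      exact iSup_congr fun n => term_smul M _ _ c (φ : Smooth d) _)

theorem pointSeminorm_apply (V : DecreasingWeightSystem d) (a : ℕ+ → (Fin d → ℕ) × Rd d)
    (φ : BVRoumieu M V) : pointSeminorm M V a φ =
      ⨆ n : ℕ+, term M (posInv n) (V.v n) (φ : Smooth d) (a n) := rfl

theorem term_le_pointSeminorm (V : DecreasingWeightSystem d) (a : ℕ+ → (Fin d → ℕ) × Rd d)
    (φ : BVRoumieu M V) (n : ℕ+) :
    term M (posInv n) (V.v n) (φ : Smooth d) (a n) ≤ pointSeminorm M V a φ :=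
  le_ciSup (bddAbove_term V a φ) n

theorem pointSeminorm_le_bNorm (V : DecreasingWeightSystem d) (a : ℕ+ → (Fin d → ℕ) × Rd d)
    (m : ℕ+) : ∃ C : ℝ, ∀ φ : BSpace M (posInv m) (V.v m),
      pointSeminorm M V a (Submodule.inclusion (BSpace_le_BVRoumieu M V m) φ) ≤
        C * BNorm M (posInv m) (V.v m) φ := by
  obtain ⟨K, hK⟩ := exists_term_le (M := M) V a m
  refine ⟨K, fun φ => ?_⟩
  rw [pointSeminorm_apply]
  exact ciSup_le fun n => hK φ _ (bnd_bNorm φ) n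

/-- The inductive limit `B^{M}_V` of Roumieu type is regular. -/
theorem BoundedIn.exists_bnd {V : DecreasingWeightSystem d} {A : Set (Smooth d)}
    (hA : BoundedIn (BVRoumieu M V) (BVRoumieuTop M V) A) :
    ∃ (n : ℕ+) (C : ℝ), ∀ φ ∈ A, Bnd M (posInv n) (V.v n) C φ := by
  have key := isVonNBounded_topology_iff (ι := BVRoumieuSeminorm M V) fun p => p.1
  by_contra! hcon
  -- For each n choose an element of A and a point where the n-th term exceeds n. The supremum over
  -- n of the terms at these points is a seminorm continuous on every step, yet unbounded on A.
  have h1 : ∀ n : ℕ+, ∃ φ ∈ A, ∃ a, (n : ℝ) < term M (posInv n) (V.v n) φ a := by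
    intro n
    obtain ⟨φ, hφ, h⟩ := hcon n n
    rw [bnd_iff] at h
    push Not at h
    exact ⟨φ, hφ, h⟩
  choose χ hχ a ha using h1
  obtain ⟨r, -, hr⟩ := (key _).1 hA.2 ⟨pointSeminorm M V a, pointSeminorm_le_bNorm V a⟩
  obtain ⟨N, hN⟩ := exists_nat_gt r
  have h3 := hr ⟨χ N.succPNat, hA.1 (hχ _)⟩ (hχ _)
  have h4 := term_le_pointSeminorm V a ⟨χ N.succPNat, hA.1 (hχ _)⟩ N.succPNat
  have h5 := ha N.succPNat
  have h6 : (((N.succPNat : ℕ+) : ℕ) : ℝ) = N + 1 := by simp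
  linarith

/-! ### Convolution with elements of `K^{M}` -/

theorem exists_norm_le_of_mem_KSpace {h : PosReal} {ψ : Smooth d} (hψ : ψ ∈ KSpace d M h)
    (κ : ℝ) : ∃ C, 0 ≤ C ∧ ∀ y, ‖(ψ : Rd d → ℂ) y‖ ≤ C * ∏ j, Real.exp (-(κ + 2) * |y j|) := by
  -- The factor d accounts for ∑|y_j| ≤ d‖y‖.
  obtain ⟨k, hk⟩ := exists_nat_ge (|κ + 2| * d)
  obtain ⟨C, hC⟩ := mem_projSpace_iff.1 hψ k
  refine ⟨C, hC.nonneg, fun y => ?_⟩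
  have h1 := hC 0 y
  have hC0 := hC.nonneg
  simp only [mderiv_zero, len, Pi.zero_apply, Finset.sum_const_zero, M.zero, pow_zero, div_one,
    mul_one, expWeight] at h1
  refine h1.trans (mul_le_mul_of_nonneg_left ?_ hC0)
  rw [← Real.exp_neg, ← Real.exp_sum, ← Finset.mul_sum, Real.exp_le_exp]
  have h2 : ∑ j, |y j| ≤ d * ‖y‖ := by
    calc ∑ j, |y j| ≤ ∑ _j : Fin d, ‖y‖ := Finset.sum_le_sum fun j _ => abs_coord_le y j
      _ = d * ‖y‖ := by simp
  have h3 : 0 ≤ ∑ j, |y j| := Finset.sum_nonneg fun j _ => abs_nonneg _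
  have h4 := norm_nonneg y
  have h5 : (κ + 2) * ∑ j, |y j| ≤ |κ + 2| * (d * ‖y‖) :=
    mul_le_mul (le_abs_self _) h2 h3 (abs_nonneg _)
  nlinarith

/-- All derivatives fall on φ, so its regularity h survives and only the decay of ψ matters. -/
theorem convExists_and_exists_bnd {k : PosReal} {ψ : Smooth d} (hψ : ψ ∈ KSpace d M k)
    {w₀ w₁ : Weight d} {κ c h C : ℝ} (hw : Dom w₀ w₁ κ c) (hh : 0 < h) {φ : Smooth d}
    (hφ : Bnd M h w₁ C φ) : ConvExists ψ φ ∧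
      ∃ f : Smooth d, (f : Rd d → ℂ) = conv ψ φ ∧ ∃ C', Bnd M h w₀ C' f := by
  obtain ⟨A, hA0, hA⟩ := exists_norm_le_of_mem_KSpace hψ κ
  have hC := hφ.nonneg
  have hle : ∀ y α x, ‖(ψ : Rd d → ℂ) y * (mderiv α φ : Rd d → ℂ) (x - y)‖ ≤
      (A * (C * (M.M (len α) / h ^ len α)) * c) * (w₀ x)⁻¹ * maj y := by
    intro y α x
    rw [norm_mul]
    have := M.pos (len α)
    exact hw.kernel_le hA0 (norm_nonneg _) (hA y) (by positivity) (hφ α (x - y))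
  have hm : ∀ α x, AEStronglyMeasurable
      (fun y => (ψ : Rd d → ℂ) y * (mderiv α φ : Rd d → ℂ) (x - y)) volume := fun α x =>
    ((contDiff_coe ψ).continuous.mul ((contDiff_coe (mderiv α φ)).continuous.comp
      (by fun_prop : Continuous fun y : Rd d => x - y))).aestronglyMeasurable
  refine ⟨fun x => ?_, ?_⟩
  · have h1 := (integrable_maj.const_mul _).mono' (hm 0 x) (ae_of_all _ fun y => hle y 0 x)
    rw [mderiv_zero] at h1
    exact h1
  · have hjet : IsMultiJet fun α x => ∫ y, (ψ : Rd d → ℂ) y * (mderiv α φ : Rd d → ℂ) (x - y) :=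
      IsMultiJet.integral_of_weight
        (G := fun y α x => (ψ : Rd d → ℂ) y * (mderiv α φ : Rd d → ℂ) (x - y))
        (fun y => ((isMultiJet_mderiv φ).comp_sub y).const_mul _) hm integrable_maj
        (fun y => (maj_pos y).le) w₀ hle
    obtain ⟨f, hf⟩ := hjet.exists_smooth
    refine ⟨f, ?_, A * C * c * ∫ y : Rd d, maj y, fun α x => ?_⟩
    · have := hf 0
      rw [mderiv_zero] at this
      rw [this]
      ext x
      rw [conv_eq, mderiv_zero]
    · rw [hf α]
      refine (norm_integral_le_of_norm_le (integrable_maj.const_mul _)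
        (ae_of_all _ fun y => hle y α x)).trans (le_of_eq ?_)
      rw [integral_const_mul]
      ring

theorem factorsThrough_of_singleton {K X : Set (Smooth d)}
    (h₁ : ∀ ψ ∈ K, ∀ φ ∈ X, ConvExists ψ φ ∧ ∃ f ∈ X, (f : Rd d → ℂ) = conv ψ φ)
    (h₂ : ∀ φ ∈ X, ∃ ψ ∈ K, ∃ A ⊆ X, ConvSetEq ψ A {φ}) : FactorsThrough K X := by
  refine ⟨fun ψ hψ φ hφ => (h₁ ψ hψ φ hφ).1, Set.Subset.antisymm ?_ ?_⟩
  · rintro _ ⟨ψ, hψ, φ, hφ, rfl⟩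
    exact (h₁ ψ hψ φ hφ).2
  · rintro _ ⟨φ, hφ, rfl⟩
    obtain ⟨ψ, hψ, A, hA, hAe⟩ := h₂ φ hφ
    have h3 : (φ : Rd d → ℂ) ∈ conv ψ '' A := by
      rw [hAe]
      exact ⟨φ, rfl, rfl⟩
    obtain ⟨f, hf, hfe⟩ := h3
    exact ⟨ψ, hψ, f, hA hf, hfe⟩

theorem exists_smooth_tens {ψ : ℕ → ℝ → ℂ} (hψ : IsJet ψ) :
    ∃ Ψ : Smooth d, ∀ α, (mderiv α Ψ : Rd d → ℂ) = tens ψ α :=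
  (isMultiJet_tens hψ).exists_smooth

theorem mem_KSpace_of_jetBound {h : PosReal} {ψ : ℕ → ℝ → ℂ} (hψ : M.JetBound h ψ)
    {Ψ : Smooth d} (hΨ : ∀ α, (mderiv α Ψ : Rd d → ℂ) = tens ψ α) : Ψ ∈ KSpace d M h := by
  refine mem_projSpace_iff.2 fun n => ?_
  obtain ⟨C, hC⟩ := hψ n n.cast_nonneg
  refine ⟨C ^ d, fun α x => ?_⟩
  have hC0 : 0 ≤ C := JBnd.nonneg hC
  rw [hΨ]
  refine (JBnd.tens_le hC h.2 α x).trans ?_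
  have hM := M.pos (len α)
  have hh := pow_pos h.2 (len α)
  refine mul_le_mul_of_nonneg_left ?_ (by positivity)
  change _ ≤ (Real.exp (n * ‖x‖))⁻¹
  rw [← Real.exp_neg, ← Real.exp_sum, ← Finset.mul_sum, Real.exp_le_exp]
  have h1 := norm_le_sum_abs x
  have h2 : (0 : ℝ) ≤ n := n.cast_nonneg
  nlinarith

end Ultra

namespace Ultra

variable {d : ℕ} {M : WeightSequence}

/-! ### The choice of the growth function -/

/-- Since t² ≤ M_2 `assoc` r, the polynomial factors only add to the power of `assoc`, which (M.2)
converts into a dilation. -/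
theorem WeightSequence.M2.assoc_pow_mul_le (hM : M.M2) (n p : ℕ) : ∃ C L : ℝ, 1 ≤ C ∧ 1 ≤ L ∧
    ∀ x t r, 0 ≤ x → 0 ≤ t → x ≤ r → t ≤ r →
      M.assoc x ^ n * (1 + t ^ 2) ^ p ≤ C * M.assoc (L * r) := by
  obtain ⟨C, L, hC, hL, h⟩ := hM.assoc_pow (n + p)
  have hM2 := M.pos 2
  refine ⟨(1 + M.M 2) ^ p * C, L, one_le_mul_of_one_le_of_one_le (one_le_pow₀ (by linarith)) hC, hL,
    fun x t r hx ht hxr htr => ?_⟩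
  have hr : 0 ≤ r := hx.trans hxr
  have h1 : M.assoc x ≤ M.assoc r := M.assoc_mono hx hxr
  have h2 : 1 + t ^ 2 ≤ (1 + M.M 2) * M.assoc r := by
    have e1 := M.pow_le_mul_assoc r 2
    have e2 := M.one_le_assoc r
    have e3 : t ^ 2 ≤ r ^ 2 := by gcongr
    nlinarith
  have hx0 := (M.assoc_pos x).le
  have hr0 := (M.assoc_pos r).le
  calc M.assoc x ^ n * (1 + t ^ 2) ^ p ≤ M.assoc r ^ n * ((1 + M.M 2) * M.assoc r) ^ p := by gcongr
    _ = (1 + M.M 2) ^ p * M.assoc r ^ (n + p) := by rw [mul_pow, pow_add]; ring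
    _ ≤ (1 + M.M 2) ^ p * (C * M.assoc (L * r)) := by
        have := h r hr
        gcongr
    _ = _ := by ring

theorem WeightSequence.M2.exists_scale (hM : M.M2) (n p : ℕ) {η : ℝ} (hη : 0 < η) :
    ∃ s, 0 < s ∧ s ≤ 1 ∧ ∃ D, 0 ≤ D ∧ ∀ t, 0 ≤ t →
      M.assoc (s * t) ^ n * (1 + t ^ 2) ^ p ≤ D * M.assoc (η * t) := by
  obtain ⟨C, L, hC, hL, h⟩ := hM.assoc_pow_mul_le n p
  -- The bound η/L compensates the dilation; s ≤ 1 is also what later gives st ≤ t(1 + t).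
  set s := min 1 (η / L) with hs
  have hL0 : 0 < L := by linarith
  have hs0 : 0 < s := lt_min one_pos (by positivity)
  have hs1 : s ≤ 1 := min_le_left _ _
  have hsL : L * s ≤ η := by
    have := min_le_right 1 (η / L)
    rw [le_div_iff₀ hL0] at this
    rw [hs]
    linarith
  refine ⟨s, hs0, hs1, (1 / s ^ 2) ^ p * C, by positivity, fun t ht => ?_⟩
  have hst : 0 ≤ s * t := by positivity
  have h1 := h (s * t) (s * t) (s * t) hst hst le_rfl le_rfl
  have h2 : 1 + t ^ 2 ≤ 1 / s ^ 2 * (1 + (s * t) ^ 2) := by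
    have e : 1 / s ^ 2 * (1 + (s * t) ^ 2) = 1 / s ^ 2 + t ^ 2 := by field_simp
    rw [e]
    have : 1 ≤ 1 / s ^ 2 := by
      rw [le_div_iff₀ (by positivity)]
      nlinarith
    linarith
  have h3 : M.assoc (L * (s * t)) ≤ M.assoc (η * t) := by
    refine M.assoc_mono (by positivity) ?_
    rw [← mul_assoc]
    gcongr
  have hx0 := (M.assoc_pos (s * t)).le
  calc M.assoc (s * t) ^ n * (1 + t ^ 2) ^ p
      ≤ M.assoc (s * t) ^ n * (1 / s ^ 2 * (1 + (s * t) ^ 2)) ^ p := by gcongr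
    _ = (1 / s ^ 2) ^ p * (M.assoc (s * t) ^ n * (1 + (s * t) ^ 2) ^ p) := by
        rw [mul_pow]; ring
    _ ≤ (1 / s ^ 2) ^ p * (C * M.assoc (η * t)) := by
        have := h1.trans (mul_le_mul_of_nonneg_left h3 (by linarith))
        gcongr
    _ = _ := by ring

theorem moderate_const_mul {s : ℝ} (hs : 0 < s) : Moderate fun t => s * t where
  nonneg t ht := by positivity
  mono := fun a _ b _ hab => by simpa using mul_le_mul_of_nonneg_left hab hs.le
  le_sq t ht l hl := by
    have : 0 ≤ s * t := by positivity
    nlinarith [mul_nonneg this (mul_nonneg (by linarith : 0 ≤ l) (by linarith : 0 ≤ l - 1))]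

/-- Functions tending to infinity slowly. -/
structure SlowFactor (f : ℝ → ℝ) : Prop where
  one_le : ∀ t, 0 ≤ t → 1 ≤ f t
  le_one_add : ∀ t, 0 ≤ t → f t ≤ 1 + t
  mono : MonotoneOn f (Set.Ici 0)
  mul_le : ∀ t, 0 ≤ t → ∀ l, 1 ≤ l → f (l * t) ≤ l * f t
  eventually_le : ∀ r : ℝ, ∃ t₀, 0 ≤ t₀ ∧ ∀ t, t₀ ≤ t → r ≤ f t

theorem SlowFactor.moderate {f : ℝ → ℝ} (hf : SlowFactor f) : Moderate fun t => t * f t where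
  nonneg t ht := mul_nonneg ht (zero_le_one.trans (hf.one_le t ht))
  mono := fun a ha b hb hab =>
    mul_le_mul hab (hf.mono ha hb hab) (zero_le_one.trans (hf.one_le a ha)) hb
  le_sq t ht l hl := by
    have h1 := mul_le_mul_of_nonneg_left (hf.mul_le t ht l hl)
      (mul_nonneg (zero_le_one.trans hl) ht)
    exact h1.trans (le_of_eq (by ring))

/-- The function f is the infimum of the affine functions j + 1 + t/S_j, where S_j exceeds the
constants C(H_i) for i ≤ j; monotonicity and f(lt) ≤ l f(t) pass to the infimum. For S_j ≤ t <
S_{j+1} one has f(t) ≤ j + 3, so the scale H_j ≥ |c|(j + 3) is both large enough and affordable. -/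
theorem exists_slowFactor (c : ℝ) (C : ℕ → ℝ) : ∃ f, SlowFactor f ∧
    ∀ n : ℕ, ∃ t₀ : ℝ, ∀ t, t₀ ≤ t → ∃ h : ℕ, n ≤ h ∧ c * f t ≤ h ∧ C h ≤ t := by
  set H : ℕ → ℕ := fun j => ⌈|c| * (j + 3)⌉₊ + j with hH
  set S : ℕ → ℝ := fun j => 1 + j + ∑ i ∈ Finset.range (j + 1), |C (H i)| with hS
  have hSmono : Monotone S := by
    intro i j hij
    have e1 : (i : ℝ) ≤ j := by exact_mod_cast hij
    have e2 : ∑ i ∈ Finset.range (i + 1), |C (H i)| ≤ ∑ i ∈ Finset.range (j + 1), |C (H i)| :=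
      Finset.sum_le_sum_of_subset_of_nonneg (Finset.range_mono (by omega))
        fun _ _ _ => abs_nonneg _
    simp only [hS]
    linarith
  have hSj : ∀ j : ℕ, 1 + (j : ℝ) ≤ S j := fun j => by
    have : 0 ≤ ∑ i ∈ Finset.range (j + 1), |C (H i)| := Finset.sum_nonneg fun _ _ => abs_nonneg _
    simp only [hS]
    linarith
  have hSC : ∀ j, C (H j) ≤ S j := fun j => by
    have e1 : |C (H j)| ≤ ∑ i ∈ Finset.range (j + 1), |C (H i)| :=
      Finset.single_le_sum (f := fun i => |C (H i)|) (fun _ _ => abs_nonneg _) (by simp)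
    have e2 := le_abs_self (C (H j))
    have e3 : (0 : ℝ) ≤ j := j.cast_nonneg
    simp only [hS]
    linarith
  have hS1 : ∀ j, 1 ≤ S j := fun j => by linarith [hSj j, (j.cast_nonneg : (0 : ℝ) ≤ j)]
  have hS0 : ∀ j, 0 < S j := fun j => zero_lt_one.trans_le (hS1 j)
  set f : ℝ → ℝ := fun t => ⨅ j : ℕ, ((j : ℝ) + 1 + t / S j) with hf
  have hb : ∀ t, 0 ≤ t → BddBelow (Set.range fun j : ℕ => ((j : ℝ) + 1 + t / S j)) := by
    intro t ht
    refine ⟨0, ?_⟩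
    rintro _ ⟨j, rfl⟩
    have := div_nonneg ht (hS0 j).le
    positivity
  have hle : ∀ t, 0 ≤ t → ∀ j : ℕ, f t ≤ (j : ℝ) + 1 + t / S j := fun t ht j => ciInf_le (hb t ht) j
  refine ⟨f, ⟨?_, ?_, ?_, ?_, ?_⟩, ?_⟩
  · intro t ht
    refine le_ciInf fun j => ?_
    have := div_nonneg ht (hS0 j).le
    have e3 : (0 : ℝ) ≤ j := j.cast_nonneg
    linarith
  · intro t ht
    refine (hle t ht 0).trans ?_
    have := div_le_self ht (hS1 0)
    simp only [Nat.cast_zero]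
    linarith
  · intro a ha b hb' hab
    refine le_ciInf fun j => (hle a ha j).trans ?_
    have := div_le_div_of_nonneg_right hab (hS0 j).le
    linarith
  · intro t ht l hl
    simp only [hf]
    rw [Real.mul_iInf_of_nonneg (by linarith)]
    refine le_ciInf fun j => (hle (l * t) (by positivity) j).trans ?_
    have e3 : (0 : ℝ) ≤ j := j.cast_nonneg
    rw [mul_add, mul_div_assoc]
    nlinarith
  · intro r
    obtain ⟨m, hm⟩ := exists_nat_ge r
    refine ⟨m * S m, mul_nonneg m.cast_nonneg (hS0 m).le, fun t ht => hm.trans (le_ciInf fun j => ?_)⟩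
    have ht0 : 0 ≤ t := (mul_nonneg m.cast_nonneg (hS0 m).le).trans ht
    rcases le_total m j with h | h
    · have e1 : (m : ℝ) ≤ j := by exact_mod_cast h
      have := div_nonneg ht0 (hS0 j).le
      linarith
    · have e1 : (m : ℝ) ≤ t / S j := by
        rw [le_div_iff₀ (hS0 j)]
        exact (mul_le_mul_of_nonneg_left (hSmono h) m.cast_nonneg).trans ht
      have e3 : (0 : ℝ) ≤ j := j.cast_nonneg
      linarith
  · intro n
    refine ⟨S n, fun t ht => ?_⟩
    have hex : ∃ j, t < S j := by
      obtain ⟨m, hm⟩ := exists_nat_ge t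
      exact ⟨m, by linarith [hSj m]⟩
    classical
    have h1 := Nat.find_spec hex
    have h2 : n < Nat.find hex := by
      by_contra! hlt
      exact absurd (h1.trans_le (hSmono hlt)) (not_lt.2 ht)
    obtain ⟨j, hj⟩ : ∃ j, Nat.find hex = j + 1 := ⟨Nat.find hex - 1, by omega⟩
    rw [hj] at h1 h2
    have h3 : S j ≤ t := not_lt.1 (Nat.find_min hex (by omega))
    have ht0 : 0 ≤ t := (hS0 n).le.trans ht
    refine ⟨H j, ?_, ?_, (hSC j).trans h3⟩
    · simp only [hH]
      omega
    · have e1 := hle t ht0 (j + 1)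
      have e2 : t / S (j + 1) ≤ 1 := (div_le_one (hS0 _)).2 h1.le
      have e3 : f t ≤ j + 3 := by
        push_cast at e1
        linarith
      have e4 : 0 ≤ f t := le_ciInf fun i => by
        have := div_nonneg ht0 (hS0 i).le
        positivity
      have e5 := Nat.le_ceil (|c| * ((j : ℝ) + 3))
      have e6 : (0 : ℝ) ≤ j := j.cast_nonneg
      have e7 : c * f t ≤ |c| * (j + 3) :=
        mul_le_mul (le_abs_self c) e3 e4 (abs_nonneg c)
      simp only [hH]
      push_cast
      linarith

theorem SlowFactor.exists_assoc_le {f : ℝ → ℝ} (hf : SlowFactor f) (r : ℝ) :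
    ∃ B, 0 ≤ B ∧ ∀ t, 0 ≤ t → M.assoc (r * t) ≤ B * M.assoc (t * f t) := by
  obtain ⟨t₀, h0, ht₀⟩ := hf.eventually_le |r|
  have hmono : ∀ t, 0 ≤ t → M.assoc (r * t) ≤ M.assoc (|r| * t) := by
    intro t ht
    refine ciSup_le fun p => ?_
    refine le_trans ?_ (M.div_le_assoc (|r| * t) p)
    refine div_le_div_of_nonneg_right ?_ (M.pos p).le
    rw [mul_pow, mul_pow, ← abs_pow]
    exact mul_le_mul_of_nonneg_right (le_abs_self _) (by positivity)
  refine ⟨M.assoc (|r| * t₀), (M.assoc_pos _).le, fun t ht => (hmono t ht).trans ?_⟩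
  have h1 := M.one_le_assoc (|r| * t₀)
  have h2 := M.one_le_assoc (t * f t)
  rcases le_total t₀ t with h | h
  · refine le_trans ?_ (le_mul_of_one_le_left (by linarith) h1)
    refine M.assoc_mono (by positivity) ?_
    rw [mul_comm]
    exact mul_le_mul_of_nonneg_left (ht₀ t h) ht
  · refine le_trans ?_ (le_mul_of_one_le_right (by linarith) h2)
    exact M.assoc_mono (by positivity) (by gcongr)

/-- As f tends to infinity, t f(t) overtakes every linear function; hence the resulting ψ has all
regularities. -/
theorem SlowFactor.dominates {f : ℝ → ℝ} (hf : SlowFactor f) (hM : M.M2) {h : ℝ} (hh : 0 < h) :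
    M.Dominates h fun t => M.assoc (t * f t) := by
  obtain ⟨C, L, hC, hL, hle⟩ := hM.assoc_pow_mul_le 2 2
  set r := max (4 * Real.pi * h) 1 with hr
  obtain ⟨B, hB0, hB⟩ := hf.exists_assoc_le (M := M) (L * r)
  refine ⟨C * B, fun t ht => ?_⟩
  have hpi := Real.pi_pos
  have h1 := hle (4 * Real.pi * h * t) t (r * t) (by positivity) ht
    (mul_le_mul_of_nonneg_right (le_max_left _ _) ht)
    (le_mul_of_one_le_left ht (le_max_right _ _))
  rw [mul_pow, mul_assoc C]
  refine h1.trans (mul_le_mul_of_nonneg_left ?_ (by linarith))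
  rw [← mul_assoc]
  exact hB t ht

end Ultra

namespace Ultra

variable {d : ℕ} {M : WeightSequence}

/-! ### Deconvolution of bounded sets -/

/-- Moderate growth of `w₀` relative to `w₁`. -/
def Ctrl (w₀ w₁ : Weight d) : Prop := ∃ κ c, Dom w₀ w₁ κ c

theorem tame_of_bnd {g : ℕ → ℝ → ℂ} {θ : ℝ → ℝ} {A : ℕ} {H D h C Cg κ : ℝ} {w : Weight d}
    {φ : Smooth d} (hD : ∀ t, 0 ≤ t →
      M.assoc (θ t) ^ (A * d) * (1 + t ^ 2) ^ (2 * d) ≤ D * M.assoc (h / H * t))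
    (hg : JBnd M h (κ + 2) Cg g) (hφ : Bnd M h w C φ) :
    Tame M g θ A H h (C * Cg ^ d * D) κ w φ := by
  intro τ hτ
  refine ⟨h, C, Cg, le_rfl, hφ, hg, ?_⟩
  have h1 : 0 ≤ C * Cg ^ d := mul_nonneg hφ.nonneg (pow_nonneg hg.nonneg d)
  have h2 := mul_le_mul_of_nonneg_left (hD τ hτ) h1
  linarith

/-- A single scale h serves for all frequencies, and θ is linear. The slope s is so small that the
kernel growth fits below `assoc` at h/H; then a smaller s' fixes the regularity s'/(4π) of ψ. -/
theorem exists_deconv_roumieu (d : ℕ) (hM : M.M2) (hM' : M.M2star) (h : PosReal) :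
    ∃ Ψ ∈ KRoumieu d M, ∃ (T : Smooth d → Smooth d) (k : PosReal),
      (∀ φ C (w w₀ w₁ w₂ : Weight d), Ctrl w w₀ → Ctrl w₀ w₁ → Ctrl w₁ w₂ → Bnd M h w₂ C φ →
        conv Ψ (T φ) = (φ : Rd d → ℂ)) ∧
      ∀ (w₀ w₁ w₂ : Weight d), Ctrl w₀ w₁ → Ctrl w₁ w₂ → ∀ C, ∃ C', ∀ φ, Bnd M h w₂ C φ →
        Bnd M k w₀ C' (T φ) := by
  obtain ⟨g, A, hg, hgb, hg0, H₀⟩ := M.exists_kernels hM hM'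
  obtain ⟨C₀, H, hC₀, hH, hMM, -⟩ := hM.assoc_sq
  have hHp : 0 < H := by linarith
  obtain ⟨s, hs0, hs1, D, hD0, hD⟩ := hM.exists_scale (A * d) (2 * d)
    (div_pos h.2 hHp : (0 : ℝ) < h / H)
  obtain ⟨s', hs0', -, D', -, hD'⟩ := hM.exists_scale 2 2 hs0
  have hpi := Real.pi_pos
  obtain ⟨r, hdom⟩ : ∃ r : PosReal, M.Dominates r fun t => M.assoc (s * t) := by
    refine ⟨⟨s' / (4 * Real.pi), by positivity⟩, D', fun t ht => ?_⟩
    rw [mul_pow, show 4 * Real.pi * (s' / (4 * Real.pi)) * t = s' * t by field_simp]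
    exact hD' t ht
  obtain ⟨ψ, k, hψ, hψb, hk, hkb, hconv⟩ := H₀ (fun t => s * t) (moderate_const_mul hs0)
    (fun t ht => by nlinarith [mul_nonneg ht ht, mul_nonneg ht (sub_nonneg.2 hs1)]) ⟨r, r.2, hdom⟩
  obtain ⟨Ψ, hΨ⟩ := exists_smooth_tens (d := d) hψ
  have hdec : Deconvolver M g A (fun t => s * t) ψ k :=
    ⟨hg, hgb, hg0, moderate_const_mul hs0, hψ, ⟨r, r.2, hψb _ r.2 hdom⟩, hk, hkb, hconv⟩
  have hΨ0 : (Ψ : Rd d → ℂ) = tens ψ 0 := by rw [← hΨ 0, mderiv_zero]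
  obtain ⟨T, hT, hTb⟩ := hdec.exists_deconv hC₀ hH hMM hΨ0
  have tame : ∀ κ, 0 ≤ κ → ∀ C, ∃ D₁, ∀ (w : Weight d) φ, Bnd M h w C φ →
      Tame M g (fun t => s * t) A H h D₁ κ w φ := by
    intro κ hκ C
    obtain ⟨Cg, hCg⟩ := hgb h h.2 (κ + 2) (by linarith)
    exact ⟨C * Cg ^ d * D, fun w φ hφ => tame_of_bnd hD hCg hφ⟩
  have hK : Ψ ∈ KSpace d M r := mem_KSpace_of_jetBound (hψb _ r.2 hdom) hΨ
  refine ⟨Ψ, ⟨r, hK⟩, T,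
    ⟨h / H, div_pos h.2 hHp⟩, ?_, ?_⟩
  · rintro φ C w w₀ w₁ w₂ ⟨κ, c, h0⟩ ⟨κ₀, c₀, h1⟩ ⟨κ₁, c₁, h2⟩ hφ
    obtain ⟨D₁, hD₁⟩ := tame κ₁ h2.nonneg C
    exact hT φ ⟨w, w₀, w₁, w₂, κ, c, κ₀, c₀, κ₁, c₁, h, D₁, h0, h1, h2, h.2, hD₁ w₂ φ hφ⟩
  · rintro w₀ w₁ w₂ ⟨κ₀, c₀, h1⟩ ⟨κ₁, c₁, h2⟩ C
    obtain ⟨D₁, hD₁⟩ := tame κ₁ h2.nonneg C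
    obtain ⟨B, hB⟩ := hTb w₀ w₁ w₂ κ₀ c₀ κ₁ c₁ h1 h2
    exact ⟨B * D₁, fun φ hφ => hB φ h D₁ h.2 (hD₁ w₂ φ hφ)⟩

/-- The numbers C h bound the set at every scale. At frequency τ a scale h is used that exceeds a
multiple of f(τ) although its constant is at most τ; this makes all elements tame while t f(t) is
superlinear. -/
theorem exists_deconv_beurling (hM : M.M2) (hM' : M.M2star) (u : ℕ → Weight d) (C : ℕ → ℝ) :
    ∃ Ψ ∈ KBeurling d M, ∃ T : Smooth d → Smooth d,
      (∀ φ, (∀ h : ℕ, 0 < h → Bnd M h (u h) (C h) φ) → ∀ (w w₀ w₁ w₂ : Weight d),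
        Ctrl w w₀ → Ctrl w₀ w₁ → Ctrl w₁ w₂ → (∃ N, ∀ h, N ≤ h → ∀ x, w₂ x ≤ u h x) →
        conv Ψ (T φ) = (φ : Rd d → ℂ)) ∧
      ∀ (w₀ w₁ w₂ : Weight d), Ctrl w₀ w₁ → Ctrl w₁ w₂ → (∃ N, ∀ h, N ≤ h → ∀ x, w₂ x ≤ u h x) →
        ∀ k : PosReal, ∃ C', ∀ φ, (∀ h : ℕ, 0 < h → Bnd M h (u h) (C h) φ) →
          Bnd M k w₀ C' (T φ) := by
  obtain ⟨g, A, hg, hgb, hg0, H₀⟩ := M.exists_kernels hM hM'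
  obtain ⟨C₀, H, hC₀, hH, hMM, hsq⟩ := hM.assoc_sq
  have hHp : 0 < H := by linarith
  obtain ⟨C₁, L, hC₁, hL, hle⟩ := hM.assoc_pow_mul_le (A * d) (2 * d)
  -- The integer h is both regularity and decay rate, leaving one constant per scale; h ≥ κ + 2
  -- provides the decay needed for κ.
  have hgc : ∀ h : ℕ, ∃ Cg, 0 < h → JBnd M h h Cg g := by
    intro h
    rcases Nat.eq_zero_or_pos h with rfl | hh
    · exact ⟨0, fun h => absurd h (lt_irrefl 0)⟩
    · obtain ⟨Cg, hCg⟩ := hgb h (by exact_mod_cast hh) h h.cast_nonneg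
      exact ⟨Cg, fun _ => hCg⟩
  choose Cg hCg using hgc
  -- In the multiplier, L comes from powers of `assoc`, one H from squaring `assoc`, and the other H
  -- from the quotient h/H in `Tame`.
  obtain ⟨f, hf, hf'⟩ := exists_slowFactor (H * (H * L)) fun h => C h * Cg h ^ d
  have hdom : ∀ h, 0 < h → M.Dominates h fun t => M.assoc (t * f t) :=
    fun h hh => hf.dominates hM hh
  obtain ⟨ψ, k, hψ, hψb, hk, hkb, hconv⟩ := H₀ (fun t => t * f t) hf.moderate
    (fun t ht => mul_le_mul_of_nonneg_left (hf.le_one_add t ht) ht) ⟨1, one_pos, hdom 1 one_pos⟩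
  obtain ⟨Ψ, hΨ⟩ := exists_smooth_tens (d := d) hψ
  have hdec : Deconvolver M g A (fun t => t * f t) ψ k :=
    ⟨hg, hgb, hg0, hf.moderate, hψ, ⟨1, one_pos, hψb _ one_pos (hdom 1 one_pos)⟩, hk, hkb, hconv⟩
  have hΨ0 : (Ψ : Rd d → ℂ) = tens ψ 0 := by rw [← hΨ 0, mderiv_zero]
  obtain ⟨T, hT, hTb⟩ := hdec.exists_deconv hC₀ hH hMM hΨ0
  have tame : ∀ (h₀ κ : ℝ) (N : ℕ), ∃ D, ∀ (w : Weight d) φ, (∀ h, N ≤ h → ∀ x, w x ≤ u h x) →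
      (∀ h : ℕ, 0 < h → Bnd M h (u h) (C h) φ) →
      Tame M g (fun t => t * f t) A H h₀ D κ w φ := by
    intro h₀ κ N
    obtain ⟨n, hn⟩ := exists_nat_ge (max h₀ (κ + 2))
    -- From n' on, scales are positive, exceed h₀ and κ + 2, and have weights dominating w.
    set n' := max (n + 1) N with hn'
    obtain ⟨t₀, ht₀⟩ := hf' n'
    set t₁ := max t₀ 0 with ht₁
    have hB0 := hf.one_le t₁ (le_max_right _ _)
    refine ⟨C₁ * C₀ + |C n' * Cg n' ^ d| * (C₁ * M.assoc (L * (t₁ * f t₁))), fun w φ hw hφ τ hτ => ?_⟩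
    have hτf := hf.one_le τ hτ
    have hτ1 : τ ≤ τ * f τ := le_mul_of_one_le_right hτ hτf
    have hτ0 : 0 ≤ τ * f τ := hτ.trans hτ1
    have h1 := hle (τ * f τ) τ (τ * f τ) hτ0 hτ le_rfl hτ1
    have hgood : ∀ h : ℕ, n' ≤ h → h₀ ≤ h ∧ Bnd M h w (C h) φ ∧ JBnd M h (κ + 2) (Cg h) g := by
      intro h hh
      have e1 : n + 1 ≤ h := (le_max_left _ _).trans hh
      have e2 : (n : ℝ) ≤ h := by exact_mod_cast (by omega : n ≤ h)
      have e3 : 0 < h := by omega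
      have e4 : (0 : ℝ) < h := by exact_mod_cast e3
      exact ⟨(le_max_left _ _).trans (hn.trans e2),
        Bnd.mono (h := ⟨h, e4⟩) (k := ⟨h, e4⟩) (hφ h e3) le_rfl (hw h ((le_max_right _ _).trans hh)),
        (hCg h e3).mono e4 ((le_max_right _ _).trans (hn.trans e2))⟩
    have hQ : 0 ≤ |C n' * Cg n' ^ d| * (C₁ * M.assoc (L * (t₁ * f t₁))) := by
      have := M.assoc_pos (L * (t₁ * f t₁))
      positivity
    have hP : 0 ≤ C₁ * C₀ := by positivity
    have hEL := M.assoc_pos (L * (τ * f τ))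
    have hEτ := M.assoc_pos (τ * f τ)
    rcases le_total t₁ τ with hc | hc
    · obtain ⟨h, hh, hcf, hCh⟩ := ht₀ τ ((le_max_left _ _).trans hc)
      obtain ⟨g1, g2, g3⟩ := hgood h hh
      refine ⟨h, C h, Cg h, g1, g2, g3, ?_⟩
      have hChn : 0 ≤ C h * Cg h ^ d := mul_nonneg g2.nonneg (pow_nonneg g3.nonneg d)
      have h2 : C h * Cg h ^ d ≤ M.assoc (L * (τ * f τ)) :=
        hCh.trans ((hτ1.trans (le_mul_of_one_le_left hτ0 hL)).trans (M.self_le_assoc _))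
      have h3 : M.assoc (H * (L * (τ * f τ))) ≤ M.assoc (h / H * τ) := by
        refine M.assoc_mono (by positivity) ?_
        have e : H * (L * (τ * f τ)) = H * (H * L) * f τ / H * τ := by field_simp
        rw [e]
        gcongr
      have hEh := M.assoc_pos ((h : ℝ) / H * τ)
      calc C h * Cg h ^ d * M.assoc (τ * f τ) ^ (A * d) * (1 + τ ^ 2) ^ (2 * d)
          = C h * Cg h ^ d * (M.assoc (τ * f τ) ^ (A * d) * (1 + τ ^ 2) ^ (2 * d)) := by ring
        _ ≤ M.assoc (L * (τ * f τ)) * (C₁ * M.assoc (L * (τ * f τ))) := by gcongr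
        _ = C₁ * M.assoc (L * (τ * f τ)) ^ 2 := by ring
        _ ≤ C₁ * (C₀ * M.assoc (h / H * τ)) := by
            have := (hsq _ (by positivity : 0 ≤ L * (τ * f τ))).trans
              (mul_le_mul_of_nonneg_left h3 (by linarith))
            gcongr
        _ ≤ _ := by
            rw [← mul_assoc]
            exact mul_le_mul_of_nonneg_right (by linarith) hEh.le
    -- Below the threshold t₁ the fixed scale n' suffices, since the kernel growth is bounded by its
    -- value at t₁.
    · obtain ⟨g1, g2, g3⟩ := hgood n' le_rfl
      refine ⟨n', C n', Cg n', g1, g2, g3, ?_⟩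
      have hChn : 0 ≤ C n' * Cg n' ^ d := mul_nonneg g2.nonneg (pow_nonneg g3.nonneg d)
      have h3 : M.assoc (L * (τ * f τ)) ≤ M.assoc (L * (t₁ * f t₁)) := by
        refine M.assoc_mono (by positivity) (mul_le_mul_of_nonneg_left ?_ (by linarith))
        exact mul_le_mul hc (hf.mono hτ (Set.mem_Ici.2 (le_max_right _ _)) hc) (by linarith) (le_max_right _ _)
      have hEh := M.one_le_assoc ((n' : ℝ) / H * τ)
      calc C n' * Cg n' ^ d * M.assoc (τ * f τ) ^ (A * d) * (1 + τ ^ 2) ^ (2 * d)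
          = C n' * Cg n' ^ d * (M.assoc (τ * f τ) ^ (A * d) * (1 + τ ^ 2) ^ (2 * d)) := by ring
        _ ≤ C n' * Cg n' ^ d * (C₁ * M.assoc (L * (t₁ * f t₁))) := by
            have := h1.trans (mul_le_mul_of_nonneg_left h3 (by linarith))
            gcongr
        _ ≤ |C n' * Cg n' ^ d| * (C₁ * M.assoc (L * (t₁ * f t₁))) :=
            mul_le_mul_of_nonneg_right (le_abs_self _)
              (mul_nonneg (by linarith) (M.assoc_pos _).le)
        _ ≤ C₁ * C₀ + |C n' * Cg n' ^ d| * (C₁ * M.assoc (L * (t₁ * f t₁))) := by linarith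
        _ ≤ _ := le_mul_of_one_le_right (by linarith) hEh
  refine ⟨Ψ, fun h => mem_KSpace_of_jetBound (hψb h h.2 (hdom h h.2)) hΨ, T, ?_, ?_⟩
  · rintro φ hφ w w₀ w₁ w₂ ⟨κ, c, h0⟩ ⟨κ₀, c₀, h1⟩ ⟨κ₁, c₁, h2⟩ ⟨N, hN⟩
    obtain ⟨D₁, hD₁⟩ := tame 1 κ₁ N
    exact hT φ ⟨w, w₀, w₁, w₂, κ, c, κ₀, c₀, κ₁, c₁, 1, D₁, h0, h1, h2, one_pos, hD₁ w₂ φ hN hφ⟩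
  · rintro w₀ w₁ w₂ ⟨κ₀, c₀, h1⟩ ⟨κ₁, c₁, h2⟩ ⟨N, hN⟩ k
    obtain ⟨D₁, hD₁⟩ := tame (k * H) κ₁ N
    obtain ⟨B, hB⟩ := hTb w₀ w₁ w₂ κ₀ c₀ κ₁ c₁ h1 h2
    refine ⟨B * D₁, fun φ hφ => ?_⟩
    have := hB φ (k * H) D₁ (mul_pos k.2 hHp) (hD₁ w₂ φ hN hφ)
    rwa [mul_div_cancel_right₀ _ hHp.ne'] at this

theorem IncreasingWeightSystem.exists_ctrl (W : IncreasingWeightSystem d) (n : ℕ) :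
    ∃ m, n ≤ m ∧ Ctrl (W.w n) (W.w m) := by
  obtain ⟨m, hm, κ, c, hκ, hc, h⟩ := W.exp_bdd n
  exact ⟨m, hm, κ, c, hκ.le, hc, h⟩

theorem DecreasingWeightSystem.exists_ctrl (V : DecreasingWeightSystem d) (n : ℕ) :
    ∃ m, n ≤ m ∧ Ctrl (V.v m) (V.v n) := by
  obtain ⟨m, hm, κ, c, hκ, hc, h⟩ := V.exp_bdd n
  exact ⟨m, hm, κ, c, hκ.le, hc, h⟩

theorem convSetEq_image {Ψ : Smooth d} {T : Smooth d → Smooth d} {B : Set (Smooth d)}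
    (h : ∀ φ ∈ B, conv Ψ (T φ) = (φ : Rd d → ℂ)) : ConvSetEq Ψ (T '' B) B := by
  rw [ConvSetEq, Set.image_image]
  exact Set.image_congr h

/-! ### Factorization -/

theorem exists_conv_mem_projSpace {ι : Type} [Nonempty ι] {h : ι → PosReal} {w : ι → Weight d}
    {k : PosReal} {ψ φ : Smooth d} (hψ : ψ ∈ KSpace d M k)
    (hφ : ∀ i, ∃ w₁ C, Ctrl (w i) w₁ ∧ Bnd M (h i) w₁ C φ) :
    ConvExists ψ φ ∧ ∃ f ∈ projSpace M h w, (f : Rd d → ℂ) = conv ψ φ := by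
  have key : ∀ i, ConvExists ψ φ ∧
      ∃ f : Smooth d, (f : Rd d → ℂ) = conv ψ φ ∧ ∃ C', Bnd M (h i) (w i) C' f := by
    intro i
    obtain ⟨w₁, C, ⟨κ, c, hw⟩, hb⟩ := hφ i
    exact convExists_and_exists_bnd hψ hw (h i).2 hb
  obtain ⟨he, f, hf, -⟩ := key (Classical.arbitrary ι)
  refine ⟨he, f, mem_projSpace_iff.2 fun i => ?_, hf⟩
  obtain ⟨-, f', hf', C, hC⟩ := key i
  obtain rfl : f' = f := Subtype.ext (hf'.trans hf.symm)
  exact ⟨C, hC⟩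

theorem BoundedIn.exists_conv_BWBeurling (hM : M.M2) (hM' : M.M2star)
    {W : IncreasingWeightSystem d} {B : Set (Smooth d)}
    (hB : BoundedIn (BWBeurling M W) (BWBeurlingTop M W) B) : ∃ ψ ∈ KBeurling d M, ∃ A,
      BoundedIn (BWBeurling M W) (BWBeurlingTop M W) A ∧ ConvSetEq ψ A B := by
  have h1 : ∀ h : ℕ, ∃ C, ∀ φ ∈ B, 0 < h → Bnd M h (W.w h) C φ := by
    intro h
    rcases Nat.eq_zero_or_pos h with rfl | hh
    · exact ⟨0, fun _ _ h => absurd h (lt_irrefl 0)⟩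
    · obtain ⟨C, hC⟩ := boundedIn_projSpace_iff.1 hB ⟨h, hh⟩
      exact ⟨C, fun φ hφ _ => hC φ hφ⟩
  choose C hC using h1
  obtain ⟨Ψ, hΨ, T, hT, hTb⟩ := exists_deconv_beurling hM hM' W.w C
  refine ⟨Ψ, hΨ, T '' B, boundedIn_projSpace_iff.2 fun i => ?_, convSetEq_image fun φ hφ => ?_⟩
  · obtain ⟨m₁, -, h1⟩ := W.exists_ctrl i
    obtain ⟨m₂, -, h2⟩ := W.exists_ctrl m₁
    obtain ⟨C', hC'⟩ := hTb _ _ _ h1 h2 ⟨m₂, fun h hh => W.mono _ _ hh⟩ (posNat i)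
    refine ⟨C', ?_⟩
    rintro _ ⟨φ, hφ, rfl⟩
    exact hC' φ fun h hh => hC h φ hφ hh
  -- The identity needs some chain of three comparisons, one more than the bound; the initial index
  -- is immaterial.
  · obtain ⟨m₁, -, h1⟩ := W.exists_ctrl 0
    obtain ⟨m₂, -, h2⟩ := W.exists_ctrl m₁
    obtain ⟨m₃, -, h3⟩ := W.exists_ctrl m₂
    exact hT φ (fun h hh => hC h φ hφ hh) _ _ _ _ h1 h2 h3 ⟨m₃, fun h hh => W.mono _ _ hh⟩

theorem BoundedIn.exists_conv_BWStep (hM : M.M2) (hM' : M.M2star)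
    {W : IncreasingWeightSystem d} {h : PosReal} {B : Set (Smooth d)}
    (hB : BoundedIn (BWStep M W h) (BWStepTop M W h) B) :
    ∃ ψ ∈ KRoumieu d M, ∃ (k : PosReal) (A : Set (Smooth d)),
      BoundedIn (BWStep M W k) (BWStepTop M W k) A ∧ ConvSetEq ψ A B := by
  have h0 := boundedIn_projSpace_iff.1 hB
  obtain ⟨Ψ, hΨ, T, k, hT, hTb⟩ := exists_deconv_roumieu d hM hM' h
  refine ⟨Ψ, hΨ, k, T '' B, boundedIn_projSpace_iff.2 fun i => ?_, convSetEq_image fun φ hφ => ?_⟩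
  · obtain ⟨m₁, -, h1⟩ := W.exists_ctrl i
    obtain ⟨m₂, -, h2⟩ := W.exists_ctrl m₁
    obtain ⟨C, hC⟩ := h0 m₂
    obtain ⟨C', hC'⟩ := hTb _ _ _ h1 h2 C
    refine ⟨C', ?_⟩
    rintro _ ⟨φ, hφ, rfl⟩
    exact hC' φ (hC φ hφ)
  · obtain ⟨m₁, -, h1⟩ := W.exists_ctrl 0
    obtain ⟨m₂, -, h2⟩ := W.exists_ctrl m₁
    obtain ⟨m₃, -, h3⟩ := W.exists_ctrl m₂
    obtain ⟨C, hC⟩ := h0 m₃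
    exact hT φ C _ _ _ _ h1 h2 h3 (hC φ hφ)

theorem BoundedIn.exists_conv_BVStep (hM : M.M2) (hM' : M.M2star)
    {V : DecreasingWeightSystem d} {n : ℕ} {B : Set (Smooth d)}
    (hB : BoundedIn (BVStep M (V.v n)) (BVStepTop M (V.v n)) B) :
    ∃ ψ ∈ KBeurling d M, ∃ (m : ℕ) (A : Set (Smooth d)),
      BoundedIn (BVStep M (V.v m)) (BVStepTop M (V.v m)) A ∧ ConvSetEq ψ A B := by
  have : Nonempty PosReal := ⟨⟨1, one_pos⟩⟩
  have h1 : ∀ h : ℕ, ∃ C, ∀ φ ∈ B, 0 < h → Bnd M h (V.v n) C φ := by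
    intro h
    rcases Nat.eq_zero_or_pos h with rfl | hh
    · exact ⟨0, fun _ _ h => absurd h (lt_irrefl 0)⟩
    · obtain ⟨C, hC⟩ := boundedIn_projSpace_iff.1 hB ⟨h, by exact_mod_cast hh⟩
      exact ⟨C, fun φ hφ _ => hC φ hφ⟩
  choose C hC using h1
  obtain ⟨Ψ, hΨ, T, hT, hTb⟩ := exists_deconv_beurling hM hM' (fun _ => V.v n) C
  -- For decreasing weights the chain descends from v_n: two comparisons place A in the step m₂, and
  -- m₃ serves only for the convolution with ψ.
  obtain ⟨m₁, -, h1⟩ := V.exists_ctrl n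
  obtain ⟨m₂, -, h2⟩ := V.exists_ctrl m₁
  obtain ⟨m₃, -, h3⟩ := V.exists_ctrl m₂
  refine ⟨Ψ, hΨ, m₂, T '' B, boundedIn_projSpace_iff.2 fun k => ?_,
    convSetEq_image fun φ hφ => ?_⟩
  · obtain ⟨C', hC'⟩ := hTb _ _ _ h2 h1 ⟨0, fun _ _ _ => le_rfl⟩ k
    refine ⟨C', ?_⟩
    rintro _ ⟨φ, hφ, rfl⟩
    exact hC' φ fun h hh => hC h φ hφ hh
  · exact hT φ (fun h hh => hC h φ hφ hh) _ _ _ _ h3 h2 h1 ⟨0, fun _ _ _ => le_rfl⟩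

theorem exists_conv_of_bnd (hM : M.M2) (hM' : M.M2star) {V : DecreasingWeightSystem d}
    {B : Set (Smooth d)} {n : ℕ+} {C : ℝ} (hB : ∀ φ ∈ B, Bnd M (posInv n) (V.v n) C φ) :
    ∃ ψ ∈ KRoumieu d M, ∃ A,
      BoundedIn (BVRoumieu M V) (BVRoumieuTop M V) A ∧ ConvSetEq ψ A B := by
  obtain ⟨Ψ, hΨ, T, k, hT, hTb⟩ := exists_deconv_roumieu d hM hM' (posInv n)
  obtain ⟨m₁, -, h1⟩ := V.exists_ctrl n
  obtain ⟨m₂, -, h2⟩ := V.exists_ctrl m₁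
  obtain ⟨m₃, -, h3⟩ := V.exists_ctrl m₂
  refine ⟨Ψ, hΨ, T '' B, ?_, convSetEq_image fun φ hφ => hT φ C _ _ _ _ h3 h2 h1 (hB φ hφ)⟩
  obtain ⟨C', hC'⟩ := hTb _ _ _ h2 h1 C
  -- One index must encode both the weight and the regularity: beyond m₂ the weights are smaller,
  -- and beyond 1/k the regularity 1/n is at most k.
  obtain ⟨N, hN⟩ := exists_nat_ge (1 / (k : ℝ))
  have hm : m₂ ≤ (max m₂ N).succPNat := (le_max_left _ _).trans (Nat.le_succ _)
  refine boundedIn_BVRoumieu_of_bnd (n := (max m₂ N).succPNat) (C := C') ?_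
  rintro _ ⟨φ, hφ, rfl⟩
  refine (hC' φ (hB φ hφ)).mono ?_ (V.anti _ _ hm)
  have h5 : (N : ℝ) ≤ ((max m₂ N).succPNat : ℕ) :=
    Nat.cast_le.2 ((le_max_right _ _).trans (Nat.le_succ _))
  exact (one_div_le k.2 (posNat _).2).1 (hN.trans h5)

theorem factorsThrough_BWBeurling (hM : M.M2) (hM' : M.M2star) (W : IncreasingWeightSystem d) :
    FactorsThrough (KBeurling d M) (BWBeurling M W) := by
  refine factorsThrough_of_singleton (fun ψ hψ φ hφ =>
    exists_conv_mem_projSpace (hψ ⟨1, one_pos⟩) fun i => ?_) fun φ hφ => ?_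
  · obtain ⟨m, hm, h⟩ := W.exists_ctrl i
    obtain ⟨C, hC⟩ := mem_projSpace_iff.1 hφ ⟨m, i.pos.trans_le hm⟩
    exact ⟨W.w m, C, h, hC.mono (Nat.cast_le.2 hm) fun _ => le_rfl⟩
  · obtain ⟨ψ, hψ, A, hA, hAe⟩ := (boundedIn_singleton_projSpace hφ).exists_conv_BWBeurling hM hM'
    exact ⟨ψ, hψ, A, hA.1, hAe⟩

theorem factorsThrough_BWRoumieu (hM : M.M2) (hM' : M.M2star) (W : IncreasingWeightSystem d) :
    FactorsThrough (KRoumieu d M) (BWRoumieu M W) := by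
  refine factorsThrough_of_singleton ?_ ?_
  · rintro ψ ⟨k, hψ⟩ φ ⟨h, hφ⟩
    obtain ⟨he, f, hf, hfe⟩ := exists_conv_mem_projSpace (h := fun _ : ℕ => h) (w := W.w) hψ
      fun i => by
        obtain ⟨m, hm, hc⟩ := W.exists_ctrl i
        obtain ⟨C, hC⟩ := mem_projSpace_iff.1 hφ m
        exact ⟨W.w m, C, hc, hC⟩
    exact ⟨he, f, ⟨h, hf⟩, hfe⟩
  · rintro φ ⟨h, hφ⟩
    obtain ⟨ψ, hψ, k, A, hA, hAe⟩ := (boundedIn_singleton_projSpace hφ).exists_conv_BWStep hM hM'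
    exact ⟨ψ, hψ, A, fun f hf => ⟨k, hA.1 hf⟩, hAe⟩

theorem factorsThrough_BVBeurling (hM : M.M2) (hM' : M.M2star) (V : DecreasingWeightSystem d) :
    FactorsThrough (KBeurling d M) (BVBeurling M V) := by
  have : Nonempty PosReal := ⟨⟨1, one_pos⟩⟩
  refine factorsThrough_of_singleton ?_ ?_
  · rintro ψ hψ φ ⟨n, hφ⟩
    obtain ⟨m, hm, hc⟩ := V.exists_ctrl n
    obtain ⟨he, f, hf, hfe⟩ := exists_conv_mem_projSpace (h := fun h : PosReal => h)
      (w := fun _ => V.v m) (hψ ⟨1, one_pos⟩) fun h => by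
        obtain ⟨C, hC⟩ := mem_projSpace_iff.1 hφ h
        exact ⟨V.v n, C, hc, hC⟩
    exact ⟨he, f, ⟨m, hf⟩, hfe⟩
  · rintro φ ⟨n, hφ⟩
    obtain ⟨ψ, hψ, m, A, hA, hAe⟩ := (boundedIn_singleton_projSpace hφ).exists_conv_BVStep hM hM'
    exact ⟨ψ, hψ, A, fun f hf => ⟨m, hA.1 hf⟩, hAe⟩

theorem factorsThrough_BVRoumieu (hM : M.M2) (hM' : M.M2star) (V : DecreasingWeightSystem d) :
    FactorsThrough (KRoumieu d M) (BVRoumieu M V) := by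
  refine factorsThrough_of_singleton ?_ ?_
  · rintro ψ ⟨k, hψ⟩ φ ⟨n, hφ⟩
    obtain ⟨m, hm, κ, c, hc⟩ := V.exists_ctrl n
    obtain ⟨C, hC⟩ := mem_BSpace_iff.1 hφ
    obtain ⟨he, f, hf, C', hC'⟩ := convExists_and_exists_bnd hψ hc (posInv n).2 hC
    refine ⟨he, f, ⟨⟨m, n.pos.trans_le hm⟩, (hC'.mono ?_ fun _ => le_rfl).mem⟩, hf⟩
    exact one_div_le_one_div_of_le (posNat n).2 (Nat.cast_le.2 hm)
  · rintro φ ⟨n, hφ⟩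
    obtain ⟨C, hC⟩ := mem_BSpace_iff.1 hφ
    obtain ⟨ψ, hψ, A, hA, hAe⟩ := exists_conv_of_bnd (B := {φ}) (n := n) hM hM'
      fun χ hχ => (Set.mem_singleton_iff.1 hχ).symm ▸ hC
    exact ⟨ψ, hψ, A, hA.1, hAe⟩

end Ultra

end

theorem mainTheorem2 (d : ℕ) (M : Ultra.WeightSequence) (hM : M.M2) (hM' : M.M2star) :
    (∀ W : Ultra.IncreasingWeightSystem d,
      Ultra.FactorsThrough (Ultra.KBeurling d M) (Ultra.BWBeurling M W) ∧
      Ultra.FactorsThrough (Ultra.KRoumieu d M) (Ultra.BWRoumieu M W) ∧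
      (∀ B, Ultra.BoundedIn (Ultra.BWBeurling M W) (Ultra.BWBeurlingTop M W) B →
        ∃ ψ ∈ Ultra.KBeurling d M, ∃ A,
          Ultra.BoundedIn (Ultra.BWBeurling M W) (Ultra.BWBeurlingTop M W) A ∧
          Ultra.ConvSetEq ψ A B) ∧
      (∀ (h : Ultra.PosReal) (B : Set (Ultra.Smooth d)),
        Ultra.BoundedIn (Ultra.BWStep M W h) (Ultra.BWStepTop M W h) B →
        ∃ ψ ∈ Ultra.KRoumieu d M, ∃ (k : Ultra.PosReal) (A : Set (Ultra.Smooth d)),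
          Ultra.BoundedIn (Ultra.BWStep M W k) (Ultra.BWStepTop M W k) A ∧
          Ultra.ConvSetEq ψ A B)) ∧
    (∀ V : Ultra.DecreasingWeightSystem d,
      Ultra.FactorsThrough (Ultra.KBeurling d M) (Ultra.BVBeurling M V) ∧
      Ultra.FactorsThrough (Ultra.KRoumieu d M) (Ultra.BVRoumieu M V) ∧
      (∀ (n : ℕ) (B : Set (Ultra.Smooth d)),
        Ultra.BoundedIn (Ultra.BVStep M (V.v n)) (Ultra.BVStepTop M (V.v n)) B →
        ∃ ψ ∈ Ultra.KBeurling d M, ∃ (m : ℕ) (A : Set (Ultra.Smooth d)),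
          Ultra.BoundedIn (Ultra.BVStep M (V.v m)) (Ultra.BVStepTop M (V.v m)) A ∧
          Ultra.ConvSetEq ψ A B) ∧
      (∀ B, Ultra.BoundedIn (Ultra.BVRoumieu M V) (Ultra.BVRoumieuTop M V) B →
        ∃ ψ ∈ Ultra.KRoumieu d M, ∃ A,
          Ultra.BoundedIn (Ultra.BVRoumieu M V) (Ultra.BVRoumieuTop M V) A ∧
          Ultra.ConvSetEq ψ A B)) := by
  exact ⟨fun W => ⟨Ultra.factorsThrough_BWBeurling hM hM' W,
      Ultra.factorsThrough_BWRoumieu hM hM' W,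
      fun _ hB => hB.exists_conv_BWBeurling hM hM', fun _ _ hB => hB.exists_conv_BWStep hM hM'⟩,
    fun V => ⟨Ultra.factorsThrough_BVBeurling hM hM' V, Ultra.factorsThrough_BVRoumieu hM hM' V,
      fun _ _ hB => hB.exists_conv_BVStep hM hM', fun _ hB => by
        obtain ⟨n, C, hC⟩ := hB.exists_bnd
        exact Ultra.exists_conv_of_bnd hM hM' hC⟩⟩
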